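/- **Setting.** Let $\mu>0$ and $1<p<1+\frac2\mu$ be such that $s\mapsto s^p$ is $C^4$ on $[0,\infty)$, and put $q=\frac1{p-1}$. Let $R^*,T^*>0$, let $\gamma_1,\gamma_2>0$ satisfy $\gamma_1+\gamma_2>\max\bigl(1,(\mu p2^p)^{1/(p-1)}\bigr)$, write $B_r=\{x\in\mathbb R:|x|<r\}$ and $$m:=2^{-p}(\gamma_1+\gamma_2)^p-\tfrac{\mu}{2}(\gamma_1+\gamma_2).$$ Assume: - (A1) $T_1<T^*$, where $T_1>0$ is the time at which $\hat\phi+\hat\psi\to\infty$ for the solution of $\hat\phi'=\hat\psi'=2^{-p}|\hat\phi+\hat\psi|^p-\frac\mu2(\hat\phi+\hat\psi)$, $\hat\phi(0)=\gamma_1$, $\hat\psi(0)=\gamma_2$; - (A2) $f\ge\gamma_1$ and $g\ge\gamma_2$ on $B_{R^*+T^*}$; - (A3) $f,g\in C^4(\overline{B_{R^*+T^*}})$; - (A4) there is $\varepsilon_0>0$ with $m\ge(2+\varepsilon_0)\bigl(|f'(x)|+|g'(x)|\bigr)$ for all $x\in B_{R^*+T^*}$; - (A5) there is $\varepsilon_1\ne-1$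 with $2^{-p}(2p-1)\bigl(1+\frac{\varepsilon_1}{2(1+\varepsilon_1)}\bigr)\bigl(1-\frac1{2p}\bigr)-2^{-p+1}p-\mu>0$ and $m\ge(2+\varepsilon_1)\bigl(|f'(x)|+|g'(x)|\bigr)$ for all $x\in B_{R^*+T^*}$. Let $(\phi,\psi)$ be the classical solution of $$(\partial_t-\partial_x)\phi=(\partial_t+\partial_x)\psi=2^{-p}|\phi+\psi|^p-\frac{\mu}{1+t}\,\frac{\phi+\psi}{2},\qquad \phi(x,0)=f(x),\quad \psi(x,0)=g(x),$$ with blow-up curve $T$ over $B_{R^*}$. This means that $0<T(x)\le T^*$ for $x\in B_{R^*}$; that $(\phi,\psi)$ solves the system on the union of the backward light cones $\{(y,s):s\ge0,\ |y-x|\le t-s\}$ with $x\in B_{R^*}$, $t<T(x)$, being continuous there and $C^1$ for positive times; and that, whenever $x\in B_{R^*}$ and $T(x)<T^*$, the function $\phi+\psi$ is unbounded on $\{x\}\times(0,T(x))$. Let $x_0\in B_{R^*}$. A *blow-up limit* at $x_0$ is a triple $(T_0,v_\phi,v_\psi)$ for which there are $\lambda_n>0$, $\lambda_n\to0$, such that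 $$\frac{T(x_0+\lambda_ny)-T(x_0)}{\lambda_n}\to T_0(y)\quad\text{locally uniformly on }\mathbb R,$$ $$\lambda_n^q\,\phi(x_0+\lambda_ny,T(x_0)+\lambda_ns)\to v_\phi(y,s),\qquad \lambda_n^q\,\psi(x_0+\lambda_ny,T(x_0)+\lambda_ns)\to v_\psi(y,s)$$ locally uniformly on $\Omega_0=\{(y,s):s<T_0(y)\}$. **Theorem 3.6 (Linear structure of the limiting blow-up curve).** For every blow-up limit $(T_0,v_\phi,v_\psi)$ at $x_0$ there exists $\alpha\in(-1,1)$ such that $T_0(y)=\alpha y$ for all $y\in\mathbb R$, and, for all $(y,s)$ with $s<\alpha y$, $$v_\phi(y,s)=V_{\phi,\alpha}(y,s):=C_{\phi,\alpha}(\alpha y-s)^{-q},\qquad v_\psi(y,s)=V_{\psi,\alpha}(y,s):=C_{\psi,\alpha}(\alpha y-s)^{-q},$$ where $C_{\phi,\alpha}=\frac{1-\alpha}2A$, $C_{\psi,\alpha}=\frac{1+\alpha}2A$ and $A>0$ is given by $A^{p-1}=2^{p-1}q(1-\alpha^2)$. -/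

import Mathlib

open Set Filter Topology

noncomputable section

namespace BlowUpCurve

/-- `T₁` is the blow-up time of the comparison system
`a' = b' = 2⁻ᵖ |a + b|ᵖ - (μ / 2) (a + b)`, `a 0 = γ₁`, `b 0 = γ₂`:
the solution exists on `[0, T₁)` and `a + b → ∞` at `T₁`. -/
def IsODEBlowUpTime (p μ γ₁ γ₂ T₁ : ℝ) : Prop :=
  0 < T₁ ∧ ∃ a b : ℝ → ℝ,
    ContinuousOn a (Ico 0 T₁) ∧ ContinuousOn b (Ico 0 T₁) ∧
    a 0 = γ₁ ∧ b 0 = γ₂ ∧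
    (∀ t ∈ Ioo 0 T₁,
      HasDerivAt a ((2 : ℝ) ^ (-p) * |a t + b t| ^ p - μ / 2 * (a t + b t)) t ∧
      HasDerivAt b ((2 : ℝ) ^ (-p) * |a t + b t| ^ p - μ / 2 * (a t + b t)) t) ∧
    Tendsto (fun t => a t + b t) (𝓝[<] T₁) atTop

/-- The standing conditions on the parameters and the assumptions A1-A5 on the initial data.
`R` and `Tmax` are the radius and the time horizon, denoted `R*` and `T*` on paper. -/
structure Assumptions (p μ γ₁ γ₂ R Tmax : ℝ) (f g : ℝ → ℝ) : Prop where
  one_lt_p : 1 < p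
  mu_pos : 0 < μ
  p_lt_glassey : p < 1 + 2 / μ
  nonlinearity_smooth : ContDiffOn ℝ 4 (fun s : ℝ => s ^ p) (Ici 0)
  R_pos : 0 < R
  Tmax_pos : 0 < Tmax
  gamma₁_pos : 0 < γ₁
  gamma₂_pos : 0 < γ₂
  gamma_large : max 1 ((μ * p * 2 ^ p) ^ (1 / (p - 1))) < γ₁ + γ₂
  A1 : ∃ T₁, IsODEBlowUpTime p μ γ₁ γ₂ T₁ ∧ T₁ < Tmax
  A2 : ∀ x, |x| < R + Tmax → γ₁ ≤ f x ∧ γ₂ ≤ g x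
  A3 : ContDiffOn ℝ 4 f (Icc (-(R + Tmax)) (R + Tmax)) ∧
    ContDiffOn ℝ 4 g (Icc (-(R + Tmax)) (R + Tmax))
  A4 : ∃ ε₀ : ℝ, 0 < ε₀ ∧ ∀ x, |x| < R + Tmax →
    (2 + ε₀) * (|deriv f x| + |deriv g x|) ≤
      (2 : ℝ) ^ (-p) * (γ₁ + γ₂) ^ p - μ / 2 * (γ₁ + γ₂)
  A5 : ∃ ε₁ : ℝ, ε₁ ≠ -1 ∧
    0 < (2 : ℝ) ^ (-p) * (2 * p - 1) * (1 + ε₁ / (2 * (1 + ε₁))) * (1 - 1 / (2 * p))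
        - (2 : ℝ) ^ (-p + 1) * p - μ ∧
    ∀ x, |x| < R + Tmax →
      (2 + ε₁) * (|deriv f x| + |deriv g x|) ≤
        (2 : ℝ) ^ (-p) * (γ₁ + γ₂) ^ p - μ / 2 * (γ₁ + γ₂)

/-- The closed backward light cone with vertex `(x, t)`, cut off at time zero. -/
def backwardCone (x t : ℝ) : Set (ℝ × ℝ) :=
  {z | 0 ≤ z.2 ∧ |z.1 - x| ≤ t - z.2}

/-- The union of the backward light cones with vertices `(x, t)`, `|x| < R`, `t < T x`:
the set `{|x| < R, 0 < t < T x}` together with its domain of dependence. -/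
def solutionDomain (R : ℝ) (T : ℝ → ℝ) : Set (ℝ × ℝ) :=
  {z | ∃ x t, |x| < R ∧ t < T x ∧ z ∈ backwardCone x t}

/-- `(φ, ψ)` (functions of `x` and `t`) is the classical solution of
`(∂ₜ - ∂ₓ) φ = (∂ₜ + ∂ₓ) ψ = 2⁻ᵖ |φ + ψ|ᵖ - μ / (1 + t) * (φ + ψ) / 2`,
`φ (x, 0) = f x`, `ψ (x, 0) = g x`, and, for `|x| < R`, `T x ∈ (0, Tmax]` is the supremum of the
times in `(0, Tmax)` up to which `∂ₜ u = (φ + ψ) / 2` stays finite at `x`: the solution exists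
before `T x`, and `φ + ψ` is unbounded there unless `T x` is the horizon `Tmax`. -/
structure IsSolutionWithBlowUpCurve (p μ R Tmax : ℝ) (f g : ℝ → ℝ) (φ ψ : ℝ → ℝ → ℝ)
    (T : ℝ → ℝ) : Prop where
  T_pos : ∀ x, |x| < R → 0 < T x
  T_le : ∀ x, |x| < R → T x ≤ Tmax
  continuousOn_φ : ContinuousOn (fun z : ℝ × ℝ => φ z.1 z.2) (solutionDomain R T)
  continuousOn_ψ : ContinuousOn (fun z : ℝ × ℝ => ψ z.1 z.2) (solutionDomain R T)
  contDiffOn_φ : ContDiffOn ℝ 1 (fun z : ℝ × ℝ => φ z.1 z.2)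
    (solutionDomain R T ∩ {z | 0 < z.2})
  contDiffOn_ψ : ContDiffOn ℝ 1 (fun z : ℝ × ℝ => ψ z.1 z.2)
    (solutionDomain R T ∩ {z | 0 < z.2})
  eq_φ : ∀ x t, (x, t) ∈ solutionDomain R T → 0 < t →
    deriv (fun t' => φ x t') t - deriv (fun x' => φ x' t) x =
      (2 : ℝ) ^ (-p) * |φ x t + ψ x t| ^ p - μ / (1 + t) * ((φ x t + ψ x t) / 2)
  eq_ψ : ∀ x t, (x, t) ∈ solutionDomain R T → 0 < t →
    deriv (fun t' => ψ x t') t + deriv (fun x' => ψ x' t) x =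
      (2 : ℝ) ^ (-p) * |φ x t + ψ x t| ^ p - μ / (1 + t) * ((φ x t + ψ x t) / 2)
  init_φ : ∀ x, (x, 0) ∈ solutionDomain R T → φ x 0 = f x
  init_ψ : ∀ x, (x, 0) ∈ solutionDomain R T → ψ x 0 = g x
  maximal : ∀ x, |x| < R → T x < Tmax →
    ¬ BddAbove ((fun t => |φ x t + ψ x t|) '' Ioo 0 (T x))

/-- The exponent `q = 1 / (p - 1)`. -/
def blowUpExponent (p : ℝ) : ℝ := 1 / (p - 1)

/-- The rescaling `l ^ q * u (x₀ + l y, T x₀ + l s)` of `u` about `(x₀, T x₀)`. -/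
def rescale (p : ℝ) (T : ℝ → ℝ) (x₀ l : ℝ) (u : ℝ → ℝ → ℝ) (y s : ℝ) : ℝ :=
  l ^ blowUpExponent p * u (x₀ + l * y) (T x₀ + l * s)

/-- The rescaled blow-up curve. -/
def rescaleCurve (T : ℝ → ℝ) (x₀ l y : ℝ) : ℝ := (T (x₀ + l * y) - T x₀) / l

/-- `(T₀, vφ, vψ)` is a blow-up limit at `x₀`: along some `l n ↓ 0` the rescaled curves converge
to `T₀` locally uniformly on `ℝ`, and the rescaled solutions converge to `vφ`, `vψ` locally
uniformly on `{(y, s) | s < T₀ y}`. Convergence of derivatives is not required, so that every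
limit in a finer topology (such as `C³` on compact sets) is a blow-up limit in this sense. -/
def IsBlowUpLimit (p : ℝ) (φ ψ : ℝ → ℝ → ℝ) (T : ℝ → ℝ) (x₀ : ℝ)
    (T₀ : ℝ → ℝ) (vφ vψ : ℝ → ℝ → ℝ) : Prop :=
  ∃ l : ℕ → ℝ, (∀ n, 0 < l n) ∧ Tendsto l atTop (𝓝 0) ∧
    TendstoLocallyUniformly (fun n y => rescaleCurve T x₀ (l n) y) T₀ atTop ∧
    TendstoLocallyUniformlyOn (fun n (z : ℝ × ℝ) => rescale p T x₀ (l n) φ z.1 z.2)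
      (fun z => vφ z.1 z.2) atTop {z | z.2 < T₀ z.1} ∧
    TendstoLocallyUniformlyOn (fun n (z : ℝ × ℝ) => rescale p T x₀ (l n) ψ z.1 z.2)
      (fun z => vψ z.1 z.2) atTop {z | z.2 < T₀ z.1}

/-- The positive number `A` with `A ^ (p - 1) = 2 ^ (p - 1) * q * (1 - α ^ 2)`, for `|α| < 1`. -/
def profileAmplitude (p α : ℝ) : ℝ :=
  (2 ^ (p - 1) * blowUpExponent p * (1 - α ^ 2)) ^ (1 / (p - 1))

/-- The self-similar profile `V_{φ,α}(y, s) = (1 - α) / 2 * A * (α y - s) ^ (-q)`. -/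
def profileφ (p α y s : ℝ) : ℝ :=
  (1 - α) / 2 * profileAmplitude p α * (α * y - s) ^ (-blowUpExponent p)

/-- The self-similar profile `V_{ψ,α}(y, s) = (1 + α) / 2 * A * (α y - s) ^ (-q)`. -/
def profileψ (p α y s : ℝ) : ℝ :=
  (1 + α) / 2 * profileAmplitude p α * (α * y - s) ^ (-blowUpExponent p)

end BlowUpCurve

end

/-! Write w = φ + ψ. The argument shows that T is differentiable at x₀ and that the rescaled
solutions converge pointwise along every sequence of scales. A blow-up limit is then identified by
uniqueness of limits, with α = T'(x₀); no compactness and no classification of global solutions is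
needed.

Comparison. Above `threshold` the source increases in w and in time, so the system is cooperative
and the solution can be compared with its translates (`TransportOn.lt_of_lt`). Since the factor in
A4 exceeds 2, the solution increases in all directions (a, b) with |a| ≤ (1 + κ) b, a cone strictly
wider than the light cone (`exists_monotone_cone`). Hence |∂ₓφ| ≤ θ ∂ₜφ and |∂ₓψ| ≤ θ ∂ₜψ with θ <
1, and T is θ-Lipschitz. The equations then make ∂ₜφ and ∂ₜψ comparable to w^p, so w^(1-p) is
comparable to T(x) - t (`BlowUpRegime.invPower_bounds`).

Decay of oscillation. Differentiating the equations, the ratios a = ∂ₓψ/∂ₜψ and b = ∂ₓφ/∂ₜφ satisfy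
(∂ₜ + ∂ₓ) a = κ (b - a) + O(1) and (∂ₜ - ∂ₓ) b = κ' (a - b) + O(1), with positive rates of the order
of 1/depth below the vertex of a backward cone. This is scale invariant: passing from depth S to
S/100 contracts the joint oscillation of a and b by a fixed factor, up to O(S)
(`ConeSystem.osc_step`). So at every point of the curve both ratios tend to one number β, uniformly
for approach from below (`BlowUpRegime.exists_slopeRatio_limit`).

Integration. It follows that ∇ w^(1-p) tends to -c (β, 1). As w^(1-p) vanishes at the curve,
integration gives w^(1-p) = c (-β (x - x₀) - (t - T(x₀))) up to first-order small terms
(`BlowUpRegime.invPower_expansion`). Its zero set yields T'(x₀) = -β, its rescaling the profile of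
w, and the limit (1 + β)/2 of ∂ₜφ/(∂ₜφ + ∂ₜψ) the split of w into φ and ψ. -/

namespace BlowUpCurve

/-! ### Barrier argument, differential inequalities, differentiation of the equation -/

/-- Two functions on a compact subset of space-time that are positive as soon as they are positive
at all earlier times are positive. -/
theorem pos_of_pos_before {K : Set (ℝ × ℝ)} (hK : IsCompact K) {A B : ℝ × ℝ → ℝ}
    (hA : ContinuousOn A K) (hB : ContinuousOn B K)
    (h : ∀ P ∈ K, (∀ Q ∈ K, Q.2 < P.2 → 0 < A Q ∧ 0 < B Q) → 0 < A P ∧ 0 < B P) :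
    ∀ P ∈ K, 0 < A P ∧ 0 < B P := by
  have hN : IsCompact ((K ∩ A ⁻¹' Iic 0) ∪ (K ∩ B ⁻¹' Iic 0)) := by
    refine hK.of_isClosed_subset ((hA.preimage_isClosed_of_isClosed hK.isClosed isClosed_Iic).union
      (hB.preimage_isClosed_of_isClosed hK.isClosed isClosed_Iic)) ?_
    exact union_subset inter_subset_left inter_subset_left
  rcases (((K ∩ A ⁻¹' Iic 0) ∪ (K ∩ B ⁻¹' Iic 0))).eq_empty_or_nonempty with he | hne
  · intro P hP
    have h1 : P ∉ ((K ∩ A ⁻¹' Iic 0) ∪ (K ∩ B ⁻¹' Iic 0)) := by rw [he]; exact notMem_empty P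
    simp only [mem_union, mem_inter_iff, mem_preimage, mem_Iic, not_or, not_and, not_le] at h1
    exact ⟨h1.1 hP, h1.2 hP⟩
  · exfalso
    -- A point of least time in the bad set: everything earlier is positive, so the hypothesis
    -- applies there.
    obtain ⟨P, hP, hmin⟩ := hN.exists_isMinOn hne continuous_snd.continuousOn
    have hPK : P ∈ K := hP.elim (fun h => h.1) (fun h => h.1)
    have := h P hPK (fun Q hQ hlt => by
      by_contra hcon
      have hQN : Q ∈ ((K ∩ A ⁻¹' Iic 0) ∪ (K ∩ B ⁻¹' Iic 0)) := by
        simp only [mem_union, mem_inter_iff, mem_preimage, mem_Iic]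
        by_contra h2
        simp only [not_or, not_and, not_le] at h2
        exact hcon ⟨h2.1 hQ, h2.2 hQ⟩
      exact absurd (hmin hQN) (not_le.2 hlt))
    rcases hP with hP | hP
    · exact absurd this.1 (not_lt.2 hP.2)
    · exact absurd this.2 (not_lt.2 hP.2)

/-- A lower bound on the derivative inside an interval bounds the increment from below. -/
theorem mul_sub_le_of_hasDerivAt {f f' : ℝ → ℝ} {s t C : ℝ} (hst : s ≤ t)
    (hc : ContinuousOn f (Icc s t)) (hd : ∀ τ ∈ Ioo s t, HasDerivAt f (f' τ) τ)
    (hC : ∀ τ ∈ Ioo s t, C ≤ f' τ) : C * (t - s) ≤ f t - f s := by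
  refine (convex_Icc s t).mul_sub_le_image_sub_of_le_deriv hc ?_ ?_ s (left_mem_Icc.2 hst) t
    (right_mem_Icc.2 hst) hst
  · rw [interior_Icc]
    exact fun τ hτ => (hd τ hτ).differentiableAt.differentiableWithinAt
  · rw [interior_Icc]
    exact fun τ hτ => by rw [(hd τ hτ).deriv]; exact hC τ hτ

/-- An upper bound on the derivative inside an interval bounds the increment from above. -/
theorem sub_le_mul_of_hasDerivAt {f f' : ℝ → ℝ} {s t C : ℝ} (hst : s ≤ t)
    (hc : ContinuousOn f (Icc s t)) (hd : ∀ τ ∈ Ioo s t, HasDerivAt f (f' τ) τ)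
    (hC : ∀ τ ∈ Ioo s t, f' τ ≤ C) : f t - f s ≤ C * (t - s) := by
  have := mul_sub_le_of_hasDerivAt (f := fun τ => -f τ) (f' := fun τ => -f' τ) (C := -C) hst hc.neg
    (fun τ hτ => (hd τ hτ).neg) (fun τ hτ => neg_le_neg (hC τ hτ))
  linarith

/-- A damped growth estimate: if `h' ≥ -C h + V'` with `V' ≥ 0`, then
`exp (C (t - s)) h t ≥ h s + (V t - V s)`. -/
theorem add_sub_le_exp_mul {h h' V V' : ℝ → ℝ} {s t C : ℝ} (hst : s ≤ t) (hC : 0 ≤ C)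
    (hc : ContinuousOn h (Icc s t)) (hVc : ContinuousOn V (Icc s t))
    (hd : ∀ τ ∈ Ioo s t, HasDerivAt h (h' τ) τ) (hV : ∀ τ ∈ Ioo s t, HasDerivAt V (V' τ) τ)
    (hV0 : ∀ τ ∈ Ioo s t, 0 ≤ V' τ) (hle : ∀ τ ∈ Ioo s t, V' τ - C * h τ ≤ h' τ) :
    h s + (V t - V s) ≤ Real.exp (C * (t - s)) * h t := by
  -- With the integrating factor, `exp (C (τ - s)) h - V` is nondecreasing; since the factor is at
  -- least 1 and `V' ≥ 0`, it may be dropped in front of `V'`.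
  have := mul_sub_le_of_hasDerivAt (f := fun τ => Real.exp (C * (τ - s)) * h τ - V τ)
    (f' := fun τ => Real.exp (C * (τ - s)) * C * h τ + Real.exp (C * (τ - s)) * h' τ - V' τ)
    (C := 0) hst ?_ ?_ ?_
  · simp only [sub_self, mul_zero, Real.exp_zero, zero_mul, one_mul] at this
    linarith
  · exact (ContinuousOn.mul (by fun_prop) hc).sub hVc
  · intro τ hτ
    have h1 : HasDerivAt (fun τ => Real.exp (C * (τ - s))) (Real.exp (C * (τ - s)) * C) τ := by
      have := (((hasDerivAt_id τ).sub_const s).const_mul C).exp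
      simpa using this
    exact (h1.mul (hd τ hτ)).sub (hV τ hτ)
  · intro τ hτ
    have h1 : 1 ≤ Real.exp (C * (τ - s)) := Real.one_le_exp (mul_nonneg hC (by linarith [hτ.1]))
    have h2 := hle τ hτ
    have h3 := hV0 τ hτ
    have h4 : Real.exp (C * (τ - s)) * V' τ ≤ Real.exp (C * (τ - s)) * (C * h τ + h' τ) :=
      mul_le_mul_of_nonneg_left (by linarith) (by linarith)
    have h5 : V' τ ≤ Real.exp (C * (τ - s)) * V' τ := le_mul_of_one_le_left h3 h1
    nlinarith

/-- If `Φ` and its derivative `H` in the direction `n` are `C¹`, then the derivative of `Φ` in a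
direction `e` is differentiable in the direction `n`, with derivative `∂ₑ H`. -/
theorem hasDerivAt_fderiv_of_fderiv_eq {E : Type*} [NormedAddCommGroup E] [NormedSpace ℝ E]
    {U : Set E} (hU : IsOpen U) {Φ H : E → ℝ} (hΦ : ContDiffOn ℝ 1 Φ U) (hH : ContDiffOn ℝ 1 H U)
    {n e : E} (hn : ∀ z ∈ U, fderiv ℝ Φ z n = H z) {z : E} (hz : z ∈ U) :
    HasDerivAt (fun τ : ℝ => fderiv ℝ Φ (z + τ • n) e) (fderiv ℝ H z e) 0 := by
  have hstrict : HasStrictFDerivAt H (fderiv ℝ H z) z :=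
    (hH.contDiffAt (hU.mem_nhds hz)).hasStrictFDerivAt one_ne_zero
  have hdiff : ∀ w ∈ U, HasFDerivAt Φ (fderiv ℝ Φ w) w := fun w hw =>
    ((hΦ.contDiffAt (hU.mem_nhds hw)).differentiableAt one_ne_zero).hasFDerivAt
  rw [hasDerivAt_iff_isLittleO, Asymptotics.isLittleO_iff]
  intro c hc
  obtain ⟨c', hc', hcc'⟩ : ∃ c' > 0, c' * ‖e‖ ≤ c := by
    refine ⟨c / (‖e‖ + 1), by positivity, ?_⟩
    rw [div_mul_eq_mul_div, div_le_iff₀ (by positivity)]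
    nlinarith [norm_nonneg e]
  -- Strict differentiability is needed here: increments of `H` are taken at the moving base points
  -- `z + σ • n`.
  have hev := hstrict.isLittleO.def hc'
  rw [nhds_prod_eq, Filter.eventually_iff, Filter.mem_prod_same_iff] at hev
  obtain ⟨N, hN, hNsub⟩ := hev
  obtain ⟨r, hr, hball⟩ := Metric.mem_nhds_iff.1 (inter_mem hN (hU.mem_nhds hz))
  have hsmall : ∀ᶠ τ : ℝ in 𝓝 0, ‖τ • n‖ < r / 2 := by
    have : Tendsto (fun τ : ℝ => ‖τ • n‖) (𝓝 0) (𝓝 ‖(0 : ℝ) • n‖) :=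
      (Continuous.tendsto (by fun_prop) 0)
    rw [zero_smul, norm_zero] at this
    exact this.eventually (gt_mem_nhds (by linarith))
  have hsmall' : ∀ᶠ s : ℝ in 𝓝 0, ‖s • e‖ < r / 2 := by
    have : Tendsto (fun τ : ℝ => ‖τ • e‖) (𝓝 0) (𝓝 ‖(0 : ℝ) • e‖) :=
      (Continuous.tendsto (by fun_prop) 0)
    rw [zero_smul, norm_zero] at this
    exact this.eventually (gt_mem_nhds (by linarith))
  filter_upwards [hsmall] with τ hτ
  simp only [zero_smul, add_zero, sub_zero, smul_eq_mul]
  have hin : ∀ σ s : ℝ, |σ| ≤ |τ| → ‖s • e‖ < r / 2 → z + σ • n + s • e ∈ Metric.ball z r := by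
    intro σ s hσ hs
    rw [mem_ball_iff_norm]
    have h1 : ‖σ • n‖ ≤ ‖τ • n‖ := by
      rw [norm_smul, norm_smul]
      exact mul_le_mul_of_nonneg_right hσ (norm_nonneg _)
    calc ‖z + σ • n + s • e - z‖ = ‖σ • n + s • e‖ := by congr 1; abel
      _ ≤ ‖σ • n‖ + ‖s • e‖ := norm_add_le _ _
      _ < r := by linarith
  have hline : ∀ σ s : ℝ, |σ| ≤ |τ| → ‖s • e‖ < r / 2 →
      HasDerivAt (fun σ : ℝ => Φ (z + σ • n + s • e)) (H (z + σ • n + s • e)) σ := by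
    intro σ s hσ hs
    have hm := (hball (hin σ s hσ hs)).2
    have h1 : HasDerivAt (fun σ : ℝ => z + σ • n + s • e) n σ := by
      simpa using (((hasDerivAt_id σ).smul_const n).const_add z).add_const (s • e)
    have := (hdiff _ hm).comp_hasDerivAt σ h1
    rwa [hn _ hm] at this
  have h0e : ‖(0 : ℝ) • e‖ < r / 2 := by rw [zero_smul, norm_zero]; linarith
  -- A second difference stands in for the mixed derivative, which need not exist for a `C¹`
  -- function. Its `s`-derivative at 0 is the quantity to bound; the mean value theorem in `σ` along
  -- `n` shows that it is `c |τ|`-Lipschitz at 0.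
  have hj : HasDerivAt (fun s : ℝ => Φ (z + τ • n + s • e) - Φ (z + s • e) - τ * s * fderiv ℝ H z e)
      (fderiv ℝ Φ (z + τ • n) e - fderiv ℝ Φ z e - τ * fderiv ℝ H z e) 0 := by
    have hd : ∀ w ∈ U, HasDerivAt (fun s : ℝ => Φ (w + s • e)) (fderiv ℝ Φ w e) 0 := by
      intro w hw
      have h1 : HasDerivAt (fun s : ℝ => w + s • e) e 0 := by
        simpa using ((hasDerivAt_id (0 : ℝ)).smul_const e).const_add w
      have h2 : HasFDerivAt Φ (fderiv ℝ Φ w) (w + (0 : ℝ) • e) := by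
        rw [zero_smul, add_zero]; exact hdiff w hw
      exact h2.comp_hasDerivAt 0 h1
    have hm1 : z + τ • n ∈ U := by
      have := (hball (hin τ 0 le_rfl h0e)).2
      simpa using this
    have h3 : HasDerivAt (fun s : ℝ => τ * s * fderiv ℝ H z e) (τ * fderiv ℝ H z e) 0 := by
      simpa using ((hasDerivAt_id (0 : ℝ)).const_mul τ).mul_const (fderiv ℝ H z e)
    exact ((hd _ hm1).sub (hd z hz)).sub h3
  have hfin := hj.le_of_lip' (C := c * ‖τ‖) (by positivity) ?_
  · rw [Real.norm_eq_abs] at hfin ⊢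
    exact hfin
  · filter_upwards [hsmall'] with s hs
    simp only [zero_smul, add_zero, sub_zero, mul_zero, zero_mul]
    have hk : ∀ σ ∈ uIcc 0 τ, HasDerivWithinAt
        (fun σ : ℝ => Φ (z + σ • n + s • e) - Φ (z + σ • n) - σ * s * fderiv ℝ H z e)
        (H (z + σ • n + s • e) - H (z + σ • n) - s * fderiv ℝ H z e) (uIcc 0 τ) σ := by
      intro σ hσ
      have hσ' : |σ| ≤ |τ| := by simpa using abs_sub_left_of_mem_uIcc hσ
      have h1 := hline σ s hσ' hs
      have h2 := hline σ 0 hσ' h0e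
      simp only [zero_smul, add_zero] at h2
      have h3 : HasDerivAt (fun σ : ℝ => σ * s * fderiv ℝ H z e) (s * fderiv ℝ H z e) σ := by
        simpa using ((hasDerivAt_id σ).mul_const s).mul_const (fderiv ℝ H z e)
      exact ((h1.sub h2).sub h3).hasDerivWithinAt
    have hb : ∀ σ ∈ uIcc 0 τ,
        ‖H (z + σ • n + s • e) - H (z + σ • n) - s * fderiv ℝ H z e‖ ≤ c * ‖s‖ := by
      intro σ hσ
      have hσ' : |σ| ≤ |τ| := by simpa using abs_sub_left_of_mem_uIcc hσ
      have h1 := (hball (hin σ s hσ' hs)).1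
      have h2 := (hball (hin σ 0 hσ' h0e)).1
      simp only [zero_smul, add_zero] at h2
      have h3 := hNsub (mk_mem_prod h1 h2)
      simp only [mem_ofPred_eq, add_sub_cancel_left, map_smul, smul_eq_mul] at h3
      refine h3.trans ?_
      rw [norm_smul]
      nlinarith [norm_nonneg s]
    have := (convex_uIcc 0 τ).norm_image_sub_le_of_norm_hasDerivWithin_le hk hb left_mem_uIcc
      right_mem_uIcc
    simp only [zero_smul, add_zero, sub_zero, zero_mul] at this
    calc _ = _ := ?_
      _ ≤ _ := this
      _ = _ := by ring
    congr 1; ring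

/-! ### Relaxation systems on truncated cones: minimum principle and mixing -/

/-- The part of the closed backward light cone with vertex `(x₁, T₁)` at depths between `d`
and `S` below the vertex. -/
def trapezoid (x₁ T₁ d S : ℝ) : Set (ℝ × ℝ) :=
  {z | d ≤ T₁ - z.2 ∧ T₁ - z.2 ≤ S ∧ |z.1 - x₁| ≤ T₁ - z.2}

theorem isCompact_trapezoid (x₁ T₁ d S : ℝ) : IsCompact (trapezoid x₁ T₁ d S) := by
  have hsub : trapezoid x₁ T₁ d S ⊆ Icc (x₁ - S) (x₁ + S) ×ˢ Icc (T₁ - S) (T₁ - d) := by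
    rintro ⟨x, t⟩ ⟨h1, h2, h3⟩
    simp only [abs_le] at h1 h2 h3
    refine ⟨⟨?_, ?_⟩, ?_, ?_⟩ <;> simp only <;> linarith [h3.1, h3.2]
  refine (isCompact_Icc.prod isCompact_Icc).of_isClosed_subset ?_ hsub
  have h1 : IsClosed {z : ℝ × ℝ | d ≤ T₁ - z.2} := isClosed_le (by fun_prop) (by fun_prop)
  have h2 : IsClosed {z : ℝ × ℝ | T₁ - z.2 ≤ S} := isClosed_le (by fun_prop) (by fun_prop)
  have h3 : IsClosed {z : ℝ × ℝ | |z.1 - x₁| ≤ T₁ - z.2} :=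
    isClosed_le (by fun_prop) (by fun_prop)
  exact h1.inter (h2.inter h3)

theorem left_line_mem_trapezoid {x₁ T₁ d S ξ t τ : ℝ} (h : (ξ - t, t) ∈ trapezoid x₁ T₁ d S)
    (h1 : T₁ - S ≤ τ) (h2 : τ ≤ t) : (ξ - τ, τ) ∈ trapezoid x₁ T₁ d S := by
  obtain ⟨a, b, c⟩ := h
  simp only [abs_le] at a b c
  refine ⟨?_, ?_, ?_⟩ <;> simp only [abs_le]
  · linarith
  · linarith
  · constructor <;> linarith [c.1, c.2]

theorem right_line_mem_trapezoid {x₁ T₁ d S ξ t τ : ℝ} (h : (ξ + t, t) ∈ trapezoid x₁ T₁ d S)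
    (h1 : T₁ - S ≤ τ) (h2 : τ ≤ t) : (ξ + τ, τ) ∈ trapezoid x₁ T₁ d S := by
  obtain ⟨a, b, c⟩ := h
  simp only [abs_le] at a b c
  refine ⟨?_, ?_, ?_⟩ <;> simp only [abs_le]
  · linarith
  · linarith
  · constructor <;> linarith [c.1, c.2]

/-- `(u, v)` is a supersolution on `K` of a relaxation system
`(∂ₜ + ∂ₓ) u = κ (v - u)`, `(∂ₜ - ∂ₓ) v = κ' (u - v)` with rates between `c` and `C`. -/
structure IsRelaxing (K : Set (ℝ × ℝ)) (u v : ℝ × ℝ → ℝ) (c C : ℝ) : Prop where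
  cont_u : ContinuousOn u K
  cont_v : ContinuousOn v K
  right : ∀ ξ τ, (ξ + τ, τ) ∈ K → ∃ u' κ, c ≤ κ ∧ κ ≤ C ∧
    HasDerivAt (fun τ => u (ξ + τ, τ)) u' τ ∧ κ * (v (ξ + τ, τ) - u (ξ + τ, τ)) ≤ u'
  left : ∀ ξ τ, (ξ - τ, τ) ∈ K → ∃ v' κ, c ≤ κ ∧ κ ≤ C ∧
    HasDerivAt (fun τ => v (ξ - τ, τ)) v' τ ∧ κ * (u (ξ - τ, τ) - v (ξ - τ, τ)) ≤ v'

/-- In `κ (g - h)` the gain `κ g` is bounded by the least rate and the loss `κ h` by the greatest,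
which leaves a damped growth inequality. `V` is a primitive of a lower bound for the gain; `V = 0`
expresses plain propagation. -/
theorem relax_line {h g V V' : ℝ → ℝ} {s t c C : ℝ} (hst : s ≤ t) (hc0 : 0 ≤ c) (hcC : c ≤ C)
    (hd : ∀ τ ∈ Icc s t, ∃ h' κ, c ≤ κ ∧ κ ≤ C ∧ HasDerivAt h h' τ ∧ κ * (g τ - h τ) ≤ h')
    (hV : ∀ τ ∈ Icc s t, HasDerivAt V (V' τ) τ)
    (hh : ∀ τ ∈ Ioo s t, 0 ≤ h τ) (hg : ∀ τ ∈ Ioo s t, 0 ≤ g τ) (hV0 : ∀ τ ∈ Ioo s t, 0 ≤ V' τ)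
    (hVg : ∀ τ ∈ Ioo s t, V' τ ≤ c * g τ) :
    h s + (V t - V s) ≤ Real.exp (C * (t - s)) * h t := by
  have hdd : ∀ τ ∈ Icc s t, HasDerivAt h (deriv h τ) τ := fun τ hτ => by
    obtain ⟨h', κ, -, -, h3, -⟩ := hd τ hτ
    exact h3.differentiableAt.hasDerivAt
  refine add_sub_le_exp_mul hst (hc0.trans hcC) (fun τ hτ => (hdd τ hτ).continuousAt.continuousWithinAt)
    (fun τ hτ => (hV τ hτ).continuousAt.continuousWithinAt)
    (fun τ hτ => hdd τ (Ioo_subset_Icc_self hτ)) (fun τ hτ => hV τ (Ioo_subset_Icc_self hτ)) hV0 ?_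
  intro τ hτ
  obtain ⟨h', κ, h1, h2, h3, h4⟩ := hd τ (Ioo_subset_Icc_self hτ)
  rw [h3.deriv]
  have h5 := hVg τ hτ
  have h6 := mul_le_mul_of_nonneg_right h1 (hg τ hτ)
  have h7 := mul_le_mul_of_nonneg_right h2 (hh τ hτ)
  linarith

/-- A component with a nonnegative partner decays at most exponentially along its characteristic, so
it cannot be the first to reach zero. The system sees only `u - v`, so adding `η` to both makes the
base data strictly positive without changing it. -/
theorem IsRelaxing.nonneg {x₁ T₁ d S c C : ℝ} {u v : ℝ × ℝ → ℝ}
    (h : IsRelaxing (trapezoid x₁ T₁ d S) u v c C) (hc0 : 0 ≤ c) (hcC : c ≤ C)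
    (hu : ∀ z ∈ trapezoid x₁ T₁ d S, T₁ - z.2 = S → 0 ≤ u z)
    (hv : ∀ z ∈ trapezoid x₁ T₁ d S, T₁ - z.2 = S → 0 ≤ v z) :
    ∀ z ∈ trapezoid x₁ T₁ d S, 0 ≤ u z ∧ 0 ≤ v z := by
  suffices hη : ∀ η > 0, ∀ z ∈ trapezoid x₁ T₁ d S, 0 < u z + η ∧ 0 < v z + η by
    intro z hz
    constructor <;> refine le_of_forall_pos_lt_add fun η hp => ?_
    · exact (hη η hp z hz).1
    · exact (hη η hp z hz).2
  intro η hη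
  refine pos_of_pos_before (isCompact_trapezoid _ _ _ _) (h.cont_u.add continuousOn_const)
    (h.cont_v.add continuousOn_const) ?_
  rintro ⟨x, t⟩ hP hbefore
  have htS : T₁ - S ≤ t := by have := hP.2.1; simp only at this; linarith
  constructor
  · have hP' : (x - t + t, t) ∈ trapezoid x₁ T₁ d S := by rwa [sub_add_cancel]
    have hb := right_line_mem_trapezoid hP' le_rfl htS
    have key := relax_line (h := fun τ => u (x - t + τ, τ) + η) (g := fun τ => v (x - t + τ, τ) + η)
      (V := fun _ => 0) (V' := fun _ => 0) htS hc0 hcC (fun τ hτ => ?_)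
      (fun τ _ => hasDerivAt_const τ 0) (fun τ hτ => ?_) (fun τ hτ => ?_) (fun τ _ => le_rfl)
      (fun τ hτ => ?_)
    · simp only [sub_add_cancel, sub_zero, add_zero] at key
      have h0 := hu _ hb (by simp)
      exact pos_of_mul_pos_right (by linarith) (Real.exp_pos _).le
    · obtain ⟨u', κ, h1, h2, h3, h4⟩ := h.right _ _ (right_line_mem_trapezoid hP' hτ.1 hτ.2)
      exact ⟨u', κ, h1, h2, h3.add_const η, by simpa using h4⟩
    · exact (hbefore _ (right_line_mem_trapezoid hP' hτ.1.le hτ.2.le) hτ.2).1.le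
    · exact (hbefore _ (right_line_mem_trapezoid hP' hτ.1.le hτ.2.le) hτ.2).2.le
    · exact mul_nonneg hc0 (hbefore _ (right_line_mem_trapezoid hP' hτ.1.le hτ.2.le) hτ.2).2.le
  · have hP' : (x + t - t, t) ∈ trapezoid x₁ T₁ d S := by rwa [add_sub_cancel_right]
    have hb := left_line_mem_trapezoid hP' le_rfl htS
    have key := relax_line (h := fun τ => v (x + t - τ, τ) + η) (g := fun τ => u (x + t - τ, τ) + η)
      (V := fun _ => 0) (V' := fun _ => 0) htS hc0 hcC (fun τ hτ => ?_)
      (fun τ _ => hasDerivAt_const τ 0) (fun τ hτ => ?_) (fun τ hτ => ?_) (fun τ _ => le_rfl)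
      (fun τ hτ => ?_)
    · simp only [add_sub_cancel_right, sub_zero, add_zero] at key
      have h0 := hv _ hb (by simp)
      exact pos_of_mul_pos_right (by linarith) (Real.exp_pos _).le
    · obtain ⟨u', κ, h1, h2, h3, h4⟩ := h.left _ _ (left_line_mem_trapezoid hP' hτ.1 hτ.2)
      exact ⟨u', κ, h1, h2, h3.add_const η, by simpa using h4⟩
    · exact (hbefore _ (left_line_mem_trapezoid hP' hτ.1.le hτ.2.le) hτ.2).2.le
    · exact (hbefore _ (left_line_mem_trapezoid hP' hτ.1.le hτ.2.le) hτ.2).1.le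
    · exact mul_nonneg hc0 (hbefore _ (left_line_mem_trapezoid hP' hτ.1.le hτ.2.le) hτ.2).1.le

/-- The fraction of the mean of a supersolution over the base of a trapezoid that is seen
pointwise at one hundredth of its depth, when the rates lie between `k / S` and `K / S`. -/
noncomputable def mixingConst (k K : ℝ) : ℝ :=
  min (0.8 * k * Real.exp (-(2 * K))) (0.072 * k ^ 2 * Real.exp (-(3 * K)))

theorem mixingConst_pos {k K : ℝ} (hk : 0 < k) : 0 < mixingConst k K := by
  unfold mixingConst; positivity

/-- A left-going characteristic that ends near the vertex crosses the right-going ones issuing from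
the middle of the base, so `v` collects there the mean of `u`; during the remaining time `u`
collects from `v`. Only a mean of `u` is assumed large, which is why two stages are needed to reach
both components pointwise. -/
theorem IsRelaxing.mixing {x₁ T₁ S k K L : ℝ} {u v : ℝ × ℝ → ℝ} {U : ℝ → ℝ} (hS : 0 < S)
    (h : IsRelaxing (trapezoid x₁ T₁ (S / 100) S) u v (k / S) (K / S)) (hk : 0 < k) (hkK : k ≤ K)
    (hL : 0 ≤ L)
    (hu : ∀ z ∈ trapezoid x₁ T₁ (S / 100) S, T₁ - z.2 = S → 0 ≤ u z)
    (hv : ∀ z ∈ trapezoid x₁ T₁ (S / 100) S, T₁ - z.2 = S → 0 ≤ v z)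
    (hU : ∀ y ∈ Icc (x₁ - S) (x₁ + S), HasDerivAt U (u (y, T₁ - S)) y)
    (hUL : L * (1.6 * S) ≤ U (x₁ + 0.8 * S) - U (x₁ - 0.8 * S)) :
    ∀ z ∈ trapezoid x₁ T₁ (S / 100) S, T₁ - z.2 = S / 100 →
      mixingConst k K * L ≤ u z ∧ mixingConst k K * L ≤ v z := by
  have hc0 : 0 ≤ k / S := by positivity
  have hcC : k / S ≤ K / S := by gcongr
  have hnn := h.nonneg hc0 hcC hu hv
  have hexp : ∀ s t : ℝ, t - s ≤ S → Real.exp (K / S * (t - s)) ≤ Real.exp K := by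
    intro s t hst
    apply Real.exp_le_exp.2
    calc K / S * (t - s) ≤ K / S * S := by
          apply mul_le_mul_of_nonneg_left hst (hc0.trans hcC)
      _ = K := by field_simp
  have hUmono : MonotoneOn U (Icc (x₁ - S) (x₁ + S)) := by
    refine monotoneOn_of_deriv_nonneg (convex_Icc _ _)
      (fun y hy => (hU y hy).continuousAt.continuousWithinAt)
      (fun y hy => (hU y (interior_subset hy)).differentiableAt.differentiableWithinAt) ?_
    intro y hy
    have hy' := interior_subset hy
    rw [(hU y hy').deriv]
    refine hu _ ⟨?_, ?_, ?_⟩ ?_ <;> simp only [sub_sub_cancel]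
    · linarith
    · exact le_rfl
    · rw [abs_le]; constructor <;> linarith [hy'.1, hy'.2]
  -- the values of `u` at the base propagate to the right
  have hprop : ∀ ξ t, (ξ + t, t) ∈ trapezoid x₁ T₁ (S / 100) S →
      Real.exp (-K) * u (ξ + (T₁ - S), T₁ - S) ≤ u (ξ + t, t) := by
    intro ξ t hP
    have htS : T₁ - S ≤ t := by have := hP.2.1; simp only at this; linarith
    have htS' : t - (T₁ - S) ≤ S := by have := hP.1; simp only at this; linarith
    have key := relax_line (h := fun τ => u (ξ + τ, τ)) (g := fun τ => v (ξ + τ, τ))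
      (V := fun _ => 0) (V' := fun _ => 0) htS hc0 hcC
      (fun τ hτ => h.right _ _ (right_line_mem_trapezoid hP hτ.1 hτ.2))
      (fun τ _ => hasDerivAt_const τ 0)
      (fun τ hτ => (hnn _ (right_line_mem_trapezoid hP hτ.1.le hτ.2.le)).1)
      (fun τ hτ => (hnn _ (right_line_mem_trapezoid hP hτ.1.le hτ.2.le)).2) (fun τ _ => le_rfl)
      (fun τ hτ => mul_nonneg hc0 (hnn _ (right_line_mem_trapezoid hP hτ.1.le hτ.2.le)).2)
    simp only [sub_zero, add_zero] at key
    have h1 := key.trans (mul_le_mul_of_nonneg_right (hexp _ _ htS') (hnn _ hP).1)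
    calc Real.exp (-K) * u (ξ + (T₁ - S), T₁ - S)
        ≤ Real.exp (-K) * (Real.exp K * u (ξ + t, t)) := by gcongr
      _ = u (ξ + t, t) := by rw [← mul_assoc, ← Real.exp_add]; simp
  have hvlow : ∀ z ∈ trapezoid x₁ T₁ (S / 100) S, T₁ - z.2 ≤ S / 10 →
      0.8 * k * Real.exp (-(2 * K)) * L ≤ v z := by
    rintro ⟨x, t⟩ hP hdepth
    have hP' : (x + t - t, t) ∈ trapezoid x₁ T₁ (S / 100) S := by rwa [add_sub_cancel_right]
    have hx := hP.2.2
    have hd1 := hP.1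
    simp only [abs_le] at hx hdepth hd1
    have htS : T₁ - S ≤ t := by linarith
    have hrel : ∀ τ ∈ Icc (T₁ - S) t, x + t - 2 * τ + (T₁ - S) ∈ Icc (x₁ - S) (x₁ + S) := by
      rintro τ ⟨h1, h2⟩
      constructor <;> linarith [hx.1, hx.2]
    have hfoot : ∀ τ ∈ Icc (T₁ - S) t, 0 ≤ u (x + t - 2 * τ + (T₁ - S), T₁ - S) := by
      rintro τ hτ
      have := hrel τ hτ
      refine hu _ ⟨?_, ?_, ?_⟩ ?_ <;> simp only [sub_sub_cancel]
      · linarith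
      · exact le_rfl
      · rw [abs_le]; constructor <;> linarith [this.1, this.2]
    -- The right-going characteristic met at time `τ` has its foot at `x + t - 2τ + (T₁ - S)`. The
    -- foot moves left at speed 2, hence the factor -1/2 in the primitive `V`.
    have key := relax_line (h := fun τ => v (x + t - τ, τ)) (g := fun τ => u (x + t - τ, τ))
      (V := fun τ => -(k / S * Real.exp (-K) / 2) * U (x + t - 2 * τ + (T₁ - S)))
      (V' := fun τ => k / S * Real.exp (-K) * u (x + t - 2 * τ + (T₁ - S), T₁ - S)) htS hc0 hcC
      (fun τ hτ => h.left _ _ (left_line_mem_trapezoid hP' hτ.1 hτ.2)) ?_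
      (fun τ hτ => (hnn _ (left_line_mem_trapezoid hP' hτ.1.le hτ.2.le)).2)
      (fun τ hτ => (hnn _ (left_line_mem_trapezoid hP' hτ.1.le hτ.2.le)).1)
      (fun τ hτ => mul_nonneg (by positivity) (hfoot τ (Ioo_subset_Icc_self hτ))) ?_
    · simp only [add_sub_cancel_right] at key
      have hb := (hnn _ (left_line_mem_trapezoid hP' le_rfl htS)).2
      -- At depth `d ≤ S / 10`, where `|x - x₁| ≤ d`, the feet run from `x + S - d` to `x - S + d`
      -- and so cover the interval of radius `0.8 S` about `x₁`.
      have hU1 : U (x₁ + 0.8 * S) ≤ U (x + t - 2 * (T₁ - S) + (T₁ - S)) := by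
        apply hUmono _ (hrel _ ⟨le_rfl, htS⟩)
        · linarith [hx.1]
        · constructor <;> linarith
      have hU2 : U (x + t - 2 * t + (T₁ - S)) ≤ U (x₁ - 0.8 * S) := by
        apply hUmono (hrel _ ⟨htS, le_rfl⟩)
        · constructor <;> linarith
        · linarith [hx.2]
      have h1 := key.trans (mul_le_mul_of_nonneg_right (hexp _ _ (by linarith)) (hnn _ hP).2)
      have h2 : k / S * Real.exp (-K) / 2 * (L * (1.6 * S)) ≤ Real.exp K * v (x, t) := by
        have : k / S * Real.exp (-K) / 2 * (L * (1.6 * S)) ≤ k / S * Real.exp (-K) / 2 *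
            (U (x + t - 2 * (T₁ - S) + (T₁ - S)) - U (x + t - 2 * t + (T₁ - S))) := by
          apply mul_le_mul_of_nonneg_left _ (by positivity)
          linarith
        linarith
      have h3 : k / S * Real.exp (-K) / 2 * (L * (1.6 * S)) = 0.8 * k * Real.exp (-K) * L := by
        field_simp; ring
      rw [h3] at h2
      calc 0.8 * k * Real.exp (-(2 * K)) * L
          = Real.exp (-K) * (0.8 * k * Real.exp (-K) * L) := by
            rw [show -(2 * K) = -K + -K by ring, Real.exp_add]; ring
        _ ≤ Real.exp (-K) * (Real.exp K * v (x, t)) := by gcongr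
        _ = v (x, t) := by rw [← mul_assoc, ← Real.exp_add]; simp
    · intro τ hτ
      have hl : HasDerivAt (fun τ => x + t - 2 * τ + (T₁ - S)) (-2) τ := by
        have := (((hasDerivAt_id τ).const_mul 2).const_sub (x + t)).add_const (T₁ - S)
        simpa using this
      have := ((hU _ (hrel τ hτ)).comp τ hl).const_mul (-(k / S * Real.exp (-K) / 2))
      refine this.congr_deriv ?_
      ring
    · intro τ hτ
      have h1 := left_line_mem_trapezoid hP' hτ.1.le hτ.2.le
      have h2 := hprop (x + t - 2 * τ) τ (by
        rwa [show x + t - 2 * τ + τ = x + t - τ by ring])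
      rw [show x + t - 2 * τ + τ = x + t - τ by ring] at h2
      rw [mul_assoc]
      exact mul_le_mul_of_nonneg_left h2 hc0
  rintro ⟨x, t⟩ hP hdepth
  simp only at hdepth
  have hmix1 : mixingConst k K * L ≤ 0.8 * k * Real.exp (-(2 * K)) * L :=
    mul_le_mul_of_nonneg_right (min_le_left _ _) hL
  have hmix2 : mixingConst k K * L ≤ 0.072 * k ^ 2 * Real.exp (-(3 * K)) * L :=
    mul_le_mul_of_nonneg_right (min_le_right _ _) hL
  refine ⟨hmix2.trans ?_, hmix1.trans (hvlow _ hP (by simp only; linarith))⟩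
  have hP' : (x - t + t, t) ∈ trapezoid x₁ T₁ (S / 100) S := by rwa [sub_add_cancel]
  set m := 0.8 * k * Real.exp (-(2 * K)) * L with hm
  have hm0 : 0 ≤ m := by positivity
  have hlow : T₁ - S ≤ T₁ - S / 10 := by linarith
  -- Second stage, from depth `S / 10` to `S / 100`: its length `0.09 S` times the bound `0.8 k ...`
  -- for `v` gives the constant 0.072.
  have key := relax_line (s := T₁ - S / 10) (t := t) (h := fun τ => u (x - t + τ, τ))
    (g := fun τ => v (x - t + τ, τ)) (V := fun τ => k / S * m * τ) (V' := fun τ => k / S * m)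
    (by linarith) hc0 hcC
    (fun τ hτ => h.right _ _ (right_line_mem_trapezoid hP' (hlow.trans hτ.1) hτ.2))
    (fun τ _ => by simpa using (hasDerivAt_id τ).const_mul (k / S * m))
    (fun τ hτ => (hnn _ (right_line_mem_trapezoid hP' (hlow.trans hτ.1.le) hτ.2.le)).1)
    (fun τ hτ => (hnn _ (right_line_mem_trapezoid hP' (hlow.trans hτ.1.le) hτ.2.le)).2)
    (fun τ _ => by positivity) (fun τ hτ => ?_)
  · have hb := (hnn _ (right_line_mem_trapezoid hP' hlow (by linarith))).1
    simp only [sub_add_cancel] at key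
    have h1 := key.trans (mul_le_mul_of_nonneg_right (hexp _ _ (by linarith)) (hnn _ hP).1)
    have h2 : k / S * m * t - k / S * m * (T₁ - S / 10) = 0.09 * k * m := by
      rw [show t = T₁ - S / 100 by linarith]; field_simp; ring
    rw [h2] at h1
    calc 0.072 * k ^ 2 * Real.exp (-(3 * K)) * L = Real.exp (-K) * (0.09 * k * m) := by
          rw [show -(3 * K) = -K + -(2 * K) by ring, Real.exp_add, hm]; ring
      _ ≤ Real.exp (-K) * (Real.exp K * u (x, t)) := by
          refine mul_le_mul_of_nonneg_left ?_ (Real.exp_pos _).le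
          linarith
      _ = u (x, t) := by rw [← mul_assoc, ← Real.exp_add]; simp
  · refine mul_le_mul_of_nonneg_left (hvlow _ ?_ ?_) hc0
    · exact right_line_mem_trapezoid hP' (hlow.trans hτ.1.le) hτ.2.le
    · simp only; linarith [hτ.1]

/-! ### Contraction of the oscillation towards the vertex of a cone -/

/-- The closed backward light cone with vertex `(x₁, T₁)`, without its vertex, down to depth `S`. -/
def puncturedCone (x₁ T₁ S : ℝ) : Set (ℝ × ℝ) :=
  {z | 0 < T₁ - z.2 ∧ T₁ - z.2 ≤ S ∧ |z.1 - x₁| ≤ T₁ - z.2}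

/-- `(a, b)` solves on a punctured cone, up to errors bounded by `E`, a relaxation system
`(∂ₜ + ∂ₓ) a = κ (b - a)`, `(∂ₜ - ∂ₓ) b = κ' (a - b)` whose rates are comparable to the reciprocal
of the depth below the vertex. -/
structure ConeSystem (x₁ T₁ S k K E : ℝ) (a b : ℝ × ℝ → ℝ) : Prop where
  cont_a : ContinuousOn a (puncturedCone x₁ T₁ S)
  cont_b : ContinuousOn b (puncturedCone x₁ T₁ S)
  right : ∀ ξ τ, (ξ + τ, τ) ∈ puncturedCone x₁ T₁ S → ∃ a' κ, k / (T₁ - τ) ≤ κ ∧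
    κ ≤ K / (T₁ - τ) ∧ HasDerivAt (fun τ => a (ξ + τ, τ)) a' τ ∧
    |a' - κ * (b (ξ + τ, τ) - a (ξ + τ, τ))| ≤ E
  left : ∀ ξ τ, (ξ - τ, τ) ∈ puncturedCone x₁ T₁ S → ∃ b' κ, k / (T₁ - τ) ≤ κ ∧
    κ ≤ K / (T₁ - τ) ∧ HasDerivAt (fun τ => b (ξ - τ, τ)) b' τ ∧
    |b' - κ * (a (ξ - τ, τ) - b (ξ - τ, τ))| ≤ E

theorem trapezoid_subset_puncturedCone {x₁ T₁ d S S' : ℝ} (hd : 0 < d) (hS : S ≤ S') :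
    trapezoid x₁ T₁ d S ⊆ puncturedCone x₁ T₁ S' :=
  fun _ hz => ⟨hd.trans_le hz.1, hz.2.1.trans hS, hz.2.2⟩

theorem ConeSystem.neg {x₁ T₁ S k K E : ℝ} {a b : ℝ × ℝ → ℝ} (h : ConeSystem x₁ T₁ S k K E a b) :
    ConeSystem x₁ T₁ S k K E (fun z => -a z) (fun z => -b z) where
  cont_a := h.cont_a.neg
  cont_b := h.cont_b.neg
  right ξ τ hz := by
    obtain ⟨a', κ, h1, h2, h3, h4⟩ := h.right ξ τ hz
    refine ⟨-a', κ, h1, h2, h3.neg, ?_⟩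
    rw [← abs_neg]
    convert h4 using 2
    ring
  left ξ τ hz := by
    obtain ⟨a', κ, h1, h2, h3, h4⟩ := h.left ξ τ hz
    refine ⟨-a', κ, h1, h2, h3.neg, ?_⟩
    rw [← abs_neg]
    convert h4 using 2
    ring

/-- Adding `E` times the time elapsed since the base absorbs the error, and subtracting `lo` from
both components is harmless. On the trapezoid the depth lies between `d` and `S`, which fixes the
range of the rates. -/
theorem ConeSystem.isRelaxing {x₁ T₁ S₀ k K E : ℝ} {a b : ℝ × ℝ → ℝ}
    (h : ConeSystem x₁ T₁ S₀ k K E a b) (hk : 0 < k) (hkK : k ≤ K) {d S : ℝ} (hd : 0 < d)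
    (hS : S ≤ S₀) (lo : ℝ) :
    IsRelaxing (trapezoid x₁ T₁ d S) (fun z => a z + E * (z.2 - (T₁ - S)) - lo)
      (fun z => b z + E * (z.2 - (T₁ - S)) - lo) (k / S) (K / d) := by
  have hsub := trapezoid_subset_puncturedCone (x₁ := x₁) (T₁ := T₁) hd hS
  have hE : ∀ τ : ℝ, HasDerivAt (fun τ => E * (τ - (T₁ - S))) E τ := fun τ => by
    simpa using ((hasDerivAt_id τ).sub_const (T₁ - S)).const_mul E
  refine ⟨?_, ?_, ?_, ?_⟩
  · exact ((h.cont_a.mono hsub).add (by fun_prop)).sub continuousOn_const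
  · exact ((h.cont_b.mono hsub).add (by fun_prop)).sub continuousOn_const
  · intro ξ τ hz
    obtain ⟨a', κ, h1, h2, h3, h4⟩ := h.right ξ τ (hsub hz)
    have hz1 := hz.1
    have hz2 := hz.2.1
    simp only at hz1 hz2
    refine ⟨a' + E, κ, le_trans ?_ h1, h2.trans ?_, (h3.add (hE τ)).sub_const lo, ?_⟩
    · exact div_le_div_of_nonneg_left hk.le (hd.trans_le hz1) hz2
    · exact div_le_div_of_nonneg_left (hk.le.trans hkK) hd hz1
    · simp only
      have := (abs_le.1 h4).1
      linarith
  · intro ξ τ hz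
    obtain ⟨a', κ, h1, h2, h3, h4⟩ := h.left ξ τ (hsub hz)
    have hz1 := hz.1
    have hz2 := hz.2.1
    simp only at hz1 hz2
    refine ⟨a' + E, κ, le_trans ?_ h1, h2.trans ?_, (h3.add (hE τ)).sub_const lo, ?_⟩
    · exact div_le_div_of_nonneg_left hk.le (hd.trans_le hz1) hz2
    · exact div_le_div_of_nonneg_left (hk.le.trans hkK) hd hz1
    · simp only
      have := (abs_le.1 h4).1
      linarith

/-- The minimum principle on the trapezoid whose top passes through the given point; the accumulated
error is at most `E * S`, independently of how close the point is to the vertex. -/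
theorem ConeSystem.lower_bound {x₁ T₁ S₀ k K E : ℝ} {a b : ℝ × ℝ → ℝ}
    (h : ConeSystem x₁ T₁ S₀ k K E a b) (hk : 0 < k) (hkK : k ≤ K) (hE : 0 ≤ E) {S lo : ℝ}
    (hS : S ≤ S₀)
    (hlo : ∀ z ∈ puncturedCone x₁ T₁ S₀, T₁ - z.2 = S → lo ≤ a z ∧ lo ≤ b z) :
    ∀ z ∈ puncturedCone x₁ T₁ S₀, T₁ - z.2 ≤ S → lo - E * S ≤ a z ∧ lo - E * S ≤ b z := by
  intro z hz hzS
  have hd : 0 < T₁ - z.2 := hz.1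
  have hsub := trapezoid_subset_puncturedCone (x₁ := x₁) (T₁ := T₁) hd hS
  have h1 := (h.isRelaxing hk hkK hd hS lo).nonneg (by have := hd.trans_le hzS; positivity)
    (by
      rw [div_le_div_iff₀ (hd.trans_le hzS) hd]
      exact mul_le_mul hkK hzS hd.le (hk.le.trans hkK))
    (fun w hw hwS => by
      have := (hlo w (hsub hw) hwS).1
      have h2 : w.2 - (T₁ - S) = 0 := by linarith
      simp only [h2, mul_zero, add_zero]
      linarith)
    (fun w hw hwS => by
      have := (hlo w (hsub hw) hwS).2
      have h2 : w.2 - (T₁ - S) = 0 := by linarith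
      simp only [h2, mul_zero, add_zero]
      linarith) z ⟨le_rfl, hzS, hz.2.2⟩
  have h2 : E * (z.2 - (T₁ - S)) ≤ E * S := mul_le_mul_of_nonneg_left (by linarith) hE
  constructor <;> linarith [h1.1, h1.2]

theorem ConeSystem.improved_lower_bound {x₁ T₁ S₀ k K E : ℝ} {a b : ℝ × ℝ → ℝ}
    (h : ConeSystem x₁ T₁ S₀ k K E a b) (hk : 0 < k) (hkK : k ≤ K) (hE : 0 ≤ E) {S lo L : ℝ}
    {U : ℝ → ℝ} (hS0 : 0 < S) (hS : S ≤ S₀) (hL : 0 ≤ L)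
    (hlo : ∀ z ∈ puncturedCone x₁ T₁ S₀, T₁ - z.2 = S → lo ≤ a z ∧ lo ≤ b z)
    (hU : ∀ y ∈ Icc (x₁ - S) (x₁ + S), HasDerivAt U (a (y, T₁ - S)) y)
    (hUL : (lo + L) * (1.6 * S) ≤ U (x₁ + 0.8 * S) - U (x₁ - 0.8 * S)) :
    ∀ z ∈ puncturedCone x₁ T₁ S₀, T₁ - z.2 = S / 100 →
      lo + mixingConst k (100 * K) * L - E * S ≤ a z ∧
      lo + mixingConst k (100 * K) * L - E * S ≤ b z := by
  intro z hz hzS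
  have hd : 0 < S / 100 := by positivity
  have hsub := trapezoid_subset_puncturedCone (x₁ := x₁) (T₁ := T₁) hd hS
  have hrel := h.isRelaxing hk hkK hd hS lo
  rw [show K / (S / 100) = 100 * K / S by field_simp] at hrel
  have h1 := hrel.mixing (U := fun y => U y - lo * y) hS0 hk (by linarith) hL
    (fun w hw hwS => by
      have := (hlo w (hsub hw) hwS).1
      have h2 : w.2 - (T₁ - S) = 0 := by linarith
      simp only [h2, mul_zero, add_zero]
      linarith)
    (fun w hw hwS => by
      have := (hlo w (hsub hw) hwS).2
      have h2 : w.2 - (T₁ - S) = 0 := by linarith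
      simp only [h2, mul_zero, add_zero]
      linarith)
    (fun y hy => by
      have h3 : HasDerivAt (fun y => lo * y) lo y := by
        simpa using (hasDerivAt_id y).const_mul lo
      refine ((hU y hy).sub h3).congr_deriv ?_
      ring) (by linarith) z ⟨hzS.ge, by linarith, hz.2.2⟩ hzS
  have h2 : E * (z.2 - (T₁ - S)) ≤ E * S := mul_le_mul_of_nonneg_left (by linarith) hE
  constructor <;> linarith [h1.1, h1.2]

/-- A function continuous on a compact interval has a primitive there. -/
theorem exists_primitive {f : ℝ → ℝ} {s t : ℝ} (hst : s ≤ t) (hf : ContinuousOn f (Icc s t)) :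
    ∃ U : ℝ → ℝ, ∀ y ∈ Icc s t, HasDerivAt U (f y) y := by
  have hc : Continuous (IccExtend hst (domRestrict (Icc s t) f)) :=
    (continuousOn_iff_continuous_domRestrict.1 hf).Icc_extend'
  refine ⟨fun y => ∫ z in s..y, IccExtend hst (domRestrict (Icc s t) f) z, fun y hy => ?_⟩
  have := (hc.integral_hasStrictDerivAt s y).hasDerivAt
  rwa [IccExtend_of_mem hst _ hy, domRestrict_apply] at this

/-- The mean of `a` over the middle of the base lies on one side of the midpoint of `[lo, hi]`. If
above, mixing lifts the lower bound by a fixed fraction of `hi - lo`; if below, the same for `(-a,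
-b)` pushes down the upper bound. Each end loses at most `E * S`. -/
theorem ConeSystem.osc_step {x₁ T₁ S₀ k K E : ℝ} {a b : ℝ × ℝ → ℝ}
    (h : ConeSystem x₁ T₁ S₀ k K E a b) (hk : 0 < k) (hkK : k ≤ K) (hE : 0 ≤ E) {S lo hi : ℝ}
    (hS0 : 0 < S) (hS : S ≤ S₀) (hlh : lo ≤ hi)
    (hb : ∀ z ∈ puncturedCone x₁ T₁ S₀, T₁ - z.2 = S → a z ∈ Icc lo hi ∧ b z ∈ Icc lo hi) :
    ∃ lo' hi', lo' ≤ hi' ∧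
      hi' - lo' ≤ (1 - mixingConst k (100 * K) / 2) * (hi - lo) + 2 * E * S ∧
      ∀ z ∈ puncturedCone x₁ T₁ S₀, T₁ - z.2 = S / 100 → a z ∈ Icc lo' hi' ∧ b z ∈ Icc lo' hi' := by
  have hmem : ∀ y ∈ Icc (x₁ - S) (x₁ + S), (y, T₁ - S) ∈ puncturedCone x₁ T₁ S₀ := by
    intro y hy
    refine ⟨?_, ?_, ?_⟩ <;> simp only [sub_sub_cancel]
    · exact hS0
    · exact hS
    · rw [abs_le]; constructor <;> linarith [hy.1, hy.2]
  obtain ⟨U, hU⟩ := exists_primitive (f := fun y => a (y, T₁ - S)) (by linarith : x₁ - S ≤ x₁ + S)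
    (h.cont_a.comp (by fun_prop) hmem)
  have hlob := h.lower_bound hk hkK hE hS (lo := lo) (fun z hz hzS =>
    ⟨(hb z hz hzS).1.1, (hb z hz hzS).2.1⟩)
  have hhib := h.neg.lower_bound hk hkK hE hS (lo := -hi) (fun z hz hzS =>
    ⟨neg_le_neg (hb z hz hzS).1.2, neg_le_neg (hb z hz hzS).2.2⟩)
  have hL : 0 ≤ (hi - lo) / 2 := by linarith
  have hne : ((x₁, T₁ - S / 100) : ℝ × ℝ) ∈ puncturedCone x₁ T₁ S₀ := by
    refine ⟨?_, ?_, ?_⟩ <;> simp <;> linarith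
  rcases le_total ((lo + hi) / 2 * (1.6 * S)) (U (x₁ + 0.8 * S) - U (x₁ - 0.8 * S)) with hc | hc
  · have h1 := h.improved_lower_bound hk hkK hE hS0 hS hL (fun z hz hzS =>
      ⟨(hb z hz hzS).1.1, (hb z hz hzS).2.1⟩) hU
      (by rw [show lo + (hi - lo) / 2 = (lo + hi) / 2 by ring]; exact hc)
    have hall : ∀ z ∈ puncturedCone x₁ T₁ S₀, T₁ - z.2 = S / 100 →
        a z ∈ Icc (lo + mixingConst k (100 * K) * ((hi - lo) / 2) - E * S) (hi + E * S) ∧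
        b z ∈ Icc (lo + mixingConst k (100 * K) * ((hi - lo) / 2) - E * S) (hi + E * S) := by
      intro z hz hzS
      have h2 := h1 z hz hzS
      have h3 := hhib z hz (by linarith)
      exact ⟨⟨h2.1, by linarith [h3.1]⟩, ⟨h2.2, by linarith [h3.2]⟩⟩
    refine ⟨_, _, ?_, ?_, hall⟩
    · have := (hall _ hne (by simp)).1
      exact this.1.trans this.2
    · linarith
  · have h1 := h.neg.improved_lower_bound hk hkK hE hS0 hS hL (U := fun y => -U y) (lo := -hi)
      (fun z hz hzS => ⟨neg_le_neg (hb z hz hzS).1.2, neg_le_neg (hb z hz hzS).2.2⟩)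
      (fun y hy => (hU y hy).neg) (by linarith)
    have hall : ∀ z ∈ puncturedCone x₁ T₁ S₀, T₁ - z.2 = S / 100 →
        a z ∈ Icc (lo - E * S) (hi - mixingConst k (100 * K) * ((hi - lo) / 2) + E * S) ∧
        b z ∈ Icc (lo - E * S) (hi - mixingConst k (100 * K) * ((hi - lo) / 2) + E * S) := by
      intro z hz hzS
      have h2 := h1 z hz hzS
      have h3 := hlob z hz (by linarith)
      exact ⟨⟨h3.1, by linarith [h2.1]⟩, ⟨h3.2, by linarith [h2.2]⟩⟩
    refine ⟨_, _, ?_, ?_, hall⟩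
    · have := (hall _ hne (by simp)).1
      exact this.1.trans this.2
    · linarith

/-- Decay of the oscillation of solutions of relaxation systems towards the vertex of a cone, at a
rate depending only on the constants of the system. -/
theorem ConeSystem.exists_osc_rate {S₀ k K E : ℝ} (hS₀ : 0 < S₀) (hk : 0 < k) (hkK : k ≤ K)
    (hE : 0 ≤ E) : ∃ ω : ℕ → ℝ, Tendsto ω atTop (𝓝 0) ∧ ∀ (x₁ T₁ : ℝ) (a b : ℝ × ℝ → ℝ),
      ConeSystem x₁ T₁ S₀ k K E a b →
      (∀ z ∈ puncturedCone x₁ T₁ S₀, |a z| ≤ 1 ∧ |b z| ≤ 1) →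
      ∀ n : ℕ, ∃ lo hi, hi - lo ≤ ω n ∧ ∀ z ∈ puncturedCone x₁ T₁ S₀, T₁ - z.2 ≤ S₀ / 100 ^ n →
        a z ∈ Icc lo hi ∧ b z ∈ Icc lo hi := by
  obtain ⟨δ, hδ0, hδ1, hδ⟩ : ∃ δ : ℝ, 0 < δ ∧ δ ≤ 1 ∧ δ ≤ mixingConst k (100 * K) / 2 :=
    ⟨min 1 (mixingConst k (100 * K) / 2), lt_min one_pos (by
      have := mixingConst_pos (k := k) (K := 100 * K) hk
      positivity), min_le_left _ _, min_le_right _ _⟩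
  -- Half of the gain `δ` is given up to absorb the errors. In `D`, the term 2 is the initial
  -- oscillation and `4 E S₀ / δ` makes `δ / 2 * D` dominate the error `2 E S₀`; as `r ≥ 1 / 100`,
  -- this persists at every later step.
  set r := 1 - δ / 2 with hr
  set D := 2 + 4 * E * S₀ / δ with hD
  have hD0 : 0 < D := by positivity
  have hpow : ∀ n : ℕ, (1 / 100 : ℝ) ^ n ≤ r ^ n := fun n =>
    pow_le_pow_left₀ (by norm_num) (by rw [hr]; linarith) n
  refine ⟨fun n => D * r ^ n + 2 * E * (S₀ * (1 / 100) ^ n), ?_, ?_⟩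
  · have h1 : Tendsto (fun n : ℕ => r ^ n) atTop (𝓝 0) :=
      tendsto_pow_atTop_nhds_zero_of_lt_one (by rw [hr]; linarith) (by rw [hr]; linarith)
    have h2 : Tendsto (fun n : ℕ => (1 / 100 : ℝ) ^ n) atTop (𝓝 0) :=
      tendsto_pow_atTop_nhds_zero_of_lt_one (by norm_num) (by norm_num)
    have := (h1.const_mul D).add ((h2.const_mul S₀).const_mul (2 * E))
    simpa using this
  intro x₁ T₁ a b h hbd n
  have key : ∀ n : ℕ, ∃ lo hi, lo ≤ hi ∧ hi - lo ≤ D * r ^ n ∧ ∀ z ∈ puncturedCone x₁ T₁ S₀,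
      T₁ - z.2 = S₀ / 100 ^ n → a z ∈ Icc lo hi ∧ b z ∈ Icc lo hi := by
    intro n
    induction n with
    | zero =>
      refine ⟨-1, 1, by norm_num, ?_, fun z hz _ => ⟨abs_le.1 (hbd z hz).1, abs_le.1 (hbd z hz).2⟩⟩
      have : 0 ≤ 4 * E * S₀ / δ := by positivity
      rw [hD, pow_zero]; linarith
    | succ n ih =>
      obtain ⟨lo, hi, h1, h2, h3⟩ := ih
      have hn : S₀ / 100 ^ n ≤ S₀ := div_le_self hS₀.le (one_le_pow₀ (by norm_num))
      obtain ⟨lo', hi', h4, h5, h6⟩ := h.osc_step hk hkK hE (by positivity) hn h1 h3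
      refine ⟨lo', hi', h4, h5.trans ?_, fun z hz hzS => h6 z hz ?_⟩
      · have h7 : (1 - mixingConst k (100 * K) / 2) * (hi - lo) ≤ (1 - δ) * (D * r ^ n) := by
          calc _ ≤ (1 - δ) * (hi - lo) := mul_le_mul_of_nonneg_right (by linarith) (by linarith)
            _ ≤ _ := mul_le_mul_of_nonneg_left h2 (by linarith)
        have h8 : 2 * E * (S₀ / 100 ^ n) ≤ δ / 2 * D * r ^ n := by
          have h9 : 2 * E * (S₀ / 100 ^ n) = 2 * E * S₀ * (1 / 100) ^ n := by
            rw [one_div, inv_pow]; ring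
          rw [h9]
          have h10 : 2 * E * S₀ ≤ δ / 2 * D := by
            have : δ / 2 * D = δ + 2 * E * S₀ := by rw [hD]; field_simp; ring
            linarith
          exact mul_le_mul h10 (hpow n) (by positivity) (by positivity)
        calc _ ≤ (1 - δ) * (D * r ^ n) + δ / 2 * D * r ^ n := add_le_add h7 h8
          _ = D * r ^ (n + 1) := by rw [pow_succ, hr]; ring
      · rw [hzS, pow_succ]; ring
  obtain ⟨lo, hi, h1, h2, h3⟩ := key n
  have hn : S₀ / 100 ^ n ≤ S₀ := div_le_self hS₀.le (one_le_pow₀ (by norm_num))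
  -- The induction controls single depths only; the minimum principle extends the bounds to
  -- everything nearer the vertex.
  have hlob := h.lower_bound hk hkK hE hn (lo := lo) (fun z hz hzS =>
    ⟨(h3 z hz hzS).1.1, (h3 z hz hzS).2.1⟩)
  have hhib := h.neg.lower_bound hk hkK hE hn (lo := -hi) (fun z hz hzS =>
    ⟨neg_le_neg (h3 z hz hzS).1.2, neg_le_neg (h3 z hz hzS).2.2⟩)
  refine ⟨lo - E * (S₀ / 100 ^ n), hi + E * (S₀ / 100 ^ n), ?_, fun z hz hzS => ?_⟩
  · have h9 : S₀ / 100 ^ n = S₀ * (1 / 100) ^ n := by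
      rw [one_div, inv_pow]; ring
    simp only
    rw [h9]
    linarith
  · have h4 := hlob z hz hzS
    have h5 := hhib z hz hzS
    exact ⟨⟨h4.1, by linarith [h5.1]⟩, ⟨h4.2, by linarith [h5.2]⟩⟩

/-! ### Geometry of the domain of a solution -/

/-- Among the cones over `x` that contain `z`, the lowest has its vertex at time `|z.1 - x| + z.2`,
so the vertex time can be eliminated. -/
theorem mem_solutionDomain_iff {R : ℝ} {T : ℝ → ℝ} {z : ℝ × ℝ} :
    z ∈ solutionDomain R T ↔ 0 ≤ z.2 ∧ ∃ x, |x| < R ∧ |z.1 - x| + z.2 < T x := by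
  constructor
  · rintro ⟨x, t, hx, ht, hz0, hz⟩
    exact ⟨hz0, x, hx, by linarith⟩
  · rintro ⟨h0, x, hx, h⟩
    exact ⟨x, |z.1 - x| + z.2, hx, h, h0, by linarith⟩

theorem mem_solutionDomain {R : ℝ} {T : ℝ → ℝ} {x t : ℝ} (hx : |x| < R) (ht0 : 0 ≤ t)
    (ht : t < T x) : (x, t) ∈ solutionDomain R T :=
  mem_solutionDomain_iff.2 ⟨ht0, x, hx, by simpa using ht⟩

theorem isOpen_solutionDomain_inter (R : ℝ) (T : ℝ → ℝ) :
    IsOpen (solutionDomain R T ∩ {z | 0 < z.2}) := by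
  have : solutionDomain R T ∩ {z | 0 < z.2} =
      (⋃ x ∈ {x : ℝ | |x| < R}, {z : ℝ × ℝ | |z.1 - x| + z.2 < T x}) ∩ {z | 0 < z.2} := by
    ext z
    simp only [mem_inter_iff, mem_solutionDomain_iff, mem_iUnion, mem_ofPred_eq, exists_prop]
    constructor
    · rintro ⟨⟨-, x, h1, h2⟩, h3⟩
      exact ⟨⟨x, h1, h2⟩, h3⟩
    · rintro ⟨⟨x, h1, h2⟩, h3⟩
      exact ⟨⟨h3.le, x, h1, h2⟩, h3⟩
  rw [this]
  refine IsOpen.inter (isOpen_biUnion fun x _ => ?_) ?_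
  · exact isOpen_lt (by fun_prop) continuous_const
  · exact isOpen_lt continuous_const continuous_snd

theorem solutionDomain_backward {R : ℝ} {T : ℝ → ℝ} {z w : ℝ × ℝ} (hz : z ∈ solutionDomain R T)
    (hw0 : 0 ≤ w.2) (hw : |w.1 - z.1| ≤ z.2 - w.2) : w ∈ solutionDomain R T := by
  obtain ⟨h0, x, hx, h⟩ := mem_solutionDomain_iff.1 hz
  refine mem_solutionDomain_iff.2 ⟨hw0, x, hx, ?_⟩
  have := abs_sub_le w.1 z.1 x
  linarith

theorem backwardCone_subset {R : ℝ} {T : ℝ → ℝ} {x t : ℝ} (h : (x, t) ∈ solutionDomain R T) :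
    backwardCone x t ⊆ solutionDomain R T :=
  fun _ hw => solutionDomain_backward h hw.1 hw.2

theorem isCompact_backwardCone (x t : ℝ) : IsCompact (backwardCone x t) := by
  have hsub : backwardCone x t ⊆ Icc (x - t) (x + t) ×ˢ Icc 0 t := by
    rintro ⟨y, s⟩ ⟨h1, h2⟩
    have h3 := abs_nonneg (y - x)
    simp only [abs_le] at h1 h2 h3
    refine ⟨⟨?_, ?_⟩, ?_, ?_⟩ <;> simp only <;> linarith [h2.1, h2.2]
  refine (isCompact_Icc.prod isCompact_Icc).of_isClosed_subset ?_ hsub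
  have h1 : IsClosed {z : ℝ × ℝ | 0 ≤ z.2} := isClosed_le (by fun_prop) (by fun_prop)
  have h2 : IsClosed {z : ℝ × ℝ | |z.1 - x| ≤ t - z.2} := isClosed_le (by fun_prop) (by fun_prop)
  exact h1.inter h2

theorem left_line_mem_backwardCone {x t ξ s τ : ℝ} (h : (ξ - s, s) ∈ backwardCone x t)
    (h1 : 0 ≤ τ) (h2 : τ ≤ s) : (ξ - τ, τ) ∈ backwardCone x t := by
  obtain ⟨a, b⟩ := h
  simp only [abs_le] at a b
  refine ⟨h1, ?_⟩
  simp only [abs_le]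
  constructor <;> linarith [b.1, b.2]

theorem right_line_mem_backwardCone {x t ξ s τ : ℝ} (h : (ξ + s, s) ∈ backwardCone x t)
    (h1 : 0 ≤ τ) (h2 : τ ≤ s) : (ξ + τ, τ) ∈ backwardCone x t := by
  obtain ⟨a, b⟩ := h
  simp only [abs_le] at a b
  refine ⟨h1, ?_⟩
  simp only [abs_le]
  constructor <;> linarith [b.1, b.2]

/-- `(Φ, Ψ)` satisfies `(∂ₜ - ∂ₓ) Φ = (∂ₜ + ∂ₓ) Ψ = H` on `K` at positive times. -/
structure TransportOn (K : Set (ℝ × ℝ)) (Φ Ψ H : ℝ × ℝ → ℝ) : Prop where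
  cont_Φ : ContinuousOn Φ K
  cont_Ψ : ContinuousOn Ψ K
  left : ∀ ξ τ, (ξ - τ, τ) ∈ K → 0 < τ → HasDerivAt (fun τ => Φ (ξ - τ, τ)) (H (ξ - τ, τ)) τ
  right : ∀ ξ τ, (ξ + τ, τ) ∈ K → 0 < τ → HasDerivAt (fun τ => Ψ (ξ + τ, τ)) (H (ξ + τ, τ)) τ

theorem TransportOn.sub {K : Set (ℝ × ℝ)} {Φ₁ Ψ₁ H₁ Φ₂ Ψ₂ H₂ : ℝ × ℝ → ℝ}
    (h₁ : TransportOn K Φ₁ Ψ₁ H₁) (h₂ : TransportOn K Φ₂ Ψ₂ H₂) :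
    TransportOn K (fun z => Φ₁ z - Φ₂ z) (fun z => Ψ₁ z - Ψ₂ z) (fun z => H₁ z - H₂ z) where
  cont_Φ := h₁.cont_Φ.sub h₂.cont_Φ
  cont_Ψ := h₁.cont_Ψ.sub h₂.cont_Ψ
  left ξ τ hz hτ := (h₁.left ξ τ hz hτ).sub (h₂.left ξ τ hz hτ)
  right ξ τ hz hτ := (h₁.right ξ τ hz hτ).sub (h₂.right ξ τ hz hτ)

theorem TransportOn.mono {K K' : Set (ℝ × ℝ)} {Φ Ψ H : ℝ × ℝ → ℝ} (h : TransportOn K Φ Ψ H)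
    (hK : K' ⊆ K) : TransportOn K' Φ Ψ H :=
  ⟨h.cont_Φ.mono hK, h.cont_Ψ.mono hK, fun ξ τ hz => h.left ξ τ (hK hz),
    fun ξ τ hz => h.right ξ τ (hK hz)⟩

theorem TransportOn.mul_le_left {x t : ℝ} {Φ Ψ H : ℝ × ℝ → ℝ}
    (h : TransportOn (backwardCone x t) Φ Ψ H) {y s C : ℝ} (hz : (y, s) ∈ backwardCone x t)
    (hC : ∀ τ ∈ Ioo 0 s, C ≤ H (y + s - τ, τ)) : C * s ≤ Φ (y, s) - Φ (y + s, 0) := by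
  have hz' : (y + s - s, s) ∈ backwardCone x t := by rwa [add_sub_cancel_right]
  have := mul_sub_le_of_hasDerivAt (f := fun τ => Φ (y + s - τ, τ)) hz.1
    (h.cont_Φ.comp (by fun_prop) (fun τ hτ => left_line_mem_backwardCone hz' hτ.1 hτ.2))
    (fun τ hτ => h.left _ _ (left_line_mem_backwardCone hz' hτ.1.le hτ.2.le) hτ.1) hC
  simpa using this

theorem TransportOn.mul_le_right {x t : ℝ} {Φ Ψ H : ℝ × ℝ → ℝ}
    (h : TransportOn (backwardCone x t) Φ Ψ H) {y s C : ℝ} (hz : (y, s) ∈ backwardCone x t)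
    (hC : ∀ τ ∈ Ioo 0 s, C ≤ H (y - s + τ, τ)) : C * s ≤ Ψ (y, s) - Ψ (y - s, 0) := by
  have hz' : (y - s + s, s) ∈ backwardCone x t := by rwa [sub_add_cancel]
  have := mul_sub_le_of_hasDerivAt (f := fun τ => Ψ (y - s + τ, τ)) hz.1
    (h.cont_Ψ.comp (by fun_prop) (fun τ hτ => right_line_mem_backwardCone hz' hτ.1 hτ.2))
    (fun τ hτ => h.right _ _ (right_line_mem_backwardCone hz' hτ.1.le hτ.2.le) hτ.1) hC
  simpa using this

/-- Comparison principle for cooperative transport systems on a backward light cone. -/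
theorem TransportOn.lt_of_lt {x t : ℝ} {Φ₁ Ψ₁ H₁ Φ₂ Ψ₂ H₂ : ℝ × ℝ → ℝ}
    (h₁ : TransportOn (backwardCone x t) Φ₁ Ψ₁ H₁) (h₂ : TransportOn (backwardCone x t) Φ₂ Ψ₂ H₂)
    (hH : ∀ z ∈ backwardCone x t, 0 < z.2 → Φ₂ z + Ψ₂ z < Φ₁ z + Ψ₁ z → H₂ z ≤ H₁ z)
    (h0 : ∀ y, (y, 0) ∈ backwardCone x t → Φ₂ (y, 0) < Φ₁ (y, 0) ∧ Ψ₂ (y, 0) < Ψ₁ (y, 0)) :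
    ∀ z ∈ backwardCone x t, Φ₂ z < Φ₁ z ∧ Ψ₂ z < Ψ₁ z := by
  have h := h₁.sub h₂
  -- As long as both differences are positive the sums are ordered, so `hH` makes the differences
  -- nondecreasing along their characteristics, and they keep their initial sign.
  have key := pos_of_pos_before (isCompact_backwardCone x t) h.cont_Φ h.cont_Ψ ?_
  · intro z hz
    exact ⟨sub_pos.1 (key z hz).1, sub_pos.1 (key z hz).2⟩
  rintro ⟨y, s⟩ hP hbefore
  constructor
  · have hP' : (y + s - s, s) ∈ backwardCone x t := by rwa [add_sub_cancel_right]
    have h1 := h.mul_le_left (C := 0) hP (fun τ hτ => by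
      have hm := left_line_mem_backwardCone hP' hτ.1.le hτ.2.le
      have h2 := hbefore _ hm hτ.2
      exact sub_nonneg.2 (hH _ hm hτ.1 (by linarith [h2.1, h2.2])))
    have h2 := left_line_mem_backwardCone hP' le_rfl hP.1
    rw [sub_zero] at h2
    linarith [(h0 _ h2).1]
  · have hP' : (y - s + s, s) ∈ backwardCone x t := by rwa [sub_add_cancel]
    have h1 := h.mul_le_right (C := 0) hP (fun τ hτ => by
      have hm := right_line_mem_backwardCone hP' hτ.1.le hτ.2.le
      have h2 := hbefore _ hm hτ.2
      exact sub_nonneg.2 (hH _ hm hτ.1 (by linarith [h2.1, h2.2])))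
    have h2 := right_line_mem_backwardCone hP' le_rfl hP.1
    rw [add_zero] at h2
    linarith [(h0 _ h2).2]

/-! ### The nonlinearity -/

/-- The right-hand side `2⁻ᵖ wᵖ - μ / (1 + t) * w / 2` of the system for positive `w`. -/
noncomputable def source (p μ t w : ℝ) : ℝ := (2 : ℝ) ^ (-p) * w ^ p - μ / (1 + t) * (w / 2)

/-- The threshold for `φ + ψ` above which the nonlinearity dominates the damping. -/
noncomputable def threshold (p μ : ℝ) : ℝ := max 1 ((μ * p * 2 ^ p) ^ (1 / (p - 1)))

section source

variable {p μ t w : ℝ}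

theorem one_lt_of_threshold_lt (hw : threshold p μ < w) : 1 < w :=
  (le_max_left _ _).trans_lt hw

/-- The inequality for which `threshold` is designed: per unit of `w`, the nonlinearity exceeds `p`
times the largest damping coefficient. Positivity and monotonicity of `source` follow from it. -/
theorem mul_lt_of_threshold_lt (hp : 1 < p) (hμ : 0 < μ) (hw : threshold p μ < w) :
    μ * p < (2 : ℝ) ^ (-p) * w ^ (p - 1) := by
  have h1 : (μ * p * 2 ^ p) ^ (1 / (p - 1)) < w := (le_max_right _ _).trans_lt hw
  have h2 : 0 ≤ μ * p * (2 : ℝ) ^ p := by positivity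
  have h3 := Real.rpow_lt_rpow (Real.rpow_nonneg h2 _) h1 (sub_pos.2 hp)
  rw [← Real.rpow_mul h2, one_div, inv_mul_cancel₀ (sub_pos.2 hp).ne', Real.rpow_one] at h3
  rw [Real.rpow_neg (by norm_num), ← div_eq_inv_mul, lt_div_iff₀ (by positivity)]
  exact h3

theorem rpow_eq_mul_rpow_sub_one (p : ℝ) (hw : 0 < w) : w ^ p = w * w ^ (p - 1) := by
  rw [Real.rpow_sub_one hw.ne']; field_simp

theorem source_eq (hw : 0 < w) :
    source p μ t w = w * ((2 : ℝ) ^ (-p) * w ^ (p - 1) - μ / (1 + t) / 2) := by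
  rw [source, rpow_eq_mul_rpow_sub_one p hw]; ring

theorem damping_le (hμ : 0 < μ) (ht : 0 ≤ t) : 0 ≤ μ / (1 + t) ∧ μ / (1 + t) ≤ μ :=
  ⟨by positivity, div_le_self hμ.le (by linarith)⟩

theorem source_le (hμ : 0 < μ) (ht : 0 ≤ t) (hw : 0 < w) :
    source p μ t w ≤ (2 : ℝ) ^ (-p) * w ^ p := by
  have := (damping_le hμ ht).1
  rw [source]
  have : 0 ≤ μ / (1 + t) * (w / 2) := by positivity
  linarith

theorem le_source (hp : 1 < p) (hμ : 0 < μ) (ht : 0 ≤ t) (hw : threshold p μ < w) :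
    (2 : ℝ) ^ (-p) * w ^ p / 2 ≤ source p μ t w := by
  have h1 := mul_lt_of_threshold_lt hp hμ hw
  have h2 := one_lt_of_threshold_lt hw
  have h3 := damping_le hμ ht
  rw [source_eq (by linarith), rpow_eq_mul_rpow_sub_one p (by linarith)]
  have h4 : (2 : ℝ) ^ (-p) * w ^ (p - 1) / 2 ≤ (2 : ℝ) ^ (-p) * w ^ (p - 1) - μ / (1 + t) / 2 := by
    nlinarith
  nlinarith

theorem source_pos (hp : 1 < p) (hμ : 0 < μ) (ht : 0 ≤ t) (hw : threshold p μ < w) :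
    0 < source p μ t w := by
  have h2 := one_lt_of_threshold_lt hw
  refine lt_of_lt_of_le ?_ (le_source hp hμ ht hw)
  positivity

theorem source_mono (hp : 1 < p) (hμ : 0 < μ) (ht : 0 ≤ t) {w' : ℝ} (hw : threshold p μ < w)
    (hww : w ≤ w') : source p μ t w ≤ source p μ t w' := by
  have h1 := mul_lt_of_threshold_lt hp hμ hw
  have h2 := one_lt_of_threshold_lt hw
  have h3 := damping_le hμ ht
  rw [source_eq (by linarith), source_eq (by linarith)]
  have h4 : w ^ (p - 1) ≤ w' ^ (p - 1) :=
    Real.rpow_le_rpow (by linarith) hww (by linarith)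
  have h5 : (2 : ℝ) ^ (-p) * w ^ (p - 1) ≤ (2 : ℝ) ^ (-p) * w' ^ (p - 1) := by gcongr
  refine mul_le_mul hww (by linarith) ?_ (by linarith)
  nlinarith

/-- The damping weakens with time, so a forward translate in time of a solution is a supersolution.
-/
theorem source_mono_time (hμ : 0 < μ) (ht : 0 ≤ t) {t' : ℝ} (htt : t ≤ t') (hw : 0 ≤ w) :
    source p μ t w ≤ source p μ t' w := by
  rw [source, source]
  have : μ / (1 + t') ≤ μ / (1 + t) := by gcongr
  have := mul_le_mul_of_nonneg_right this (by linarith : 0 ≤ w / 2)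
  linarith

end source

/-! ### Translates, constant barriers, and derivatives along characteristics -/

theorem TransportOn.shift {K K' : Set (ℝ × ℝ)} {Φ Ψ H : ℝ × ℝ → ℝ} (h : TransportOn K Φ Ψ H)
    {a b : ℝ} (hb : 0 ≤ b) (hK : ∀ z ∈ K', z + (a, b) ∈ K) :
    TransportOn K' (fun z => Φ (z + (a, b))) (fun z => Ψ (z + (a, b))) (fun z => H (z + (a, b))) where
  cont_Φ := h.cont_Φ.comp (by fun_prop) hK
  cont_Ψ := h.cont_Ψ.comp (by fun_prop) hK
  left ξ τ hz hτ := by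
    have h1 := hK _ hz
    have e : ∀ τ : ℝ, ((ξ - τ, τ) : ℝ × ℝ) + (a, b) = (ξ + a + b - (τ + b), τ + b) := fun τ => by
      ext <;> simp; ring
    simp only [e] at h1 ⊢
    exact (h.left _ _ h1 (by linarith)).comp_add_const τ b
  right ξ τ hz hτ := by
    have h1 := hK _ hz
    have e : ∀ τ : ℝ, ((ξ + τ, τ) : ℝ × ℝ) + (a, b) = (ξ + a - b + (τ + b), τ + b) := fun τ => by
      ext <;> simp; ring
    simp only [e] at h1 ⊢
    exact (h.right _ _ h1 (by linarith)).comp_add_const τ b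

/-- The right-hand side of the system, with `θ` for the time in the damping coefficient. -/
noncomputable def rawSource (p μ : ℝ) (θ Φ Ψ : ℝ × ℝ → ℝ) (z : ℝ × ℝ) : ℝ :=
  (2 : ℝ) ^ (-p) * |Φ z + Ψ z| ^ p - μ / (1 + θ z) * ((Φ z + Ψ z) / 2)

theorem rawSource_eq {p μ : ℝ} {θ Φ Ψ : ℝ × ℝ → ℝ} {z : ℝ × ℝ} (h : 0 < Φ z + Ψ z) :
    rawSource p μ θ Φ Ψ z = source p μ (θ z) (Φ z + Ψ z) := by
  rw [rawSource, source, abs_of_pos h]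

/-- The constants `γ₁ - η`, `γ₂ - η` are a barrier with zero source: for small `η` their sum is
still at least the threshold, above which the source is positive. The time `θ` in the damping is
kept free so that the spatially homogeneous system, with `θ = 0`, is covered as well. -/
theorem TransportOn.lower_bound {p μ γ₁ γ₂ x t : ℝ} {θ Φ Ψ : ℝ × ℝ → ℝ} (hp : 1 < p) (hμ : 0 < μ)
    (hγ : threshold p μ < γ₁ + γ₂)
    (h : TransportOn (backwardCone x t) Φ Ψ (rawSource p μ θ Φ Ψ))
    (hθ : ∀ z ∈ backwardCone x t, 0 ≤ θ z)
    (h0 : ∀ y, (y, 0) ∈ backwardCone x t → γ₁ ≤ Φ (y, 0) ∧ γ₂ ≤ Ψ (y, 0)) :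
    ∀ z ∈ backwardCone x t, γ₁ ≤ Φ z ∧ γ₂ ≤ Ψ z := by
  have key : ∀ η > 0, η ≤ (γ₁ + γ₂ - threshold p μ) / 2 → ∀ z ∈ backwardCone x t,
      γ₁ - η < Φ z ∧ γ₂ - η < Ψ z := by
    intro η hη hη'
    refine h.lt_of_lt (Φ₂ := fun _ => γ₁ - η) (Ψ₂ := fun _ => γ₂ - η) (H₂ := fun _ => 0)
      ⟨continuousOn_const, continuousOn_const, fun _ τ _ _ => hasDerivAt_const _ _,
        fun _ τ _ _ => hasDerivAt_const _ _⟩ ?_ ?_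
    · intro z hz _ hlt
      have h1 : threshold p μ < Φ z + Ψ z := by linarith
      have h2 := one_lt_of_threshold_lt h1
      rw [rawSource_eq (by linarith)]
      exact (source_pos hp hμ (hθ z hz) h1).le
    · intro y hy
      have := h0 y hy
      constructor <;> linarith [this.1, this.2]
  intro z hz
  constructor <;> refine le_of_forall_pos_lt_add fun η hη => ?_
  · have h1 := (key (min η ((γ₁ + γ₂ - threshold p μ) / 2))
      (lt_min hη (by linarith)) (min_le_right _ _) z hz).1
    linarith [min_le_left η ((γ₁ + γ₂ - threshold p μ) / 2)]
  · have h1 := (key (min η ((γ₁ + γ₂ - threshold p μ) / 2))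
      (lt_min hη (by linarith)) (min_le_right _ _) z hz).2
    linarith [min_le_left η ((γ₁ + γ₂ - threshold p μ) / 2)]

theorem deriv_fst_eq_fderiv {u : ℝ → ℝ → ℝ} {x t : ℝ}
    (h : DifferentiableAt ℝ (Function.uncurry u) (x, t)) :
    deriv (fun x' => u x' t) x = fderiv ℝ (Function.uncurry u) (x, t) (1, 0) := by
  have h1 : HasDerivAt (fun x' : ℝ => ((x', t) : ℝ × ℝ)) (1, 0) x :=
    (hasDerivAt_id x).prodMk (hasDerivAt_const x t)
  exact (h.hasFDerivAt.comp_hasDerivAt x h1).deriv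

theorem deriv_snd_eq_fderiv {u : ℝ → ℝ → ℝ} {x t : ℝ}
    (h : DifferentiableAt ℝ (Function.uncurry u) (x, t)) :
    deriv (fun t' => u x t') t = fderiv ℝ (Function.uncurry u) (x, t) (0, 1) := by
  have h1 : HasDerivAt (fun t' : ℝ => ((x, t') : ℝ × ℝ)) (0, 1) t :=
    (hasDerivAt_const t x).prodMk (hasDerivAt_id t)
  exact (h.hasFDerivAt.comp_hasDerivAt t h1).deriv

theorem hasDerivAt_add_smul {Φ : ℝ × ℝ → ℝ} {z n : ℝ × ℝ} (h : DifferentiableAt ℝ Φ z) :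
    HasDerivAt (fun τ : ℝ => Φ (z + τ • n)) (fderiv ℝ Φ z n) 0 := by
  have h1 : HasDerivAt (fun τ : ℝ => z + τ • n) n 0 := by
    simpa using ((hasDerivAt_id (0 : ℝ)).smul_const n).const_add z
  have h2 : HasFDerivAt Φ (fderiv ℝ Φ z) (z + (0 : ℝ) • n) := by
    rw [zero_smul, add_zero]; exact h.hasFDerivAt
  exact h2.comp_hasDerivAt 0 h1

theorem hasDerivAt_line_of_hasDerivAt_zero {F : ℝ × ℝ → ℝ} {L ξ τ c : ℝ}
    (h : HasDerivAt (fun σ : ℝ => F ((ξ + c * τ, τ) + σ • (c, 1))) L 0) :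
    HasDerivAt (fun τ => F (ξ + c * τ, τ)) L τ := by
  have h1 : HasDerivAt (fun σ : ℝ => F ((ξ + c * τ, τ) + σ • (c, 1))) L (τ - τ) := by
    rwa [sub_self]
  refine (h1.comp_sub_const τ τ).congr_of_eventuallyEq (Eventually.of_forall fun σ => ?_)
  simp only [Prod.smul_mk, smul_eq_mul, mul_one, Prod.mk_add_mk]
  congr 1
  ext <;> simp
  ring

/-! ### Lower bounds for the solution and its growth in a cone of directions -/

section solution

variable {p μ γ₁ γ₂ R Tmax : ℝ} {f g : ℝ → ℝ} {φ ψ : ℝ → ℝ → ℝ} {T : ℝ → ℝ}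

theorem IsSolutionWithBlowUpCurve.differentiableAt_φ
    (hsol : IsSolutionWithBlowUpCurve p μ R Tmax f g φ ψ T) {z : ℝ × ℝ}
    (hz : z ∈ solutionDomain R T) (h0 : 0 < z.2) : DifferentiableAt ℝ (Function.uncurry φ) z :=
  (hsol.contDiffOn_φ.contDiffAt ((isOpen_solutionDomain_inter R T).mem_nhds ⟨hz, h0⟩)).differentiableAt
    one_ne_zero

theorem IsSolutionWithBlowUpCurve.differentiableAt_ψ
    (hsol : IsSolutionWithBlowUpCurve p μ R Tmax f g φ ψ T) {z : ℝ × ℝ}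
    (hz : z ∈ solutionDomain R T) (h0 : 0 < z.2) : DifferentiableAt ℝ (Function.uncurry ψ) z :=
  (hsol.contDiffOn_ψ.contDiffAt ((isOpen_solutionDomain_inter R T).mem_nhds ⟨hz, h0⟩)).differentiableAt
    one_ne_zero

theorem IsSolutionWithBlowUpCurve.fderiv_φ
    (hsol : IsSolutionWithBlowUpCurve p μ R Tmax f g φ ψ T) {z : ℝ × ℝ}
    (hz : z ∈ solutionDomain R T) (h0 : 0 < z.2) :
    fderiv ℝ (Function.uncurry φ) z (-1, 1) =
      rawSource p μ Prod.snd (Function.uncurry φ) (Function.uncurry ψ) z := by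
  obtain ⟨x, t⟩ := z
  have hd := hsol.differentiableAt_φ hz h0
  have := hsol.eq_φ x t hz h0
  rw [deriv_fst_eq_fderiv hd, deriv_snd_eq_fderiv hd, ← map_sub] at this
  simpa [rawSource] using this

theorem IsSolutionWithBlowUpCurve.fderiv_ψ
    (hsol : IsSolutionWithBlowUpCurve p μ R Tmax f g φ ψ T) {z : ℝ × ℝ}
    (hz : z ∈ solutionDomain R T) (h0 : 0 < z.2) :
    fderiv ℝ (Function.uncurry ψ) z (1, 1) =
      rawSource p μ Prod.snd (Function.uncurry φ) (Function.uncurry ψ) z := by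
  obtain ⟨x, t⟩ := z
  have hd := hsol.differentiableAt_ψ hz h0
  have := hsol.eq_ψ x t hz h0
  rw [deriv_fst_eq_fderiv hd, deriv_snd_eq_fderiv hd, ← map_add] at this
  simpa [rawSource] using this

theorem IsSolutionWithBlowUpCurve.transportOn
    (hsol : IsSolutionWithBlowUpCurve p μ R Tmax f g φ ψ T) :
    TransportOn (solutionDomain R T) (Function.uncurry φ) (Function.uncurry ψ)
      (rawSource p μ Prod.snd (Function.uncurry φ) (Function.uncurry ψ)) where
  cont_Φ := hsol.continuousOn_φ
  cont_Ψ := hsol.continuousOn_ψ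
  left ξ τ hz hτ := by
    have e : ∀ τ : ℝ, ξ - τ = ξ + -1 * τ := fun τ => by ring
    simp only [e] at hz ⊢
    rw [← hsol.fderiv_φ hz hτ]
    exact hasDerivAt_line_of_hasDerivAt_zero (hasDerivAt_add_smul (hsol.differentiableAt_φ hz hτ))
  right ξ τ hz hτ := by
    rw [← hsol.fderiv_ψ hz hτ]
    have e : ∀ τ : ℝ, ξ + 1 * τ = ξ + τ := fun τ => by ring
    rw [← e] at hz
    have := hasDerivAt_line_of_hasDerivAt_zero (c := 1)
      (hasDerivAt_add_smul (n := (1, 1)) (hsol.differentiableAt_ψ hz hτ))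
    simpa only [one_mul] using this

theorem abs_lt_of_mem_solutionDomain
    (hsol : IsSolutionWithBlowUpCurve p μ R Tmax f g φ ψ T) {z : ℝ × ℝ}
    (hz : z ∈ solutionDomain R T) : |z.1| < R + Tmax := by
  obtain ⟨h0, x, hx, h⟩ := mem_solutionDomain_iff.1 hz
  have h1 := hsol.T_le x hx
  have h2 : |z.1| ≤ |z.1 - x| + |x| := by
    have := abs_add_le (z.1 - x) x
    rwa [sub_add_cancel] at this
  linarith

theorem lower_bound (hA : Assumptions p μ γ₁ γ₂ R Tmax f g)
    (hsol : IsSolutionWithBlowUpCurve p μ R Tmax f g φ ψ T) {z : ℝ × ℝ}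
    (hz : z ∈ solutionDomain R T) : γ₁ ≤ φ z.1 z.2 ∧ γ₂ ≤ ψ z.1 z.2 := by
  have hsub := backwardCone_subset (x := z.1) (t := z.2) hz
  refine (hsol.transportOn.mono hsub).lower_bound hA.one_lt_p hA.mu_pos hA.gamma_large
    (fun w hw => hw.1) ?_ z ⟨hz.elim fun x h => h.elim fun t h => h.2.2.1, by simp⟩
  intro y hy
  have h1 := hA.A2 y (abs_lt_of_mem_solutionDomain hsol (hsub hy))
  simp only [Function.uncurry_apply_pair]
  rw [hsol.init_φ y (hsub hy), hsol.init_ψ y (hsub hy)]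
  exact h1

theorem threshold_lt (hA : Assumptions p μ γ₁ γ₂ R Tmax f g)
    (hsol : IsSolutionWithBlowUpCurve p μ R Tmax f g φ ψ T) {z : ℝ × ℝ}
    (hz : z ∈ solutionDomain R T) : threshold p μ < φ z.1 z.2 + ψ z.1 z.2 := by
  have h1 := lower_bound hA hsol hz
  have h2 : threshold p μ < γ₁ + γ₂ := hA.gamma_large
  linarith [h1.1, h1.2]

theorem rawSource_eq_source (hA : Assumptions p μ γ₁ γ₂ R Tmax f g)
    (hsol : IsSolutionWithBlowUpCurve p μ R Tmax f g φ ψ T) {z : ℝ × ℝ}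
    (hz : z ∈ solutionDomain R T) :
    rawSource p μ Prod.snd (Function.uncurry φ) (Function.uncurry ψ) z =
      source p μ z.2 (φ z.1 z.2 + ψ z.1 z.2) :=
  rawSource_eq (by
    have := one_lt_of_threshold_lt (threshold_lt hA hsol hz)
    change 0 < φ z.1 z.2 + ψ z.1 z.2
    linarith)

/-- Both monotonicities of `source` point the same way, so its value at the least sum and the
earliest time, the number `m` of A4, is a lower bound everywhere. -/
theorem source_zero_le (hA : Assumptions p μ γ₁ γ₂ R Tmax f g)
    (hsol : IsSolutionWithBlowUpCurve p μ R Tmax f g φ ψ T) {z : ℝ × ℝ}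
    (hz : z ∈ solutionDomain R T) :
    source p μ 0 (γ₁ + γ₂) ≤
      rawSource p μ Prod.snd (Function.uncurry φ) (Function.uncurry ψ) z := by
  have h1 := lower_bound hA hsol hz
  have h0 : 0 ≤ z.2 := (mem_solutionDomain_iff.1 hz).1
  have h2 := one_lt_of_threshold_lt hA.gamma_large
  rw [rawSource_eq_source hA hsol hz]
  exact (source_mono_time hA.mu_pos le_rfl h0 (by linarith)).trans
    (source_mono hA.one_lt_p hA.mu_pos h0 hA.gamma_large (by linarith [h1.1, h1.2]))

/-- Some strict room in the smallness condition on the slopes of the data: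
initial differences are controlled by the growth of the solution. -/
theorem exists_opening (hA : Assumptions p μ γ₁ γ₂ R Tmax f g) : ∃ κ > 0,
    ∀ x a b : ℝ, |x| < R + Tmax → |x + a| < R + Tmax → |a| ≤ (2 + κ) * b → 0 < b →
      |f (x + a) - f x| < source p μ 0 (γ₁ + γ₂) * b ∧
      |g (x + a) - g x| < source p μ 0 (γ₁ + γ₂) * b := by
  obtain ⟨ε, hε, h⟩ := hA.A4
  have hm : (2 : ℝ) ^ (-p) * (γ₁ + γ₂) ^ p - μ / 2 * (γ₁ + γ₂) = source p μ 0 (γ₁ + γ₂) := by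
    rw [source]; ring
  rw [hm] at h
  have hm0 : 0 < source p μ 0 (γ₁ + γ₂) :=
    source_pos hA.one_lt_p hA.mu_pos le_rfl hA.gamma_large
  set m := source p μ 0 (γ₁ + γ₂) with hmdef
  have main : ∀ F : ℝ → ℝ, ContDiffOn ℝ 4 F (Icc (-(R + Tmax)) (R + Tmax)) →
      (∀ x, |x| < R + Tmax → (2 + ε) * |deriv F x| ≤ m) →
      ∀ x a b : ℝ, |x| < R + Tmax → |x + a| < R + Tmax → |a| ≤ (2 + ε / 2) * b → 0 < b →
      |F (x + a) - F x| < m * b := by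
    intro F hF hF' x a b hx hxa ha hb
    have h1 : ∀ y ∈ Ioo (-(R + Tmax)) (R + Tmax), DifferentiableAt ℝ F y := fun y hy =>
      (hF.contDiffAt (Icc_mem_nhds hy.1 hy.2)).differentiableAt (by norm_num)
    have h2 : ∀ y ∈ Ioo (-(R + Tmax)) (R + Tmax), ‖deriv F y‖ ≤ m / (2 + ε) := fun y hy => by
      rw [le_div_iff₀ (by positivity), Real.norm_eq_abs, mul_comm]
      exact hF' y (abs_lt.2 hy)
    have h3 := (convex_Ioo (-(R + Tmax)) (R + Tmax)).norm_image_sub_le_of_norm_deriv_le h1 h2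
      (abs_lt.1 hx) (abs_lt.1 hxa)
    rw [add_sub_cancel_left, Real.norm_eq_abs, Real.norm_eq_abs] at h3
    calc _ ≤ m / (2 + ε) * |a| := h3
      _ ≤ m / (2 + ε) * ((2 + ε / 2) * b) := by gcongr
      _ = m * b * ((2 + ε / 2) / (2 + ε)) := by field_simp
      _ < m * b * 1 := by
        apply mul_lt_mul_of_pos_left _ (by positivity)
        rw [div_lt_one (by positivity)]; linarith
      _ = m * b := mul_one _
  -- Half of the margin `ε` in A4 widens the admissible directions; the other half keeps the
  -- inequality strict.
  refine ⟨ε / 2, by positivity, fun x a b hx hxa ha hb => ⟨main f hA.A3.1 ?_ x a b hx hxa ha hb,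
    main g hA.A3.2 ?_ x a b hx hxa ha hb⟩⟩
  · intro y hy
    refine le_trans (mul_le_mul_of_nonneg_left ?_ (by positivity)) (h y hy)
    linarith [abs_nonneg (deriv g y)]
  · intro y hy
    refine le_trans (mul_le_mul_of_nonneg_left ?_ (by positivity)) (h y hy)
    linarith [abs_nonneg (deriv f y)]

/-- The solution increases in a cone of directions strictly larger than the light cone. -/
theorem exists_monotone_cone (hA : Assumptions p μ γ₁ γ₂ R Tmax f g)
    (hsol : IsSolutionWithBlowUpCurve p μ R Tmax f g φ ψ T) : ∃ κ > 0, ∀ x t a b : ℝ,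
      (x, t) ∈ solutionDomain R T → (x + a, t + b) ∈ solutionDomain R T → 0 < b →
      |a| ≤ (1 + κ) * b → φ x t < φ (x + a) (t + b) ∧ ψ x t < ψ (x + a) (t + b) := by
  obtain ⟨κ, hκ, hop⟩ := exists_opening hA
  refine ⟨κ, hκ, fun x t a b h1 h2 hb hab => ?_⟩
  have ht0 : 0 ≤ t := (mem_solutionDomain_iff.1 h1).1
  have hshift : ∀ z ∈ backwardCone x t, z + (a, b) ∈ solutionDomain R T := by
    intro z hz
    refine solutionDomain_backward h2 (add_nonneg hz.1 hb.le) ?_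
    have := hz.2
    simp only [Prod.fst_add, Prod.snd_add, add_sub_add_right_eq_sub]
    exact this
  -- The solution is compared with its own translate by `(a, b)` on the backward cone of `(x, t)`.
  have hT1 := hsol.transportOn.mono (backwardCone_subset h1)
  have hT2 := hsol.transportOn.shift hb.le hshift
  have key := hT2.lt_of_lt hT1 ?_ ?_ (x, t) ⟨ht0, by simp⟩
  · simpa using key
  · intro z hz hz0 hlt
    have hzD := backwardCone_subset h1 hz
    rw [rawSource_eq_source hA hsol (hshift z hz), rawSource_eq_source hA hsol hzD]
    refine (source_mono hA.one_lt_p hA.mu_pos hz0.le (threshold_lt hA hsol hzD) hlt.le).trans ?_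
    have h3 := one_lt_of_threshold_lt (threshold_lt hA hsol (hshift z hz))
    exact source_mono_time hA.mu_pos hz0.le (by simpa using hb.le) (by
      change 0 ≤ φ (z + (a, b)).1 (z + (a, b)).2 + ψ (z + (a, b)).1 (z + (a, b)).2
      linarith)
  · intro y hy
    have hyD := backwardCone_subset h1 hy
    have hyD2 : (y + a, b) ∈ solutionDomain R T := by simpa using hshift _ hy
    have hself : (y + a, b) ∈ backwardCone (y + a) b := ⟨hb.le, by simp⟩
    have hT := hsol.transportOn.mono (backwardCone_subset hyD2)
    have hab' := abs_le.1 hab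
    have hbase : ∀ c : ℝ, |c| ≤ b → (y + a + c, (0 : ℝ)) ∈ solutionDomain R T := fun c hc =>
      solutionDomain_backward hyD2 le_rfl (by simpa using hc)
    have hy1 := abs_lt_of_mem_solutionDomain hsol hyD
    constructor
    -- At time zero the translate equals `φ (y + a, b)`, which is at least `f (y + a + b) + m b`
    -- along the characteristic from `(y + a + b, 0)`. From `|a| ≤ (1 + κ) b` follows `|a + b| ≤ (2
    -- + κ) b`: this is the origin of the factor 2 in A4.
    · have h3 := hT.mul_le_left (C := source p μ 0 (γ₁ + γ₂)) hself (fun τ hτ =>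
        source_zero_le hA hsol (backwardCone_subset hyD2 (left_line_mem_backwardCone
          (by rwa [add_sub_cancel_right]) hτ.1.le hτ.2.le)))
      have hb1 := hbase b (by rw [abs_of_pos hb])
      have hb2 := abs_lt_of_mem_solutionDomain hsol hb1
      have h4 := (hop y (a + b) b hy1 (by simpa [add_assoc] using hb2) (by
        rw [abs_le]; constructor <;> linarith) hb).1
      simp only [Function.uncurry_apply_pair, Prod.mk_add_mk, zero_add] at h3 ⊢
      rw [hsol.init_φ _ hb1, add_assoc] at h3
      rw [hsol.init_φ _ hyD]
      linarith [(abs_lt.1 h4).1]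
    · have h3 := hT.mul_le_right (C := source p μ 0 (γ₁ + γ₂)) hself (fun τ hτ =>
        source_zero_le hA hsol (backwardCone_subset hyD2 (right_line_mem_backwardCone
          (by rwa [sub_add_cancel]) hτ.1.le hτ.2.le)))
      have hb1 := hbase (-b) (by rw [abs_neg, abs_of_pos hb])
      have hb2 := abs_lt_of_mem_solutionDomain hsol hb1
      have h4 := (hop y (a + -b) b hy1 (by simpa [add_assoc] using hb2) (by
        rw [abs_le]; constructor <;> linarith) hb).2
      rw [sub_eq_add_neg (y + a) b] at h3
      simp only [Function.uncurry_apply_pair, Prod.mk_add_mk, zero_add] at h3 ⊢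
      rw [hsol.init_ψ _ hb1, add_assoc] at h3
      rw [hsol.init_ψ _ hyD]
      linarith [(abs_lt.1 h4).1]

end solution

/-! ### Blow-up before the horizon and the Lipschitz bound for the curve -/

section solution

variable {p μ γ₁ γ₂ R Tmax : ℝ} {f g : ℝ → ℝ} {φ ψ : ℝ → ℝ → ℝ} {T : ℝ → ℝ}

/-- The source is at least `m > 0` along characteristics. The strictness allows a comparison with
the homogeneous solution to start at any positive time. -/
theorem lt_of_pos_time (hA : Assumptions p μ γ₁ γ₂ R Tmax f g)
    (hsol : IsSolutionWithBlowUpCurve p μ R Tmax f g φ ψ T) {z : ℝ × ℝ}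
    (hz : z ∈ solutionDomain R T) (h0 : 0 < z.2) : γ₁ < φ z.1 z.2 ∧ γ₂ < ψ z.1 z.2 := by
  obtain ⟨x, t⟩ := z
  have hself : (x, t) ∈ backwardCone x t := ⟨h0.le, by simp⟩
  have hT := hsol.transportOn.mono (backwardCone_subset hz)
  have hm : 0 < source p μ 0 (γ₁ + γ₂) * t :=
    mul_pos (source_pos hA.one_lt_p hA.mu_pos le_rfl hA.gamma_large) h0
  have hbase : ∀ c : ℝ, |c| ≤ t → (x + c, (0 : ℝ)) ∈ solutionDomain R T := fun c hc =>
    solutionDomain_backward hz le_rfl (by simpa using hc)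
  constructor
  · have h3 := hT.mul_le_left (C := source p μ 0 (γ₁ + γ₂)) hself (fun τ hτ =>
      source_zero_le hA hsol (backwardCone_subset hz (left_line_mem_backwardCone
        (by rwa [add_sub_cancel_right]) hτ.1.le hτ.2.le)))
    have hb1 := lower_bound hA hsol (hbase t (by rw [abs_of_pos h0]))
    simp only [Function.uncurry_apply_pair] at h3 ⊢
    linarith [hb1.1]
  · have h3 := hT.mul_le_right (C := source p μ 0 (γ₁ + γ₂)) hself (fun τ hτ =>
      source_zero_le hA hsol (backwardCone_subset hz (right_line_mem_backwardCone
        (by rwa [sub_add_cancel]) hτ.1.le hτ.2.le)))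
    have hb1 := lower_bound hA hsol (hbase (-t) (by rw [abs_neg, abs_of_pos h0]))
    rw [sub_eq_add_neg x t] at h3
    simp only [Function.uncurry_apply_pair] at h3 ⊢
    linarith [hb1.2]

/-- Comparison with the spatially homogeneous problem: the blow-up happens before the horizon. -/
theorem blowUpCurve_lt_horizon (hA : Assumptions p μ γ₁ γ₂ R Tmax f g)
    (hsol : IsSolutionWithBlowUpCurve p μ R Tmax f g φ ψ T) {x : ℝ} (hx : |x| < R) :
    T x < Tmax := by
  obtain ⟨T₁, ⟨hT₁, a, b, hac, hbc, ha0, hb0, hab, hlim⟩, hlt⟩ := hA.A1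
  by_contra hcon
  -- If `T x ≥ Tmax`, the solution started at time `δ` lies strictly above the homogeneous one,
  -- whose damping is the stronger, yet stays bounded over `x` up to time `T₁ + δ < T x`.
  set δ := (Tmax - T₁) / 2 with hδ
  have hδ0 : 0 < δ := by rw [hδ]; linarith
  have hTx : T₁ + δ < T x := by rw [hδ]; linarith
  have hcont : ContinuousOn (fun t => φ x t + ψ x t) (Icc 0 (T₁ + δ)) := by
    have hm : ∀ t ∈ Icc 0 (T₁ + δ), (x, t) ∈ solutionDomain R T := fun t ht =>
      mem_solutionDomain hx ht.1 (ht.2.trans_lt hTx)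
    exact (hsol.continuousOn_φ.comp (f := fun t => (x, t)) (by fun_prop) hm).add
      (hsol.continuousOn_ψ.comp (f := fun t => (x, t)) (by fun_prop) hm)
  obtain ⟨M, hM⟩ := (isCompact_Icc.image_of_continuousOn hcont).bddAbove
  have key : ∀ t ∈ Ioo 0 T₁, a t + b t ≤ M := by
    intro t ht
    have hzD : (x, t + δ) ∈ solutionDomain R T :=
      mem_solutionDomain hx (by linarith [ht.1]) (by linarith [ht.2])
    have hshift : ∀ z ∈ backwardCone x t, z + (0, δ) ∈ solutionDomain R T := by
      intro z hz
      refine solutionDomain_backward hzD (add_nonneg hz.1 hδ0.le) ?_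
      have := hz.2
      simp only [Prod.fst_add, Prod.snd_add, add_sub_add_right_eq_sub, add_zero]
      exact this
    have htime : ∀ z ∈ backwardCone x t, z.2 ∈ Ico 0 T₁ := fun z hz =>
      ⟨hz.1, by linarith [hz.2, abs_nonneg (z.1 - x), ht.2]⟩
    have hODE : TransportOn (backwardCone x t) (fun z => a z.2) (fun z => b z.2)
        (rawSource p μ (fun _ => 0) (fun z => a z.2) (fun z => b z.2)) := by
      refine ⟨hac.comp continuousOn_snd htime, hbc.comp continuousOn_snd htime, ?_, ?_⟩
      · intro ξ τ hz hτ
        refine (hab τ ⟨hτ, (htime _ hz).2⟩).1.congr_deriv ?_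
        simp only [rawSource]; ring
      · intro ξ τ hz hτ
        refine (hab τ ⟨hτ, (htime _ hz).2⟩).2.congr_deriv ?_
        simp only [rawSource]; ring
    have hlow := hODE.lower_bound hA.one_lt_p hA.mu_pos hA.gamma_large (fun _ _ => le_rfl)
      (fun y _ => ⟨ha0.ge, hb0.ge⟩)
    have hcmp := (hsol.transportOn.shift hδ0.le hshift).lt_of_lt hODE ?_ ?_ (x, t)
      ⟨ht.1.le, by simp⟩
    · simp only [Prod.mk_add_mk, add_zero, Function.uncurry_apply_pair] at hcmp
      have := hM (mem_image_of_mem _ (⟨by linarith [ht.1], by linarith [ht.2]⟩ :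
        t + δ ∈ Icc 0 (T₁ + δ)))
      linarith [hcmp.1, hcmp.2]
    · intro z hz hz0 hw
      have h1 := hlow z hz
      have h2 : threshold p μ < a z.2 + b z.2 :=
        lt_of_lt_of_le hA.gamma_large (add_le_add h1.1 h1.2)
      have h3 := one_lt_of_threshold_lt h2
      rw [rawSource_eq (Φ := fun z => a z.2) (Ψ := fun z => b z.2) (by linarith),
        rawSource_eq_source hA hsol (hshift z hz)]
      refine (source_mono hA.one_lt_p hA.mu_pos le_rfl h2 hw.le).trans ?_
      refine source_mono_time hA.mu_pos le_rfl (add_nonneg hz.1 hδ0.le) ?_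
      exact (by linarith : (0 : ℝ) ≤ a z.2 + b z.2).trans hw.le
    · intro y hy
      have h1 := lt_of_pos_time hA hsol (hshift _ hy) (by simpa using hδ0)
      simp only [ha0, hb0]
      exact h1
  have h1 := hlim.eventually (eventually_gt_atTop M)
  have h2 : ∀ᶠ t in 𝓝[<] T₁, t ∈ Ioo 0 T₁ := Ioo_mem_nhdsLT hT₁
  obtain ⟨t, ht1, ht2⟩ := (h1.and h2).exists
  exact absurd (key t ht2) (not_le.2 ht1)

/-- `φ + ψ` tends to infinity at the blow-up curve. -/
theorem exists_lt_of_lt_blowUpCurve (hA : Assumptions p μ γ₁ γ₂ R Tmax f g)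
    (hsol : IsSolutionWithBlowUpCurve p μ R Tmax f g φ ψ T) {x : ℝ} (hx : |x| < R) (M : ℝ) :
    ∃ t₀ ∈ Ioo 0 (T x), ∀ t ∈ Ico t₀ (T x), M < φ x t + ψ x t := by
  have h := hsol.maximal x hx (blowUpCurve_lt_horizon hA hsol hx)
  rw [not_bddAbove_iff] at h
  obtain ⟨_, ⟨t₀, ht₀, rfl⟩, hM⟩ := h M
  obtain ⟨κ, hκ, hmono⟩ := exists_monotone_cone hA hsol
  refine ⟨t₀, ht₀, fun t ht => ?_⟩
  have h0 := mem_solutionDomain hx ht₀.1.le ht₀.2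
  have h1 := one_lt_of_threshold_lt (threshold_lt hA hsol h0)
  simp only at h1 hM
  rw [abs_of_pos (by linarith)] at hM
  rcases ht.1.eq_or_lt with h2 | h2
  · rwa [← h2]
  · have h3 := mem_solutionDomain hx (ht₀.1.le.trans ht.1) ht.2
    have := hmono x t₀ 0 (t - t₀) h0 (by simpa using h3) (by linarith) (by
      rw [abs_zero]; exact mul_nonneg (by linarith) (by linarith))
    rw [add_zero, add_sub_cancel] at this
    linarith [this.1, this.2]

/-- If the curve rose too steeply from `x` to `x'`, the points `(x, t₀)` with `t₀` near `T x` would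
all be joined by increasing directions to the fixed point `(x', T x + b)` of the domain, and the
finite value there would bound `φ + ψ` as it blows up over `x`. -/
theorem blowUpCurve_sub_le (hA : Assumptions p μ γ₁ γ₂ R Tmax f g)
    (hsol : IsSolutionWithBlowUpCurve p μ R Tmax f g φ ψ T) : ∃ κ > 0, ∀ x x' : ℝ, |x| < R →
      |x'| < R → (1 + κ) * (T x' - T x) ≤ |x' - x| := by
  obtain ⟨κ, hκ, hmono⟩ := exists_monotone_cone hA hsol
  refine ⟨κ, hκ, fun x x' hx hx' => ?_⟩
  by_contra hcon
  rw [not_le] at hcon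
  obtain ⟨b, hb1, hb2⟩ : ∃ b, |x' - x| / (1 + κ) < b ∧ b < T x' - T x :=
    exists_between (by rwa [div_lt_iff₀ (by positivity), mul_comm])
  have hb0 : 0 < b := lt_of_le_of_lt (by positivity) hb1
  rw [div_lt_iff₀ (by positivity), mul_comm] at hb1
  obtain ⟨t₀, ht₀, h⟩ := exists_lt_of_lt_blowUpCurve hA hsol hx
    (φ x' (T x + b) + ψ x' (T x + b))
  have h1 := h t₀ ⟨le_rfl, ht₀.2⟩
  have hm1 := mem_solutionDomain hx ht₀.1.le ht₀.2
  have hTx := hsol.T_pos x hx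
  have hm2 : (x', t₀ + b) ∈ solutionDomain R T :=
    mem_solutionDomain hx' (by linarith [ht₀.1]) (by linarith [ht₀.2])
  have hm3 : (x', T x + b) ∈ solutionDomain R T :=
    mem_solutionDomain hx' (by linarith) (by linarith)
  have h2 := hmono x t₀ (x' - x) b hm1 (by simpa using hm2) hb0 hb1.le
  have h3 := hmono x' (t₀ + b) 0 (T x - t₀) hm2
    (by rw [add_zero, show t₀ + b + (T x - t₀) = T x + b by ring]; exact hm3)
    (by linarith [ht₀.2]) (by rw [abs_zero]; exact mul_nonneg (by linarith) (by linarith [ht₀.2]))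
  rw [add_zero, show t₀ + b + (T x - t₀) = T x + b by ring] at h3
  rw [add_sub_cancel] at h2
  linarith [h2.1, h2.2, h3.1, h3.2]

theorem fderiv_nonneg_of_increasing {F : ℝ × ℝ → ℝ} {z e : ℝ × ℝ} (h : DifferentiableAt ℝ F z)
    (hinc : ∀ᶠ s : ℝ in 𝓝[>] 0, F z ≤ F (z + s • e)) : 0 ≤ fderiv ℝ F z e := by
  have h1 := (hasDerivAt_add_smul (n := e) h).tendsto_slope_zero_right
  refine ge_of_tendsto h1 ?_
  filter_upwards [hinc, self_mem_nhdsWithin] with s hs hs0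
  simp only [zero_add, zero_smul, add_zero, smul_eq_mul]
  exact mul_nonneg (inv_nonneg.2 (le_of_lt hs0)) (by linarith)

theorem abs_fderiv_le_of_increasing {F : ℝ × ℝ → ℝ} {z : ℝ × ℝ} {κ : ℝ}
    (h : DifferentiableAt ℝ F z)
    (hinc : ∀ a : ℝ, |a| ≤ 1 + κ → ∀ᶠ s : ℝ in 𝓝[>] 0, F z ≤ F (z + s • (a, 1))) (hκ : 0 ≤ 1 + κ) :
    (1 + κ) * |fderiv ℝ F z (1, 0)| ≤ fderiv ℝ F z (0, 1) := by
  have h1 := fderiv_nonneg_of_increasing h (hinc (1 + κ) (abs_of_nonneg hκ).le)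
  have h2 := fderiv_nonneg_of_increasing h (hinc (-(1 + κ)) (by rw [abs_neg, abs_of_nonneg hκ]))
  have e : ∀ a : ℝ, ((a, 1) : ℝ × ℝ) = a • (1, 0) + (0, 1) := fun a => by simp
  rw [e, map_add, map_smul, smul_eq_mul] at h1 h2
  rcases abs_cases (fderiv ℝ F z (1, 0)) with h3 | h3 <;> rw [h3.1] <;> linarith

/-- The derivative bounds that express the monotonicity of the solution in a cone of directions. -/
theorem exists_derivative_bounds (hA : Assumptions p μ γ₁ γ₂ R Tmax f g)
    (hsol : IsSolutionWithBlowUpCurve p μ R Tmax f g φ ψ T) : ∃ κ > 0, ∀ z ∈ solutionDomain R T,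
      0 < z.2 →
      (1 + κ) * |fderiv ℝ (Function.uncurry φ) z (1, 0)| ≤ fderiv ℝ (Function.uncurry φ) z (0, 1) ∧
      (1 + κ) * |fderiv ℝ (Function.uncurry ψ) z (1, 0)| ≤
        fderiv ℝ (Function.uncurry ψ) z (0, 1) := by
  obtain ⟨κ, hκ, hmono⟩ := exists_monotone_cone hA hsol
  refine ⟨κ, hκ, fun z hz hz0 => ?_⟩
  have hev : ∀ a : ℝ, |a| ≤ 1 + κ → ∀ᶠ s : ℝ in 𝓝[>] 0,
      φ z.1 z.2 < φ (z + s • (a, 1)).1 (z + s • (a, 1)).2 ∧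
      ψ z.1 z.2 < ψ (z + s • (a, 1)).1 (z + s • (a, 1)).2 := by
    intro a ha
    have hc : Tendsto (fun s : ℝ => z + s • ((a, 1) : ℝ × ℝ)) (𝓝[>] 0) (𝓝 z) := by
      have : Tendsto (fun s : ℝ => z + s • ((a, 1) : ℝ × ℝ)) (𝓝 0) (𝓝 (z + (0 : ℝ) • ((a, 1) : ℝ × ℝ))) :=
        Continuous.tendsto (by fun_prop) 0
      rw [zero_smul, add_zero] at this
      exact this.mono_left nhdsWithin_le_nhds
    filter_upwards [hc.eventually ((isOpen_solutionDomain_inter R T).mem_nhds ⟨hz, hz0⟩),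
      self_mem_nhdsWithin] with s hs hs0
    have hs0' : 0 < s := hs0
    have e : ((z.1 + s * a, z.2 + s) : ℝ × ℝ) = z + s • (a, 1) := by ext <;> simp
    have := hmono z.1 z.2 (s * a) s hz (by rw [e]; exact hs.1) hs0' (by
      rw [abs_mul, abs_of_pos hs0', mul_comm]
      exact mul_le_mul_of_nonneg_right ha hs0'.le)
    simpa using this
  exact ⟨abs_fderiv_le_of_increasing (hsol.differentiableAt_φ hz hz0)
      (fun a ha => (hev a ha).mono fun s hs => hs.1.le) (by linarith),
    abs_fderiv_le_of_increasing (hsol.differentiableAt_ψ hz hz0)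
      (fun a ha => (hev a ha).mono fun s hs => hs.2.le) (by linarith)⟩

end solution

/-! ### The blow-up regime: what the asymptotics need from the data -/

/-- The properties of the solution near the blow-up curve from which the asymptotics are derived:
`(Φ, Ψ)` is a `C¹` solution on `Ω`, it increases in a cone of directions `|x| ≤ t / θ` wider than
the light cone, and `Φ + Ψ` blows up exactly at the curve `T`, which is `θ`-Lipschitz. -/
structure BlowUpRegime (p μ θ R : ℝ) (Ω : Set (ℝ × ℝ)) (Φ Ψ : ℝ × ℝ → ℝ) (T : ℝ → ℝ) : Prop where
  one_lt_p : 1 < p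
  mu_pos : 0 < μ
  theta_pos : 0 < θ
  theta_lt : θ < 1
  isOpen : IsOpen Ω
  time_pos : ∀ z ∈ Ω, 0 < z.2
  mem : ∀ x t, |x| < R → 0 < t → t < T x → (x, t) ∈ Ω
  smooth_Φ : ContDiffOn ℝ 1 Φ Ω
  smooth_Ψ : ContDiffOn ℝ 1 Ψ Ω
  eq_Φ : ∀ z ∈ Ω, fderiv ℝ Φ z (-1, 1) = source p μ z.2 (Φ z + Ψ z)
  eq_Ψ : ∀ z ∈ Ω, fderiv ℝ Ψ z (1, 1) = source p μ z.2 (Φ z + Ψ z)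
  above : ∀ z ∈ Ω, threshold p μ < Φ z + Ψ z
  pos : ∀ z ∈ Ω, 0 < Φ z ∧ 0 < Ψ z
  slope_Φ : ∀ z ∈ Ω, |fderiv ℝ Φ z (1, 0)| ≤ θ * fderiv ℝ Φ z (0, 1)
  slope_Ψ : ∀ z ∈ Ω, |fderiv ℝ Ψ z (1, 0)| ≤ θ * fderiv ℝ Ψ z (0, 1)
  T_pos : ∀ x, |x| < R → 0 < T x
  blowUp : ∀ x, |x| < R → ∀ M, ∃ t₀ ∈ Ioo 0 (T x), ∀ t ∈ Ico t₀ (T x), M < Φ (x, t) + Ψ (x, t)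
  lipschitz : ∀ x x', |x| < R → |x'| < R → T x' - T x ≤ θ * |x' - x|

theorem exists_blowUpRegime {p μ γ₁ γ₂ R Tmax : ℝ} {f g : ℝ → ℝ} {φ ψ : ℝ → ℝ → ℝ} {T : ℝ → ℝ}
    (hA : Assumptions p μ γ₁ γ₂ R Tmax f g)
    (hsol : IsSolutionWithBlowUpCurve p μ R Tmax f g φ ψ T) : ∃ θ,
    BlowUpRegime p μ θ R (solutionDomain R T ∩ {z | 0 < z.2}) (Function.uncurry φ)
      (Function.uncurry ψ) T := by
  obtain ⟨κ₁, hκ₁, h1⟩ := exists_derivative_bounds hA hsol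
  obtain ⟨κ₂, hκ₂, h2⟩ := blowUpCurve_sub_le hA hsol
  have hκ : 0 < min κ₁ κ₂ := lt_min hκ₁ hκ₂
  have hle : ∀ κ X Y : ℝ, min κ₁ κ₂ ≤ κ → 0 ≤ Y → (1 + κ) * X ≤ Y → X ≤ 1 / (1 + min κ₁ κ₂) * Y := by
    intro κ X Y hk hY h
    rw [one_div, inv_mul_eq_div, le_div_iff₀ (by positivity)]
    rcases le_total 0 X with hX | hX
    · nlinarith
    · nlinarith
  have hnn : ∀ (F : ℝ × ℝ → ℝ) (z : ℝ × ℝ), (1 + κ₁) * |fderiv ℝ F z (1, 0)| ≤ fderiv ℝ F z (0, 1) →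
      0 ≤ fderiv ℝ F z (0, 1) := fun F z h => le_trans (by positivity) h
  refine ⟨1 / (1 + min κ₁ κ₂), ?_⟩
  exact
  { one_lt_p := hA.one_lt_p
    mu_pos := hA.mu_pos
    theta_pos := by positivity
    theta_lt := by rw [div_lt_one (by positivity)]; linarith
    isOpen := isOpen_solutionDomain_inter R T
    time_pos := fun z hz => hz.2
    mem := fun x t hx ht htT => ⟨mem_solutionDomain hx ht.le htT, ht⟩
    smooth_Φ := hsol.contDiffOn_φ
    smooth_Ψ := hsol.contDiffOn_ψ
    eq_Φ := fun z hz => (hsol.fderiv_φ hz.1 hz.2).trans (rawSource_eq_source hA hsol hz.1)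
    eq_Ψ := fun z hz => (hsol.fderiv_ψ hz.1 hz.2).trans (rawSource_eq_source hA hsol hz.1)
    above := fun z hz => threshold_lt hA hsol hz.1
    pos := fun z hz => ⟨hA.gamma₁_pos.trans_le (lower_bound hA hsol hz.1).1,
      hA.gamma₂_pos.trans_le (lower_bound hA hsol hz.1).2⟩
    slope_Φ := fun z hz => hle κ₁ _ _ (min_le_left _ _) (hnn _ _ (h1 z hz.1 hz.2).1)
      (h1 z hz.1 hz.2).1
    slope_Ψ := fun z hz => hle κ₁ _ _ (min_le_left _ _) (hnn _ _ (h1 z hz.1 hz.2).2)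
      (h1 z hz.1 hz.2).2
    T_pos := hsol.T_pos
    blowUp := fun x hx M => exists_lt_of_lt_blowUpCurve hA hsol hx M
    lipschitz := fun x x' hx hx' => hle κ₂ _ _ (min_le_right _ _) (abs_nonneg _)
      (h2 x x' hx hx') }

namespace BlowUpRegime

variable {p μ θ R : ℝ} {Ω : Set (ℝ × ℝ)} {Φ Ψ : ℝ × ℝ → ℝ} {T : ℝ → ℝ}

theorem differentiableAt_Φ (h : BlowUpRegime p μ θ R Ω Φ Ψ T) {z : ℝ × ℝ} (hz : z ∈ Ω) :
    DifferentiableAt ℝ Φ z :=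
  (h.smooth_Φ.contDiffAt (h.isOpen.mem_nhds hz)).differentiableAt one_ne_zero

theorem differentiableAt_Ψ (h : BlowUpRegime p μ θ R Ω Φ Ψ T) {z : ℝ × ℝ} (hz : z ∈ Ω) :
    DifferentiableAt ℝ Ψ z :=
  (h.smooth_Ψ.contDiffAt (h.isOpen.mem_nhds hz)).differentiableAt one_ne_zero

theorem one_lt (h : BlowUpRegime p μ θ R Ω Φ Ψ T) {z : ℝ × ℝ} (hz : z ∈ Ω) : 1 < Φ z + Ψ z :=
  one_lt_of_threshold_lt (h.above z hz)

theorem time_sub_space_Φ (h : BlowUpRegime p μ θ R Ω Φ Ψ T) {z : ℝ × ℝ} (hz : z ∈ Ω) :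
    fderiv ℝ Φ z (0, 1) - fderiv ℝ Φ z (1, 0) = source p μ z.2 (Φ z + Ψ z) := by
  rw [← h.eq_Φ z hz, ← map_sub]; simp

theorem time_add_space_Ψ (h : BlowUpRegime p μ θ R Ω Φ Ψ T) {z : ℝ × ℝ} (hz : z ∈ Ω) :
    fderiv ℝ Ψ z (0, 1) + fderiv ℝ Ψ z (1, 0) = source p μ z.2 (Φ z + Ψ z) := by
  rw [← h.eq_Ψ z hz, ← map_add]; simp

theorem source_pos (h : BlowUpRegime p μ θ R Ω Φ Ψ T) {z : ℝ × ℝ} (hz : z ∈ Ω) :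
    0 < source p μ z.2 (Φ z + Ψ z) :=
  BlowUpCurve.source_pos h.one_lt_p h.mu_pos (h.time_pos z hz).le (h.above z hz)

/-- The equation `Φₜ - Φₓ = source` together with `|Φₓ| ≤ θ Φₜ` places the source between `(1 - θ)
Φₜ` and `(1 + θ) Φₜ`. -/
theorem time_Φ_bounds (h : BlowUpRegime p μ θ R Ω Φ Ψ T) {z : ℝ × ℝ} (hz : z ∈ Ω) :
    0 < fderiv ℝ Φ z (0, 1) ∧ source p μ z.2 (Φ z + Ψ z) ≤ 2 * fderiv ℝ Φ z (0, 1) ∧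
      (1 - θ) * fderiv ℝ Φ z (0, 1) ≤ source p μ z.2 (Φ z + Ψ z) := by
  have h1 := h.time_sub_space_Φ hz
  have h2 := abs_le.1 (h.slope_Φ z hz)
  have h3 := h.source_pos hz
  have h4 := h.theta_lt
  have h5 := h.theta_pos
  have h6 : 0 < fderiv ℝ Φ z (0, 1) := by nlinarith
  refine ⟨h6, ?_, ?_⟩ <;> nlinarith

theorem time_Ψ_bounds (h : BlowUpRegime p μ θ R Ω Φ Ψ T) {z : ℝ × ℝ} (hz : z ∈ Ω) :
    0 < fderiv ℝ Ψ z (0, 1) ∧ source p μ z.2 (Φ z + Ψ z) ≤ 2 * fderiv ℝ Ψ z (0, 1) ∧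
      (1 - θ) * fderiv ℝ Ψ z (0, 1) ≤ source p μ z.2 (Φ z + Ψ z) := by
  have h1 := h.time_add_space_Ψ hz
  have h2 := abs_le.1 (h.slope_Ψ z hz)
  have h3 := h.source_pos hz
  have h4 := h.theta_lt
  have h5 := h.theta_pos
  have h6 : 0 < fderiv ℝ Ψ z (0, 1) := by nlinarith
  refine ⟨h6, ?_, ?_⟩ <;> nlinarith

end BlowUpRegime

/-! ### The blow-up rate -/

/-- The power of `Φ + Ψ` that vanishes linearly at the blow-up curve. -/
noncomputable def invPower (p : ℝ) (Φ Ψ : ℝ × ℝ → ℝ) (z : ℝ × ℝ) : ℝ := (Φ z + Ψ z) ^ (1 - p)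

namespace BlowUpRegime

variable {p μ θ R : ℝ} {Ω : Set (ℝ × ℝ)} {Φ Ψ : ℝ × ℝ → ℝ} {T : ℝ → ℝ}

theorem invPower_pos (h : BlowUpRegime p μ θ R Ω Φ Ψ T) {z : ℝ × ℝ} (hz : z ∈ Ω) :
    0 < invPower p Φ Ψ z := by
  have := h.one_lt hz
  exact Real.rpow_pos_of_pos (by linarith) _

theorem hasFDerivAt_invPower (h : BlowUpRegime p μ θ R Ω Φ Ψ T) {z : ℝ × ℝ} (hz : z ∈ Ω) :
    HasFDerivAt (invPower p Φ Ψ) (((1 - p) * (Φ z + Ψ z) ^ (-p)) •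
      (fderiv ℝ Φ z + fderiv ℝ Ψ z)) z := by
  have h1 := ((h.differentiableAt_Φ hz).hasFDerivAt.add (h.differentiableAt_Ψ hz).hasFDerivAt)
  have h2 : HasDerivAt (fun w : ℝ => w ^ (1 - p)) ((1 - p) * (Φ z + Ψ z) ^ (-p)) (Φ z + Ψ z) := by
    have := Real.hasDerivAt_rpow_const (x := Φ z + Ψ z) (p := 1 - p)
      (Or.inl (by have := h.one_lt hz; positivity))
    rwa [show 1 - p - 1 = -p by ring] at this
  exact h2.comp_hasFDerivAt z h1

theorem source_mul_rpow_bounds (h : BlowUpRegime p μ θ R Ω Φ Ψ T) {z : ℝ × ℝ} (hz : z ∈ Ω) :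
    (2 : ℝ) ^ (-p) / 2 ≤ (Φ z + Ψ z) ^ (-p) * source p μ z.2 (Φ z + Ψ z) ∧
      (Φ z + Ψ z) ^ (-p) * source p μ z.2 (Φ z + Ψ z) ≤ (2 : ℝ) ^ (-p) := by
  have hw := h.one_lt hz
  have hw0 : 0 < Φ z + Ψ z := by linarith
  have h1 := le_source h.one_lt_p h.mu_pos (h.time_pos z hz).le (h.above z hz)
  have h2 := source_le (p := p) h.mu_pos (h.time_pos z hz).le hw0
  have h3 : (Φ z + Ψ z) ^ (-p) * (Φ z + Ψ z) ^ p = 1 := by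
    rw [← Real.rpow_add hw0]; simp
  have h4 : 0 < (Φ z + Ψ z) ^ (-p) := Real.rpow_pos_of_pos hw0 _
  constructor
  · calc (2 : ℝ) ^ (-p) / 2 = (Φ z + Ψ z) ^ (-p) * ((2 : ℝ) ^ (-p) * (Φ z + Ψ z) ^ p / 2) := by
          rw [show (Φ z + Ψ z) ^ (-p) * ((2 : ℝ) ^ (-p) * (Φ z + Ψ z) ^ p / 2) =
            ((Φ z + Ψ z) ^ (-p) * (Φ z + Ψ z) ^ p) * ((2 : ℝ) ^ (-p) / 2) by ring, h3, one_mul]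
      _ ≤ _ := by gcongr
  · calc _ ≤ (Φ z + Ψ z) ^ (-p) * ((2 : ℝ) ^ (-p) * (Φ z + Ψ z) ^ p) := by gcongr
      _ = (2 : ℝ) ^ (-p) := by
          rw [show (Φ z + Ψ z) ^ (-p) * ((2 : ℝ) ^ (-p) * (Φ z + Ψ z) ^ p) =
            ((Φ z + Ψ z) ^ (-p) * (Φ z + Ψ z) ^ p) * (2 : ℝ) ^ (-p) by ring, h3, one_mul]

/-- The time derivatives are comparable to the source, hence to the `p`-th power of `Φ + Ψ`, which
the factor with exponent `-p` cancels. -/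
theorem time_invPower_bounds (h : BlowUpRegime p μ θ R Ω Φ Ψ T) {z : ℝ × ℝ} (hz : z ∈ Ω) :
    (p - 1) * 2 ^ (-p) / 2 ≤ (p - 1) * (Φ z + Ψ z) ^ (-p) *
      (fderiv ℝ Φ z (0, 1) + fderiv ℝ Ψ z (0, 1)) ∧
    (p - 1) * (Φ z + Ψ z) ^ (-p) * (fderiv ℝ Φ z (0, 1) + fderiv ℝ Ψ z (0, 1)) ≤
      2 * (p - 1) * 2 ^ (-p) / (1 - θ) := by
  have hp := h.one_lt_p
  have hθ : 0 < 1 - θ := by linarith [h.theta_lt]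
  have hw := h.one_lt hz
  have h4 : 0 < (Φ z + Ψ z) ^ (-p) := Real.rpow_pos_of_pos (by linarith) _
  obtain ⟨h1, h2⟩ := h.source_mul_rpow_bounds hz
  have hΦ := h.time_Φ_bounds hz
  have hΨ := h.time_Ψ_bounds hz
  have hp1 : 0 < p - 1 := by linarith
  constructor
  · calc (p - 1) * 2 ^ (-p) / 2 = (p - 1) * (2 ^ (-p) / 2) := by ring
      _ ≤ (p - 1) * ((Φ z + Ψ z) ^ (-p) * source p μ z.2 (Φ z + Ψ z)) := by gcongr
      _ ≤ (p - 1) * ((Φ z + Ψ z) ^ (-p) * (fderiv ℝ Φ z (0, 1) + fderiv ℝ Ψ z (0, 1))) := by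
          gcongr; linarith
      _ = _ := by ring
  · rw [le_div_iff₀ hθ]
    calc _ = (p - 1) * ((Φ z + Ψ z) ^ (-p) *
          ((1 - θ) * fderiv ℝ Φ z (0, 1) + (1 - θ) * fderiv ℝ Ψ z (0, 1))) := by ring
      _ ≤ (p - 1) * ((Φ z + Ψ z) ^ (-p) * (2 * source p μ z.2 (Φ z + Ψ z))) := by
          gcongr; linarith
      _ = 2 * (p - 1) * ((Φ z + Ψ z) ^ (-p) * source p μ z.2 (Φ z + Ψ z)) := by ring
      _ ≤ _ := by gcongr

theorem hasDerivAt_invPower (h : BlowUpRegime p μ θ R Ω Φ Ψ T) {x t : ℝ} (hz : (x, t) ∈ Ω) :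
    HasDerivAt (fun t => invPower p Φ Ψ (x, t)) (-((p - 1) * (Φ (x, t) + Ψ (x, t)) ^ (-p) *
      (fderiv ℝ Φ (x, t) (0, 1) + fderiv ℝ Ψ (x, t) (0, 1)))) t := by
  have h1 : HasDerivAt (fun t' : ℝ => ((x, t') : ℝ × ℝ)) (0, 1) t :=
    (hasDerivAt_const t x).prodMk (hasDerivAt_id t)
  refine ((h.hasFDerivAt_invPower hz).comp_hasDerivAt t h1).congr_deriv ?_
  simp only [smul_apply, add_apply, smul_eq_mul]
  ring

theorem exists_invPower_lt (h : BlowUpRegime p μ θ R Ω Φ Ψ T) {x : ℝ} (hx : |x| < R) {η : ℝ}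
    (hη : 0 < η) : ∃ t₀ ∈ Ioo 0 (T x), ∀ t ∈ Ico t₀ (T x), invPower p Φ Ψ (x, t) < η := by
  have hp := h.one_lt_p
  obtain ⟨t₀, ht₀, hM⟩ := h.blowUp x hx (η ^ (1 / (1 - p)))
  refine ⟨t₀, ht₀, fun t ht => ?_⟩
  have h1 := hM t ht
  have h2 : 0 < η ^ (1 / (1 - p)) := Real.rpow_pos_of_pos hη _
  have h3 := Real.rpow_lt_rpow_of_neg h2 h1 (by linarith : 1 - p < 0)
  rwa [← Real.rpow_mul hη.le, one_div, inv_mul_cancel₀ (by linarith), Real.rpow_one] at h3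

/-- Two-sided linear bounds: the blow-up rate. -/
theorem invPower_bounds (h : BlowUpRegime p μ θ R Ω Φ Ψ T) {x t : ℝ} (hx : |x| < R) (ht : 0 < t)
    (htT : t < T x) :
    (p - 1) * 2 ^ (-p) / 2 * (T x - t) ≤ invPower p Φ Ψ (x, t) ∧
      invPower p Φ Ψ (x, t) ≤ 2 * (p - 1) * 2 ^ (-p) / (1 - θ) * (T x - t) := by
  have hmem : ∀ τ, t ≤ τ → τ < T x → (x, τ) ∈ Ω := fun τ h1 h2 => h.mem x τ hx (by linarith) h2
  have hinc : ∀ τ, t ≤ τ → τ < T x →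
      (p - 1) * 2 ^ (-p) / 2 * (τ - t) ≤ invPower p Φ Ψ (x, t) - invPower p Φ Ψ (x, τ) ∧
      invPower p Φ Ψ (x, t) - invPower p Φ Ψ (x, τ) ≤
        2 * (p - 1) * 2 ^ (-p) / (1 - θ) * (τ - t) := by
    intro τ h1 h2
    have hd : ∀ σ ∈ Icc t τ, HasDerivAt (fun t => -invPower p Φ Ψ (x, t))
        ((p - 1) * (Φ (x, σ) + Ψ (x, σ)) ^ (-p) *
        (fderiv ℝ Φ (x, σ) (0, 1) + fderiv ℝ Ψ (x, σ) (0, 1))) σ := fun σ hσ => by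
      exact (h.hasDerivAt_invPower (hmem σ hσ.1 (hσ.2.trans_lt h2))).neg.congr_deriv (neg_neg _)
    have hc : ContinuousOn (fun t => -invPower p Φ Ψ (x, t)) (Icc t τ) := fun σ hσ =>
      (hd σ hσ).continuousAt.continuousWithinAt
    have h3 := mul_sub_le_of_hasDerivAt h1 hc (fun σ hσ => hd σ (Ioo_subset_Icc_self hσ))
      (fun σ hσ => (h.time_invPower_bounds (hmem σ hσ.1.le (hσ.2.trans h2))).1)
    have h4 := sub_le_mul_of_hasDerivAt h1 hc (fun σ hσ => hd σ (Ioo_subset_Icc_self hσ))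
      (fun σ hσ => (h.time_invPower_bounds (hmem σ hσ.1.le (hσ.2.trans h2))).2)
    constructor <;> linarith
  have hp := h.one_lt_p
  have hθ : 0 < 1 - θ := by linarith [h.theta_lt]
  have hc1 : 0 < (p - 1) * (2 : ℝ) ^ (-p) / 2 := by
    have : 0 < p - 1 := by linarith
    positivity
  have hc2 : 0 < 2 * (p - 1) * (2 : ℝ) ^ (-p) / (1 - θ) := by
    have : 0 < p - 1 := by linarith
    positivity
  -- Both bounds come from letting the later time tend to `T x`: the lower one needs only positivity
  -- of `invPower` there, the upper one that it tends to zero.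
  constructor
  · refine le_of_forall_pos_le_add fun η hη => ?_
    have h1 : max t (T x - η / ((p - 1) * 2 ^ (-p) / 2)) < T x :=
      max_lt htT (by have := div_pos hη hc1; linarith)
    have h2 := (hinc _ (le_max_left _ _) h1).1
    have h3 := h.invPower_pos (hmem _ (le_max_left _ _) h1)
    have h4 := le_max_right t (T x - η / ((p - 1) * 2 ^ (-p) / 2))
    have h5 : (p - 1) * 2 ^ (-p) / 2 * (T x - η / ((p - 1) * 2 ^ (-p) / 2) - t) ≤
        (p - 1) * 2 ^ (-p) / 2 * (max t (T x - η / ((p - 1) * 2 ^ (-p) / 2)) - t) := by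
      gcongr
    have h6 : (p - 1) * 2 ^ (-p) / 2 * (T x - η / ((p - 1) * 2 ^ (-p) / 2) - t) =
        (p - 1) * 2 ^ (-p) / 2 * (T x - t) - η := by
      have := hc1.ne'
      rw [show (p - 1) * 2 ^ (-p) / 2 * (T x - η / ((p - 1) * 2 ^ (-p) / 2) - t) =
        (p - 1) * 2 ^ (-p) / 2 * (T x - t) -
        (p - 1) * 2 ^ (-p) / 2 * (η / ((p - 1) * 2 ^ (-p) / 2)) by ring, mul_div_cancel₀ _ this]
    linarith
  · refine le_of_forall_pos_le_add fun η hη => ?_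
    obtain ⟨t₀, ht₀, hlt⟩ := h.exists_invPower_lt hx hη
    have h1 : max t t₀ < T x := max_lt htT ht₀.2
    have h2 := (hinc _ (le_max_left _ _) h1).2
    have h3 := hlt _ ⟨le_max_right t t₀, h1⟩
    have h4 : 2 * (p - 1) * 2 ^ (-p) / (1 - θ) * (max t t₀ - t) ≤
        2 * (p - 1) * 2 ^ (-p) / (1 - θ) * (T x - t) := by gcongr
    linarith

end BlowUpRegime

/-! ### The relaxation system of the slope ratios -/

/-- The ratio of the space derivative to the time derivative. -/
noncomputable def slopeRatio (F : ℝ × ℝ → ℝ) (z : ℝ × ℝ) : ℝ := fderiv ℝ F z (1, 0) / fderiv ℝ F z (0, 1)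

namespace BlowUpRegime

variable {p μ θ R : ℝ} {Ω : Set (ℝ × ℝ)} {Φ Ψ : ℝ × ℝ → ℝ} {T : ℝ → ℝ}

/-- The derivative of the nonlinearity with respect to `Φ + Ψ`. -/
noncomputable def sourceDeriv (p μ t w : ℝ) : ℝ := (2 : ℝ) ^ (-p) * (p * w ^ (p - 1)) - μ / (1 + t) / 2

theorem hasFDerivAt_source (h : BlowUpRegime p μ θ R Ω Φ Ψ T) {z : ℝ × ℝ} (hz : z ∈ Ω) :
    HasFDerivAt (fun z => source p μ z.2 (Φ z + Ψ z))
      (sourceDeriv p μ z.2 (Φ z + Ψ z) • (fderiv ℝ Φ z + fderiv ℝ Ψ z) +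
        (μ / (1 + z.2) ^ 2 * ((Φ z + Ψ z) / 2)) • ContinuousLinearMap.snd ℝ ℝ ℝ) z := by
  have hw := h.one_lt hz
  have ht := h.time_pos z hz
  have h1 := ((h.differentiableAt_Φ hz).hasFDerivAt.add (h.differentiableAt_Ψ hz).hasFDerivAt)
  have h2 : HasDerivAt (fun w : ℝ => (2 : ℝ) ^ (-p) * w ^ p)
      ((2 : ℝ) ^ (-p) * (p * (Φ z + Ψ z) ^ (p - 1))) (Φ z + Ψ z) :=
    (Real.hasDerivAt_rpow_const (Or.inl (by linarith))).const_mul _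
  have h3 : HasDerivAt (fun t : ℝ => μ / (1 + t)) (-(μ / (1 + z.2) ^ 2)) z.2 := by
    have := ((hasDerivAt_id z.2).const_add 1).inv (by simp only [id]; linarith) |>.const_mul μ
    refine (this.congr_deriv ?_).congr_of_eventuallyEq (Eventually.of_forall fun t => ?_)
    · simp only [id]; ring
    · simp [div_eq_mul_inv]
  have h4 : HasFDerivAt (fun z : ℝ × ℝ => μ / (1 + z.2)) _ z :=
    h3.comp_hasFDerivAt z (hasFDerivAt_snd (𝕜 := ℝ) (p := z))
  have h5 := (h2.comp_hasFDerivAt z h1).sub (h4.mul (h1.mul_const (1 / 2)))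
  refine (h5.congr_of_eventuallyEq (Eventually.of_forall fun w => ?_)).congr_fderiv ?_
  · simp only [source, Function.comp_apply, Pi.sub_apply, Pi.mul_apply, Pi.add_apply]; ring
  · ext <;>
    · simp [sourceDeriv]
      ring

theorem contDiffOn_source (h : BlowUpRegime p μ θ R Ω Φ Ψ T) :
    ContDiffOn ℝ 1 (fun z => source p μ z.2 (Φ z + Ψ z)) Ω := by
  have h1 := h.smooth_Φ.add h.smooth_Ψ
  have h2 : ContDiffOn ℝ 1 (fun z => (Φ z + Ψ z) ^ p) Ω :=
    h1.rpow_const_of_ne fun z hz => by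
      have := h.one_lt hz
      exact (by linarith : (0 : ℝ) < Φ z + Ψ z).ne'
  have h3 : ContDiffOn ℝ 1 (fun z : ℝ × ℝ => μ / (1 + z.2)) Ω :=
    contDiffOn_const.div (contDiffOn_const.add contDiff_snd.contDiffOn) fun z hz => by
      have := h.time_pos z hz
      positivity
  exact (contDiffOn_const.mul h2).sub (h3.mul (h1.div_const 2))

/-- The equation differentiated in the direction `e`, legitimate along the characteristic although
`Φ` is only `C¹`. The term with `e.2` comes from the explicit time dependence of the damping. -/
theorem hasDerivAt_fderiv_left (h : BlowUpRegime p μ θ R Ω Φ Ψ T) {ξ τ : ℝ}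
    (hz : (ξ - τ, τ) ∈ Ω) (e : ℝ × ℝ) :
    HasDerivAt (fun τ => fderiv ℝ Φ (ξ - τ, τ) e)
      (sourceDeriv p μ τ (Φ (ξ - τ, τ) + Ψ (ξ - τ, τ)) *
        (fderiv ℝ Φ (ξ - τ, τ) e + fderiv ℝ Ψ (ξ - τ, τ) e) +
        μ / (1 + τ) ^ 2 * ((Φ (ξ - τ, τ) + Ψ (ξ - τ, τ)) / 2) * e.2) τ := by
  have key := hasDerivAt_fderiv_of_fderiv_eq h.isOpen h.smooth_Φ h.contDiffOn_source (e := e)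
    h.eq_Φ hz
  rw [(h.hasFDerivAt_source hz).fderiv] at key
  have e1 : ∀ τ : ℝ, ξ - τ = ξ + -1 * τ := fun τ => by ring
  simp only [e1] at key ⊢
  have := hasDerivAt_line_of_hasDerivAt_zero (F := fun z => fderiv ℝ Φ z e) key
  simpa [mul_add] using this

theorem hasDerivAt_fderiv_right (h : BlowUpRegime p μ θ R Ω Φ Ψ T) {ξ τ : ℝ}
    (hz : (ξ + τ, τ) ∈ Ω) (e : ℝ × ℝ) :
    HasDerivAt (fun τ => fderiv ℝ Ψ (ξ + τ, τ) e)
      (sourceDeriv p μ τ (Φ (ξ + τ, τ) + Ψ (ξ + τ, τ)) *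
        (fderiv ℝ Φ (ξ + τ, τ) e + fderiv ℝ Ψ (ξ + τ, τ) e) +
        μ / (1 + τ) ^ 2 * ((Φ (ξ + τ, τ) + Ψ (ξ + τ, τ)) / 2) * e.2) τ := by
  have e1 : ξ + τ = ξ + 1 * τ := by ring
  rw [e1] at hz
  have key := hasDerivAt_fderiv_of_fderiv_eq h.isOpen h.smooth_Ψ h.contDiffOn_source (e := e)
    h.eq_Ψ hz
  rw [(h.hasFDerivAt_source hz).fderiv] at key
  have := hasDerivAt_line_of_hasDerivAt_zero (F := fun z => fderiv ℝ Ψ z e) key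
  simpa [mul_add] using this

theorem slopeRatio_Φ_abs_le (h : BlowUpRegime p μ θ R Ω Φ Ψ T) {z : ℝ × ℝ} (hz : z ∈ Ω) :
    |slopeRatio Φ z| ≤ θ := by
  rw [slopeRatio, abs_div, abs_of_pos (h.time_Φ_bounds hz).1, div_le_iff₀ (h.time_Φ_bounds hz).1]
  exact h.slope_Φ z hz

theorem slopeRatio_Ψ_abs_le (h : BlowUpRegime p μ θ R Ω Φ Ψ T) {z : ℝ × ℝ} (hz : z ∈ Ω) :
    |slopeRatio Ψ z| ≤ θ := by
  rw [slopeRatio, abs_div, abs_of_pos (h.time_Ψ_bounds hz).1, div_le_iff₀ (h.time_Ψ_bounds hz).1]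
  exact h.slope_Ψ z hz

theorem continuousOn_slopeRatio_Φ (h : BlowUpRegime p μ θ R Ω Φ Ψ T) :
    ContinuousOn (slopeRatio Φ) Ω := by
  have h1 := h.smooth_Φ.continuousOn_fderiv_of_isOpen h.isOpen le_rfl
  exact (h1.clm_apply continuousOn_const).div (h1.clm_apply continuousOn_const)
    fun z hz => (h.time_Φ_bounds hz).1.ne'

theorem continuousOn_slopeRatio_Ψ (h : BlowUpRegime p μ θ R Ω Φ Ψ T) :
    ContinuousOn (slopeRatio Ψ) Ω := by
  have h1 := h.smooth_Ψ.continuousOn_fderiv_of_isOpen h.isOpen le_rfl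
  exact (h1.clm_apply continuousOn_const).div (h1.clm_apply continuousOn_const)
    fun z hz => (h.time_Ψ_bounds hz).1.ne'

/-- Above the threshold the damping cannot spoil the growth of the nonlinearity. With the linear
bounds on `invPower`, this derivative is of the order of the reciprocal distance to the curve. -/
theorem sourceDeriv_bounds (h : BlowUpRegime p μ θ R Ω Φ Ψ T) {z : ℝ × ℝ} (hz : z ∈ Ω) :
    (2 : ℝ) ^ (-p) / 2 / invPower p Φ Ψ z ≤ sourceDeriv p μ z.2 (Φ z + Ψ z) ∧
      sourceDeriv p μ z.2 (Φ z + Ψ z) ≤ (2 : ℝ) ^ (-p) * p / invPower p Φ Ψ z := by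
  have hw := h.one_lt hz
  have hp := h.one_lt_p
  have h1 := mul_lt_of_threshold_lt hp h.mu_pos (h.above z hz)
  have h2 := damping_le h.mu_pos (h.time_pos z hz).le
  have h3 : (Φ z + Ψ z) ^ (p - 1) = 1 / invPower p Φ Ψ z := by
    rw [invPower, one_div, ← Real.rpow_neg (by linarith)]; congr 1; ring
  have h4 := h.mu_pos
  have h5 : 0 < (2 : ℝ) ^ (-p) * (1 / invPower p Φ Ψ z) := by
    have := h.invPower_pos hz
    positivity
  rw [h3] at h1
  rw [sourceDeriv, h3]
  constructor
  · rw [show (2 : ℝ) ^ (-p) / 2 / invPower p Φ Ψ z = (2 : ℝ) ^ (-p) * (1 / invPower p Φ Ψ z) / 2 by ring,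
      show (2 : ℝ) ^ (-p) * (p * (1 / invPower p Φ Ψ z)) = p * ((2 : ℝ) ^ (-p) * (1 / invPower p Φ Ψ z)) by ring]
    nlinarith
  · rw [show (2 : ℝ) ^ (-p) * p / invPower p Φ Ψ z = (2 : ℝ) ^ (-p) * (p * (1 / invPower p Φ Ψ z)) by ring]
    linarith [h2.1]

/-- The error term due to the time dependence of the damping is bounded. -/
theorem damping_error_le (h : BlowUpRegime p μ θ R Ω Φ Ψ T) {z : ℝ × ℝ} (hz : z ∈ Ω) {D r : ℝ}
    (hD : source p μ z.2 (Φ z + Ψ z) ≤ 2 * D) (hr : |r| ≤ θ) :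
    |r * (μ / (1 + z.2) ^ 2 * ((Φ z + Ψ z) / 2)) / D| ≤ 2 * μ * 2 ^ p := by
  have hw := h.one_lt hz
  have hp := h.one_lt_p
  have hμ := h.mu_pos
  have ht := h.time_pos z hz
  have h1 := le_source hp hμ ht.le (h.above z hz)
  have h2 : Φ z + Ψ z ≤ (Φ z + Ψ z) ^ p := by
    conv_lhs => rw [← Real.rpow_one (Φ z + Ψ z)]
    exact Real.rpow_le_rpow_of_exponent_le hw.le hp.le
  have h3 : (2 : ℝ) ^ (-p) * (Φ z + Ψ z) ≤ 4 * D := by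
    have : (2 : ℝ) ^ (-p) * (Φ z + Ψ z) ≤ (2 : ℝ) ^ (-p) * (Φ z + Ψ z) ^ p := by gcongr
    linarith
  have h4 : Φ z + Ψ z ≤ 2 ^ p * (4 * D) := by
    calc Φ z + Ψ z = 2 ^ p * ((2 : ℝ) ^ (-p) * (Φ z + Ψ z)) := by
          rw [← mul_assoc, ← Real.rpow_add (by norm_num)]; simp
      _ ≤ _ := by gcongr
  have hD0 : 0 < D := by
    have : 0 < 2 ^ p * (4 * D) := by linarith
    have := pos_of_mul_pos_right this (by positivity)
    linarith
  have h5 : μ / (1 + z.2) ^ 2 ≤ μ := div_le_self hμ.le (one_le_pow₀ (by linarith))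
  have h6 : |r| ≤ 1 := hr.trans h.theta_lt.le
  rw [abs_div, abs_mul, abs_of_pos hD0, div_le_iff₀ hD0,
    abs_of_nonneg (show 0 ≤ μ / (1 + z.2) ^ 2 * ((Φ z + Ψ z) / 2) by positivity)]
  calc _ ≤ 1 * (μ * ((Φ z + Ψ z) / 2)) := by gcongr
    _ ≤ 1 * (μ * (2 ^ p * (4 * D) / 2)) := by gcongr
    _ = _ := by ring

end BlowUpRegime

/-! ### Common limit of the slope ratios on the curve -/

namespace BlowUpRegime

variable {p μ θ R : ℝ} {Ω : Set (ℝ × ℝ)} {Φ Ψ : ℝ × ℝ → ℝ} {T : ℝ → ℝ}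

/-- Since `T` is `θ`-Lipschitz with `θ < 1`, inside a backward cone the vertical distance to the
curve is comparable to the depth below the vertex; so rates in terms of the former become rates in
terms of the latter. -/
theorem cone_geometry (h : BlowUpRegime p μ θ R Ω Φ Ψ T) {x₁ S : ℝ} (hx : |x₁| + S < R)
    (hS : S < T x₁) {z : ℝ × ℝ} (hz : z ∈ puncturedCone x₁ (T x₁) S) :
    z ∈ Ω ∧ |z.1| < R ∧ (1 - θ) * (T x₁ - z.2) ≤ T z.1 - z.2 ∧
      T z.1 - z.2 ≤ 2 * (T x₁ - z.2) := by
  obtain ⟨h1, h2, h3⟩ := hz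
  have hz1 : |z.1| < R := by
    have := abs_add_le (z.1 - x₁) x₁
    rw [sub_add_cancel] at this
    linarith
  have hx1 : |x₁| < R := by linarith
  have hθ := h.theta_lt
  have hθ0 := h.theta_pos
  have h4 := h.lipschitz z.1 x₁ hz1 hx1
  have h5 := h.lipschitz x₁ z.1 hx1 hz1
  rw [abs_sub_comm] at h4
  have h6 : θ * |z.1 - x₁| ≤ θ * (T x₁ - z.2) := by gcongr
  have h7 : θ * (T x₁ - z.2) ≤ 1 * (T x₁ - z.2) := by gcongr
  have h8 : 0 < (1 - θ) * (T x₁ - z.2) := mul_pos (by linarith) h1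
  refine ⟨h.mem z.1 z.2 hz1 (by linarith) (by linarith), hz1, by linarith, by linarith⟩

/-- The constants in the relaxation system of the slope ratios. -/
theorem exists_coneSystem (h : BlowUpRegime p μ θ R Ω Φ Ψ T) : ∃ k K E : ℝ, 0 < k ∧ k ≤ K ∧ 0 ≤ E ∧
    ∀ x₁ S : ℝ, |x₁| + S < R → S < T x₁ →
      ConeSystem x₁ (T x₁) S k K E (slopeRatio Ψ) (slopeRatio Φ) := by
  have hp := h.one_lt_p
  have hp1 : 0 < p - 1 := by linarith
  have hθ : 0 < 1 - θ := by linarith [h.theta_lt]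
  have hμ := h.mu_pos
  set c₁ := (p - 1) * (2 : ℝ) ^ (-p) / 2 with hc1
  set c₂ := 2 * (p - 1) * (2 : ℝ) ^ (-p) / (1 - θ) with hc2
  have hc10 : 0 < c₁ := by positivity
  have hc20 : 0 < c₂ := by positivity
  set k := (2 : ℝ) ^ (-p) / 2 / (c₂ * 2) * ((1 - θ) / 2) with hk
  set K := (2 : ℝ) ^ (-p) * p / (c₁ * (1 - θ)) * (2 / (1 - θ)) with hK
  have hk0 : 0 < k := by positivity
  refine ⟨k, max k K, 2 * μ * 2 ^ p, hk0, le_max_left _ _, by positivity, fun x₁ S hx hS => ?_⟩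
  have hgeo := fun z hz => h.cone_geometry hx hS (z := z) hz
  have hsub : puncturedCone x₁ (T x₁) S ⊆ Ω := fun z hz => (hgeo z hz).1
  -- bounds for the rates
  have hrate : ∀ z ∈ puncturedCone x₁ (T x₁) S, ∀ A B : ℝ, 0 < A → 0 < B →
      (1 - θ) * A ≤ 2 * B → (1 - θ) * B ≤ 2 * A →
      k / (T x₁ - z.2) ≤ sourceDeriv p μ z.2 (Φ z + Ψ z) * (B / A) ∧
      sourceDeriv p μ z.2 (Φ z + Ψ z) * (B / A) ≤ max k K / (T x₁ - z.2) := by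
    intro z hz A B hA hB hAB hBA
    obtain ⟨g1, g2, g3, g4⟩ := hgeo z hz
    have hr : 0 < T x₁ - z.2 := hz.1
    obtain ⟨s1, s2⟩ := h.sourceDeriv_bounds g1
    have hg0 := h.invPower_pos g1
    have h8 : 0 < (1 - θ) * (T x₁ - z.2) := mul_pos hθ hr
    obtain ⟨i1, i2⟩ := h.invPower_bounds (x := z.1) (t := z.2) g2 (h.time_pos z g1) (by linarith)
    rw [← hc1] at i1
    rw [← hc2] at i2
    have i3 : c₁ * ((1 - θ) * (T x₁ - z.2)) ≤ invPower p Φ Ψ z :=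
      le_trans (mul_le_mul_of_nonneg_left g3 hc10.le) i1
    have i4 : invPower p Φ Ψ z ≤ c₂ * (2 * (T x₁ - z.2)) :=
      le_trans i2 (mul_le_mul_of_nonneg_left g4 hc20.le)
    have q1 : (1 - θ) / 2 ≤ B / A := by
      rw [div_le_div_iff₀ (by norm_num) hA]; linarith
    have q2 : B / A ≤ 2 / (1 - θ) := by
      rw [div_le_div_iff₀ hA hθ]; linarith
    have hG0 : 0 < (2 : ℝ) ^ (-p) / 2 / invPower p Φ Ψ z := by positivity
    constructor
    · calc k / (T x₁ - z.2) = (2 : ℝ) ^ (-p) / 2 / (c₂ * (2 * (T x₁ - z.2))) * ((1 - θ) / 2) := by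
            rw [hk]; field_simp
        _ ≤ (2 : ℝ) ^ (-p) / 2 / invPower p Φ Ψ z * (B / A) := by gcongr
        _ ≤ _ := by gcongr
    · calc _ ≤ (2 : ℝ) ^ (-p) * p / invPower p Φ Ψ z * (2 / (1 - θ)) := by gcongr
        _ ≤ (2 : ℝ) ^ (-p) * p / (c₁ * ((1 - θ) * (T x₁ - z.2))) * (2 / (1 - θ)) := by gcongr
        _ = K / (T x₁ - z.2) := by rw [hK]; field_simp
        _ ≤ _ := by gcongr; exact le_max_right _ _
  refine ⟨h.continuousOn_slopeRatio_Ψ.mono hsub, h.continuousOn_slopeRatio_Φ.mono hsub, ?_, ?_⟩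
  · intro ξ τ hz
    have hΩ := hsub hz
    have hΦ := h.time_Φ_bounds hΩ
    have hΨ := h.time_Ψ_bounds hΩ
    obtain ⟨r1, r2⟩ := hrate _ hz _ _ hΨ.1 hΦ.1 (by linarith [hΨ.2.2, hΦ.2.1])
      (by linarith [hΨ.2.1, hΦ.2.2])
    -- By the quotient rule the ratio of `Ψ` relaxes to that of `Φ` at rate `sourceDeriv * (Φₜ /
    -- Ψₜ)`; what remains is the damping term, divided by `Ψₜ`.
    refine ⟨_, _, r1, r2, (h.hasDerivAt_fderiv_right hΩ (1, 0)).div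
      (h.hasDerivAt_fderiv_right hΩ (0, 1)) hΨ.1.ne', ?_⟩
    have herr := h.damping_error_le hΩ hΨ.2.1 (h.slopeRatio_Ψ_abs_le hΩ)
    rw [← abs_neg] at herr
    convert herr using 2
    have h1 := hΦ.1.ne'
    have h2 := hΨ.1.ne'
    simp only [slopeRatio]
    field_simp
    ring
  · intro ξ τ hz
    have hΩ := hsub hz
    have hΦ := h.time_Φ_bounds hΩ
    have hΨ := h.time_Ψ_bounds hΩ
    obtain ⟨r1, r2⟩ := hrate _ hz _ _ hΦ.1 hΨ.1 (by linarith [hΨ.2.1, hΦ.2.2])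
      (by linarith [hΨ.2.2, hΦ.2.1])
    refine ⟨_, _, r1, r2, (h.hasDerivAt_fderiv_left hΩ (1, 0)).div
      (h.hasDerivAt_fderiv_left hΩ (0, 1)) hΦ.1.ne', ?_⟩
    have herr := h.damping_error_le hΩ hΦ.2.1 (h.slopeRatio_Φ_abs_le hΩ)
    rw [← abs_neg] at herr
    convert herr using 2
    have h1 := hΦ.1.ne'
    have h2 := hΨ.1.ne'
    simp only [slopeRatio]
    field_simp
    ring

/-- Near a point of the blow-up curve all slope ratios are close to each other. -/
theorem slopeRatio_cauchy (h : BlowUpRegime p μ θ R Ω Φ Ψ T) {x₀ : ℝ} (hx₀ : |x₀| < R) {η : ℝ}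
    (hη : 0 < η) : ∃ c : ℝ, ∃ ρ > 0, |x₀| + ρ < R ∧ ∀ y s, |y - x₀| < ρ → T y - ρ < s → s < T y →
      (y, s) ∈ Ω ∧ |slopeRatio Φ (y, s) - c| ≤ η ∧ |slopeRatio Ψ (y, s) - c| ≤ η := by
  obtain ⟨k, K, E, hk, hkK, hE, hsys⟩ := h.exists_coneSystem
  have hTx := h.T_pos x₀ hx₀
  have hθ := h.theta_lt
  have hθ0 := h.theta_pos
  set S := min (R - |x₀|) (T x₀) / 4 with hS
  have hS0 : 0 < S := by
    have : 0 < min (R - |x₀|) (T x₀) := lt_min (by linarith) hTx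
    positivity
  have hS1 : 4 * S ≤ R - |x₀| := by rw [hS]; linarith [min_le_left (R - |x₀|) (T x₀)]
  have hS2 : 4 * S ≤ T x₀ := by rw [hS]; linarith [min_le_right (R - |x₀|) (T x₀)]
  obtain ⟨ω, hω, hosc⟩ := ConeSystem.exists_osc_rate hS0 hk hkK hE
  obtain ⟨n, hn⟩ := (hω.eventually (gt_mem_nhds (half_pos hη))).exists
  set σ := S / 100 ^ n with hσ
  have hσ0 : 0 < σ := by positivity
  have hσS : σ ≤ S := div_le_self hS0.le (one_le_pow₀ (by norm_num))
  have hx1 : ∀ y, |y - x₀| < S → |y| + S < R ∧ S < T y := by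
    intro y hy
    have h1 := abs_add_le (y - x₀) x₀
    rw [sub_add_cancel] at h1
    have hyR : |y| < R := by linarith
    have h2 := h.lipschitz y x₀ hyR hx₀
    rw [abs_sub_comm] at h2
    have h3 : θ * |y - x₀| ≤ 1 * |y - x₀| := by gcongr
    constructor <;> linarith
  have hcone : ∀ y, |y - x₀| < S → ∃ lo hi, hi - lo ≤ ω n ∧
      ∀ z ∈ puncturedCone y (T y) S, T y - z.2 ≤ σ →
        slopeRatio Ψ z ∈ Icc lo hi ∧ slopeRatio Φ z ∈ Icc lo hi := by
    intro y hy
    obtain ⟨h1, h2⟩ := hx1 y hy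
    refine hosc y (T y) _ _ (hsys y S h1 h2) (fun z hz => ?_) n
    have hzΩ := (h.cone_geometry h1 h2 hz).1
    exact ⟨(h.slopeRatio_Ψ_abs_le hzΩ).trans hθ.le, (h.slopeRatio_Φ_abs_le hzΩ).trans hθ.le⟩
  -- The point `(x₀, T x₀ - σ / 2)` lies, at depth less than `σ`, in the cone of every vertex `(y, T
  -- y)` with `|y - x₀| < σ / 4`, so it links the small oscillations in the different cones. The
  -- rate `ω` does not depend on the vertex, so one `n` serves for all.
  refine ⟨slopeRatio Φ (x₀, T x₀ - σ / 2), σ / 4, by positivity, by linarith, ?_⟩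
  intro y s hy hs1 hs2
  have hyS : |y - x₀| < S := by linarith
  obtain ⟨h1, h2⟩ := hx1 y hyS
  have hyR : |y| < R := by linarith
  obtain ⟨lo, hi, hω', hall⟩ := hcone y hyS
  have h3 := h.lipschitz y x₀ hyR hx₀
  have h4 := h.lipschitz x₀ y hx₀ hyR
  rw [abs_sub_comm] at h3
  have h5 : θ * |y - x₀| ≤ 1 * |y - x₀| := by gcongr
  have hP : (y, s) ∈ puncturedCone y (T y) S := by
    refine ⟨?_, ?_, ?_⟩ <;> simp only [sub_self, abs_zero] <;> linarith
  have hZ : (x₀, T x₀ - σ / 2) ∈ puncturedCone y (T y) S := by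
    refine ⟨?_, ?_, ?_⟩ <;> simp only
    · linarith
    · linarith
    · rw [abs_sub_comm]; linarith
  have hP' := hall _ hP (by simp only; linarith)
  have hZ' := hall _ hZ (by simp only; linarith)
  refine ⟨(h.cone_geometry h1 h2 hP).1, ?_, ?_⟩
  · rw [abs_le]
    constructor <;> linarith [hP'.2.1, hP'.2.2, hZ'.2.1, hZ'.2.2]
  · rw [abs_le]
    constructor <;> linarith [hP'.1.1, hP'.1.2, hZ'.2.1, hZ'.2.2]

/-- The slope ratios have a common limit at every point of the blow-up curve. -/
theorem exists_slopeRatio_limit (h : BlowUpRegime p μ θ R Ω Φ Ψ T) {x₀ : ℝ} (hx₀ : |x₀| < R) :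
    ∃ β : ℝ, |β| ≤ θ ∧ ∀ η > 0, ∃ ρ > 0, |x₀| + ρ < R ∧ ∀ y s, |y - x₀| < ρ → T y - ρ < s →
      s < T y → (y, s) ∈ Ω ∧ |slopeRatio Φ (y, s) - β| ≤ η ∧ |slopeRatio Ψ (y, s) - β| ≤ η := by
  set u : ℕ → ℝ := fun n => slopeRatio Φ (x₀, T x₀ - 1 / ((n : ℝ) + 1)) with hu
  have hev : ∀ ρ > 0, ∀ᶠ n : ℕ in atTop, |x₀ - x₀| < ρ ∧ T x₀ - ρ < T x₀ - 1 / ((n : ℝ) + 1) ∧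
      T x₀ - 1 / ((n : ℝ) + 1) < T x₀ := by
    intro ρ hρ
    filter_upwards [tendsto_one_div_add_atTop_nhds_zero_nat.eventually (gt_mem_nhds hρ)] with n hn
    have : 0 < 1 / ((n : ℝ) + 1) := by positivity
    refine ⟨by simpa using hρ, by linarith, by linarith⟩
  have hC : CauchySeq u := by
    rw [Metric.cauchySeq_iff']
    intro ε hε
    obtain ⟨c, ρ, hρ, -, hc⟩ := h.slopeRatio_cauchy hx₀ (show 0 < ε / 3 by positivity)
    obtain ⟨N, hN⟩ := eventually_atTop.1 (hev ρ hρ)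
    refine ⟨N, fun n hn => ?_⟩
    have h1 := abs_le.1 (hc _ _ (hN n hn).1 (hN n hn).2.1 (hN n hn).2.2).2.1
    have h2 := abs_le.1 (hc _ _ (hN N le_rfl).1 (hN N le_rfl).2.1 (hN N le_rfl).2.2).2.1
    rw [Real.dist_eq, abs_lt]
    constructor <;> simp only [hu] <;> linarith [h1.1, h1.2, h2.1, h2.2]
  obtain ⟨β, hβ⟩ := cauchySeq_tendsto_of_complete hC
  refine ⟨β, ?_, fun η hη => ?_⟩
  · obtain ⟨c, ρ, hρ, -, hc⟩ := h.slopeRatio_cauchy hx₀ one_pos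
    refine le_of_tendsto hβ.abs ?_
    filter_upwards [hev ρ hρ] with n hn
    exact h.slopeRatio_Φ_abs_le (hc _ _ hn.1 hn.2.1 hn.2.2).1
  · obtain ⟨c, ρ, hρ, hρR, hc⟩ := h.slopeRatio_cauchy hx₀ (show 0 < η / 2 by positivity)
    refine ⟨ρ, hρ, hρR, fun y s h1 h2 h3 => ?_⟩
    have hβc : |β - c| ≤ η / 2 := by
      refine le_of_tendsto (hβ.sub_const c).abs ?_
      filter_upwards [hev ρ hρ] with n hn
      exact (hc _ _ hn.1 hn.2.1 hn.2.2).2.1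
    obtain ⟨h4, h5, h6⟩ := hc y s h1 h2 h3
    rw [abs_le] at hβc h5 h6
    refine ⟨h4, ?_, ?_⟩ <;> rw [abs_le] <;> constructor <;>
      linarith [hβc.1, hβc.2, h5.1, h5.2, h6.1, h6.2]

end BlowUpRegime

/-! ### Limits at the curve and the first-order expansion -/

/-- The filter of approach to the point of the curve `T` over `x₀` from below the curve. -/
def curveFilter (T : ℝ → ℝ) (x₀ : ℝ) : Filter (ℝ × ℝ) :=
  comap (fun z => (z.1, T z.1 - z.2)) (𝓝 x₀ ×ˢ 𝓝[>] 0)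

theorem eventually_curveFilter {T : ℝ → ℝ} {x₀ : ℝ} {P : ℝ × ℝ → Prop} :
    (∀ᶠ z in curveFilter T x₀, P z) ↔
      ∃ ρ > 0, ∀ y s, |y - x₀| < ρ → T y - ρ < s → s < T y → P (y, s) := by
  have hb := (Metric.nhds_basis_ball (x := x₀)).prod_same_index (nhdsGT_basis (0 : ℝ))
    (fun {i j} hi hj => ⟨min i j, lt_min hi hj, Metric.ball_subset_ball (min_le_left _ _),
      Ioo_subset_Ioo_right (min_le_right _ _)⟩)
  have hb' := hb.comap (fun z : ℝ × ℝ => (z.1, T z.1 - z.2))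
  rw [curveFilter, hb'.eventually_iff]
  constructor
  · rintro ⟨ρ, hρ, h⟩
    refine ⟨ρ, hρ, fun y s h1 h2 h3 => h ⟨?_, ?_, ?_⟩⟩
    · simpa [Real.dist_eq] using h1
    · simp only; linarith
    · simp only; linarith
  · rintro ⟨ρ, hρ, h⟩
    refine ⟨ρ, hρ, fun z hz => ?_⟩
    obtain ⟨h1, h2, h3⟩ := hz
    simp only [Metric.mem_ball, Real.dist_eq] at h1 h2 h3
    exact h z.1 z.2 h1 (by linarith) (by linarith)

namespace BlowUpRegime

variable {p μ θ R : ℝ} {Ω : Set (ℝ × ℝ)} {Φ Ψ : ℝ × ℝ → ℝ} {T : ℝ → ℝ}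

theorem eventually_mem (h : BlowUpRegime p μ θ R Ω Φ Ψ T) {x₀ : ℝ} (hx₀ : |x₀| < R) :
    ∀ᶠ z in curveFilter T x₀, z ∈ Ω ∧ |z.1| < R ∧ z.2 < T z.1 := by
  obtain ⟨c, ρ, hρ, hρR, hc⟩ := h.slopeRatio_cauchy hx₀ one_pos
  refine eventually_curveFilter.2 ⟨ρ, hρ, fun y s h1 h2 h3 => ⟨(hc y s h1 h2 h3).1, ?_, h3⟩⟩
  have := abs_add_le (y - x₀) x₀
  rw [sub_add_cancel] at this
  simp only
  linarith

theorem tendsto_invPower (h : BlowUpRegime p μ θ R Ω Φ Ψ T) {x₀ : ℝ} (hx₀ : |x₀| < R) :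
    Tendsto (invPower p Φ Ψ) (curveFilter T x₀) (𝓝 0) := by
  have h1 : Tendsto (fun z : ℝ × ℝ => T z.1 - z.2) (curveFilter T x₀) (𝓝 0) :=
    ((tendsto_snd.comp (tendsto_comap (f := fun z : ℝ × ℝ => (z.1, T z.1 - z.2)))).mono_right
      nhdsWithin_le_nhds)
  have h2 := h1.const_mul (2 * (p - 1) * (2 : ℝ) ^ (-p) / (1 - θ))
  rw [mul_zero] at h2
  refine tendsto_of_tendsto_of_tendsto_of_le_of_le' tendsto_const_nhds h2 ?_ ?_
  · filter_upwards [h.eventually_mem hx₀] with z hz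
    exact (h.invPower_pos hz.1).le
  · filter_upwards [h.eventually_mem hx₀] with z hz
    exact (h.invPower_bounds hz.2.1 (h.time_pos z hz.1) hz.2.2).2

/-- After division by the `p`-th power, the damping contributes at most `μ / 2 * invPower`, which
vanishes at the curve; so the damping leaves no trace in the profile. -/
theorem tendsto_rpow_mul_source (h : BlowUpRegime p μ θ R Ω Φ Ψ T) {x₀ : ℝ} (hx₀ : |x₀| < R) :
    Tendsto (fun z => (Φ z + Ψ z) ^ (-p) * source p μ z.2 (Φ z + Ψ z)) (curveFilter T x₀)
      (𝓝 ((2 : ℝ) ^ (-p))) := by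
  have h1 := ((h.tendsto_invPower hx₀).const_mul (μ / 2)).const_sub ((2 : ℝ) ^ (-p))
  rw [mul_zero, sub_zero] at h1
  refine tendsto_of_tendsto_of_tendsto_of_le_of_le' h1 tendsto_const_nhds ?_ ?_
  · filter_upwards [h.eventually_mem hx₀] with z hz
    have hw := h.one_lt hz.1
    have hw0 : 0 < Φ z + Ψ z := by linarith
    have h2 : (Φ z + Ψ z) ^ (-p) * (Φ z + Ψ z) ^ p = 1 := by
      rw [← Real.rpow_add hw0]; simp
    have h3 : (Φ z + Ψ z) ^ (-p) * (Φ z + Ψ z) = invPower p Φ Ψ z := by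
      rw [invPower, ← Real.rpow_add_one hw0.ne']; congr 1; ring
    have h4 := damping_le h.mu_pos (h.time_pos z hz.1).le
    have h5 := h.invPower_pos hz.1
    have h6 : μ / (1 + z.2) / 2 * invPower p Φ Ψ z ≤ μ / 2 * invPower p Φ Ψ z := by
      gcongr; exact h4.2
    calc _ ≤ (2 : ℝ) ^ (-p) - μ / (1 + z.2) / 2 * invPower p Φ Ψ z := by linarith
      _ = _ := by
        rw [← h3, source]
        linear_combination (-(2 : ℝ) ^ (-p)) * h2
  · filter_upwards [h.eventually_mem hx₀] with z hz
    exact (h.source_mul_rpow_bounds hz.1).2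

theorem time_Φ_eq (h : BlowUpRegime p μ θ R Ω Φ Ψ T) {z : ℝ × ℝ} (hz : z ∈ Ω) :
    fderiv ℝ Φ z (0, 1) = source p μ z.2 (Φ z + Ψ z) * (1 / (1 - slopeRatio Φ z)) ∧
      fderiv ℝ Φ z (1, 0) =
        source p μ z.2 (Φ z + Ψ z) * (slopeRatio Φ z / (1 - slopeRatio Φ z)) := by
  have h1 := h.time_sub_space_Φ hz
  have h2 := (h.time_Φ_bounds hz).1
  have h3 := h.slopeRatio_Φ_abs_le hz
  have h4 : 0 < 1 - slopeRatio Φ z := by linarith [(abs_le.1 h3).2, h.theta_lt]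
  have h5 : fderiv ℝ Φ z (1, 0) = slopeRatio Φ z * fderiv ℝ Φ z (0, 1) := by
    rw [slopeRatio]; field_simp
  rw [h5] at h1 ⊢
  have h6 : fderiv ℝ Φ z (0, 1) = source p μ z.2 (Φ z + Ψ z) * (1 / (1 - slopeRatio Φ z)) := by
    rw [← h1]; field_simp
  refine ⟨h6, ?_⟩
  rw [h6]; ring

theorem time_Ψ_eq (h : BlowUpRegime p μ θ R Ω Φ Ψ T) {z : ℝ × ℝ} (hz : z ∈ Ω) :
    fderiv ℝ Ψ z (0, 1) = source p μ z.2 (Φ z + Ψ z) * (1 / (1 + slopeRatio Ψ z)) ∧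
      fderiv ℝ Ψ z (1, 0) =
        source p μ z.2 (Φ z + Ψ z) * (slopeRatio Ψ z / (1 + slopeRatio Ψ z)) := by
  have h1 := h.time_add_space_Ψ hz
  have h2 := (h.time_Ψ_bounds hz).1
  have h3 := h.slopeRatio_Ψ_abs_le hz
  have h4 : 0 < 1 + slopeRatio Ψ z := by linarith [(abs_le.1 h3).1, h.theta_lt]
  have h5 : fderiv ℝ Ψ z (1, 0) = slopeRatio Ψ z * fderiv ℝ Ψ z (0, 1) := by
    rw [slopeRatio]; field_simp
  rw [h5] at h1 ⊢
  have h6 : fderiv ℝ Ψ z (0, 1) = source p μ z.2 (Φ z + Ψ z) * (1 / (1 + slopeRatio Ψ z)) := by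
    rw [← h1]; field_simp
  refine ⟨h6, ?_⟩
  rw [h6]; ring

end BlowUpRegime

/-- The rate at which `invPower` vanishes at a point of the curve with slope `-β`. -/
noncomputable def vanishingRate (p β : ℝ) : ℝ := (p - 1) * 2 ^ (-p) * (1 / (1 - β) + 1 / (1 + β))

namespace BlowUpRegime

variable {p μ θ R : ℝ} {Ω : Set (ℝ × ℝ)} {Φ Ψ : ℝ × ℝ → ℝ} {T : ℝ → ℝ}

theorem exists_tendsto_slopeRatio (h : BlowUpRegime p μ θ R Ω Φ Ψ T) {x₀ : ℝ} (hx₀ : |x₀| < R) :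
    ∃ β : ℝ, |β| < 1 ∧ Tendsto (slopeRatio Φ) (curveFilter T x₀) (𝓝 β) ∧
      Tendsto (slopeRatio Ψ) (curveFilter T x₀) (𝓝 β) := by
  obtain ⟨β, hβ, hlim⟩ := h.exists_slopeRatio_limit hx₀
  refine ⟨β, hβ.trans_lt h.theta_lt, ?_, ?_⟩ <;> rw [Metric.tendsto_nhds] <;> intro ε hε <;>
    obtain ⟨ρ, hρ, -, hc⟩ := hlim (ε / 2) (by positivity) <;>
    refine eventually_curveFilter.2 ⟨ρ, hρ, fun y s h1 h2 h3 => ?_⟩ <;> rw [Real.dist_eq]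
  · linarith [(hc y s h1 h2 h3).2.1]
  · linarith [(hc y s h1 h2 h3).2.2]

/-- The equations and the slope ratios determine all first derivatives as the source times rational
functions of the ratios; every factor then has a limit. -/
theorem tendsto_fderiv_invPower (h : BlowUpRegime p μ θ R Ω Φ Ψ T) {x₀ β : ℝ} (hx₀ : |x₀| < R)
    (hβ : |β| < 1) (hΦ : Tendsto (slopeRatio Φ) (curveFilter T x₀) (𝓝 β))
    (hΨ : Tendsto (slopeRatio Ψ) (curveFilter T x₀) (𝓝 β)) :
    Tendsto (fun z => fderiv ℝ (invPower p Φ Ψ) z (0, 1)) (curveFilter T x₀)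
      (𝓝 (-vanishingRate p β)) ∧
    Tendsto (fun z => fderiv ℝ (invPower p Φ Ψ) z (1, 0)) (curveFilter T x₀)
      (𝓝 (-(vanishingRate p β * β))) := by
  have hβ' := abs_lt.1 hβ
  have hn1 : 1 - β ≠ 0 := by linarith
  have hn2 : 1 + β ≠ 0 := by linarith
  have hs := h.tendsto_rpow_mul_source hx₀
  have hr1 := (hΦ.const_sub 1)
  have hr2 := (hΨ.const_add 1)
  constructor
  · have key := (hs.const_mul (1 - p)).mul ((tendsto_const_nhds.div hr1 hn1).add
      (tendsto_const_nhds (x := (1 : ℝ)) |>.div hr2 hn2) : Tendsto _ _ (𝓝 (1 / (1 - β) + 1 / (1 + β))))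
    rw [show (1 - p) * 2 ^ (-p) * (1 / (1 - β) + 1 / (1 + β)) = -vanishingRate p β by
      rw [vanishingRate]; ring] at key
    refine key.congr' ?_
    filter_upwards [h.eventually_mem hx₀] with z hz
    rw [(h.hasFDerivAt_invPower hz.1).fderiv]
    simp only [smul_apply, add_apply, smul_eq_mul, Pi.div_apply]
    rw [(h.time_Φ_eq hz.1).1, (h.time_Ψ_eq hz.1).1]
    ring
  · have key := (hs.const_mul (1 - p)).mul ((hΦ.div hr1 hn1).add (hΨ.div hr2 hn2))
    rw [show (1 - p) * 2 ^ (-p) * (β / (1 - β) + β / (1 + β)) = -(vanishingRate p β * β) by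
      rw [vanishingRate]; ring] at key
    refine key.congr' ?_
    filter_upwards [h.eventually_mem hx₀] with z hz
    rw [(h.hasFDerivAt_invPower hz.1).fderiv]
    simp only [smul_apply, add_apply, smul_eq_mul, Pi.div_apply]
    rw [(h.time_Φ_eq hz.1).2, (h.time_Ψ_eq hz.1).2]
    ring

/-- The fraction of `∂ₜ (Φ + Ψ)` that is due to `Φ`. -/
theorem tendsto_time_fraction (h : BlowUpRegime p μ θ R Ω Φ Ψ T) {x₀ β : ℝ} (hx₀ : |x₀| < R)
    (hΦ : Tendsto (slopeRatio Φ) (curveFilter T x₀) (𝓝 β))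
    (hΨ : Tendsto (slopeRatio Ψ) (curveFilter T x₀) (𝓝 β)) :
    Tendsto (fun z => fderiv ℝ Φ z (0, 1) / (fderiv ℝ Φ z (0, 1) + fderiv ℝ Ψ z (0, 1)))
      (curveFilter T x₀) (𝓝 ((1 + β) / 2)) := by
  -- With slope ratios `r` of `Φ` and `r'` of `Ψ`, the fraction equals `(1 + r') / (2 + r' - r)`.
  have key := (hΨ.const_add 1).div ((hΨ.const_add 2).sub hΦ) (by simp)
  rw [show (2 + β - β) = 2 by ring] at key
  refine key.congr' ?_
  filter_upwards [h.eventually_mem hx₀] with z hz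
  have h1 := h.source_pos hz.1
  have h3 : 0 < 1 - slopeRatio Φ z := by
    linarith [(abs_le.1 (h.slopeRatio_Φ_abs_le hz.1)).2, h.theta_lt]
  have h4 : 0 < 1 + slopeRatio Ψ z := by
    linarith [(abs_le.1 (h.slopeRatio_Ψ_abs_le hz.1)).1, h.theta_lt]
  have h5 : 0 < 2 + slopeRatio Ψ z - slopeRatio Φ z := by linarith
  have h6 : 0 < fderiv ℝ Φ z (0, 1) + fderiv ℝ Ψ z (0, 1) :=
    add_pos (h.time_Φ_bounds hz.1).1 (h.time_Ψ_bounds hz.1).1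
  simp only [Pi.div_apply]
  rw [div_eq_div_iff h5.ne' h6.ne', (h.time_Φ_eq hz.1).1, (h.time_Ψ_eq hz.1).1]
  field_simp
  ring

theorem vanishingRate_pos (hp : 1 < p) {β : ℝ} (hβ : |β| < 1) : 0 < vanishingRate p β := by
  have hβ' := abs_lt.1 hβ
  have h1 : 0 < 1 - β := by linarith
  have h2 : 0 < 1 + β := by linarith
  have h3 : 0 < p - 1 := by linarith
  rw [vanishingRate]; positivity

/-- The first order expansion of `invPower` at a point of the blow-up curve. -/
theorem invPower_expansion (h : BlowUpRegime p μ θ R Ω Φ Ψ T) {x₀ β : ℝ} (hx₀ : |x₀| < R)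
    (hβ : |β| < 1) (hΦ : Tendsto (slopeRatio Φ) (curveFilter T x₀) (𝓝 β))
    (hΨ : Tendsto (slopeRatio Ψ) (curveFilter T x₀) (𝓝 β)) {η : ℝ} (hη : 0 < η) :
    ∀ᶠ z in curveFilter T x₀,
      |invPower p Φ Ψ z - vanishingRate p β * (-β * (z.1 - x₀) - (z.2 - T x₀))| ≤
        η * (|z.1 - x₀| + |z.2 - T x₀|) := by
  obtain ⟨ht, hx⟩ := h.tendsto_fderiv_invPower hx₀ hβ hΦ hΨ
  have hη5 : 0 < η / 5 := by positivity
  have hev := ((Metric.tendsto_nhds.1 ht (η / 5) hη5).and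
    (Metric.tendsto_nhds.1 hx (η / 5) hη5)).and (h.eventually_mem hx₀)
  obtain ⟨ρ, hρ, hall⟩ := eventually_curveFilter.1 hev
  simp only [Real.dist_eq, sub_neg_eq_add] at hall
  refine eventually_curveFilter.2 ⟨ρ / 5, by positivity, fun y s h1 h2 h3 => ?_⟩
  simp only
  set c := vanishingRate p β with hc
  set d := |y - x₀| with hd
  have hd0 : 0 ≤ d := abs_nonneg _
  have hR : ∀ y', |y' - x₀| < ρ → |y'| < R := fun y' hy' =>
    (hall y' (T y' - ρ / 2) hy' (by linarith) (by linarith)).2.2.1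
  have hT : ∀ y', |y' - x₀| < ρ → |T y' - T x₀| ≤ |y' - x₀| := by
    intro y' hy'
    have h4 := h.lipschitz y' x₀ (hR y' hy') hx₀
    have h5 := h.lipschitz x₀ y' hx₀ (hR y' hy')
    rw [abs_sub_comm] at h4
    have h6 : θ * |y' - x₀| ≤ 1 * |y' - x₀| := by
      have := h.theta_lt; gcongr
    rw [abs_le]
    constructor <;> linarith
  have hTy := abs_le.1 (hT y (by linarith))
  set F : ℝ × ℝ → ℝ := fun z => invPower p Φ Ψ z - c * (-β * (z.1 - x₀) - (z.2 - T x₀)) with hF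
  have hlint : ∀ y' s', HasDerivAt (fun s' : ℝ => c * (-β * (y' - x₀) - (s' - T x₀))) (-c) s' := by
    intro y' s'
    have := (((hasDerivAt_id s').sub_const (T x₀)).const_sub (-β * (y' - x₀))).const_mul c
    simpa using this
  have hlinx : ∀ y' s', HasDerivAt (fun y' : ℝ => c * (-β * (y' - x₀) - (s' - T x₀)))
      (-(c * β)) y' := by
    intro y' s'
    have := ((((hasDerivAt_id y').sub_const x₀).const_mul (-β)).sub_const (s' - T x₀)).const_mul c
    simpa using this
  have hFt : ∀ y' s', |y' - x₀| < ρ → T y' - ρ < s' → s' < T y' →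
      HasDerivAt (fun s' => F (y', s')) (fderiv ℝ (invPower p Φ Ψ) (y', s') (0, 1) + c) s' ∧
      ‖fderiv ℝ (invPower p Φ Ψ) (y', s') (0, 1) + c‖ ≤ η / 5 := by
    intro y' s' k1 k2 k3
    obtain ⟨⟨k4, k5⟩, k6, k7⟩ := hall y' s' k1 k2 k3
    refine ⟨?_, k4.le⟩
    have hl : HasDerivAt (fun t' : ℝ => ((y', t') : ℝ × ℝ)) (0, 1) s' :=
      (hasDerivAt_const s' y').prodMk (hasDerivAt_id s')
    have := (((h.hasFDerivAt_invPower k6).differentiableAt.hasFDerivAt.comp_hasDerivAt s' hl).sub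
      (hlint y' s'))
    rw [sub_neg_eq_add] at this
    exact this
  have hFx : ∀ y' s', |y' - x₀| < ρ → T y' - ρ < s' → s' < T y' →
      HasDerivAt (fun y' => F (y', s')) (fderiv ℝ (invPower p Φ Ψ) (y', s') (1, 0) + c * β) y' ∧
      ‖fderiv ℝ (invPower p Φ Ψ) (y', s') (1, 0) + c * β‖ ≤ η / 5 := by
    intro y' s' k1 k2 k3
    obtain ⟨⟨k4, k5⟩, k6, k7⟩ := hall y' s' k1 k2 k3
    refine ⟨?_, k5.le⟩
    have hl : HasDerivAt (fun t' : ℝ => ((t', s') : ℝ × ℝ)) (1, 0) y' :=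
      (hasDerivAt_id y').prodMk (hasDerivAt_const y' s')
    have := (((h.hasFDerivAt_invPower k6).differentiableAt.hasFDerivAt.comp_hasDerivAt y' hl).sub
      (hlinx y' s'))
    rw [sub_neg_eq_add] at this
    exact this
  have hvert : ∀ y' s₁ s₂, |y' - x₀| < ρ → T y' - ρ < s₁ → s₁ ≤ s₂ → s₂ < T y' →
      |F (y', s₂) - F (y', s₁)| ≤ η / 5 * (s₂ - s₁) := by
    intro y' s₁ s₂ k1 k2 k3 k4
    have := (convex_Icc s₁ s₂).norm_image_sub_le_of_norm_hasDerivWithin_le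
      (fun σ hσ => (hFt y' σ k1 (by linarith [hσ.1]) (by linarith [hσ.2])).1.hasDerivWithinAt)
      (fun σ hσ => (hFt y' σ k1 (by linarith [hσ.1]) (by linarith [hσ.2])).2)
      (left_mem_Icc.2 k3) (right_mem_Icc.2 k3)
    rwa [Real.norm_eq_abs, Real.norm_eq_abs, abs_of_nonneg (sub_nonneg.2 k3)] at this
  -- The path goes down from `(y, s)` by `2 d`, so that the horizontal segment to `x₀` stays below
  -- the 1-Lipschitz curve, and then up over `x₀` to the curve, where `F` tends to 0. Its length is
  -- at most `5 d + |s - T x₀|`, hence `η / 5`; likewise `ρ / 5` keeps the path where the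
  -- derivatives are controlled.
  set s₁ := s - 2 * d with hs₁
  have hseg : ∀ y' ∈ uIcc x₀ y, |y' - x₀| < ρ ∧ T y' - ρ < s₁ ∧ s₁ < T y' := by
    intro y' hy'
    have k1 : |y' - x₀| ≤ d := abs_sub_left_of_mem_uIcc hy'
    have k2 := abs_le.1 (hT y' (by linarith))
    refine ⟨by linarith, by linarith [hTy.1], ?_⟩
    rcases hd0.eq_or_lt with k3 | k3
    · have k4 : y' = x₀ := by
        have : |y' - x₀| ≤ 0 := by linarith
        linarith [abs_nonpos_iff.1 this]
      have k5 : y = x₀ := by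
        have : |y - x₀| ≤ 0 := by linarith
        linarith [abs_nonpos_iff.1 this]
      rw [k4, ← k5]; linarith
    · linarith [hTy.2]
  have e1 : |F (y, s) - F (y, s₁)| ≤ η / 5 * (2 * d) := by
    have := hvert y s₁ s (by linarith) (hseg y right_mem_uIcc).2.1 (by linarith) h3
    rwa [show s - s₁ = 2 * d by rw [hs₁]; ring] at this
  have e2 : |F (y, s₁) - F (x₀, s₁)| ≤ η / 5 * d := by
    have := (convex_uIcc x₀ y).norm_image_sub_le_of_norm_hasDerivWithin_le
      (fun σ hσ => (hFx σ s₁ (hseg σ hσ).1 (hseg σ hσ).2.1 (hseg σ hσ).2.2).1.hasDerivWithinAt)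
      (fun σ hσ => (hFx σ s₁ (hseg σ hσ).1 (hseg σ hσ).2.1 (hseg σ hσ).2.2).2)
      left_mem_uIcc right_mem_uIcc
    rwa [Real.norm_eq_abs, Real.norm_eq_abs] at this
  have hx0seg := hseg x₀ left_mem_uIcc
  have e3 : |F (x₀, s₁)| ≤ η / 5 * (T x₀ - s₁) := by
    refine le_of_forall_pos_le_add fun δ hδ => ?_
    obtain ⟨t₀, ht₀, hlt⟩ := h.exists_invPower_lt hx₀ (half_pos hδ)
    have hcpos : 0 < c := vanishingRate_pos h.one_lt_p hβ
    obtain ⟨t, ht1, ht2⟩ := exists_between (max_lt (max_lt ht₀.2 hx0seg.2.2)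
      (show T x₀ - δ / 2 / c < T x₀ by have := div_pos (half_pos hδ) hcpos; linarith))
    have ht3 : t₀ ≤ t := ((le_max_left _ _).trans (le_max_left _ _)).trans ht1.le
    have ht4 : s₁ ≤ t := ((le_max_right _ _).trans (le_max_left _ _)).trans ht1.le
    have ht5 : T x₀ - δ / 2 / c ≤ t := (le_max_right _ _).trans ht1.le
    have k1 := hvert x₀ s₁ t hx0seg.1 hx0seg.2.1 ht4 ht2
    have k2 := hlt t ⟨ht3, ht2⟩
    have k3 := h.invPower_pos (h.mem x₀ t hx₀ (ht₀.1.trans_le ht3) ht2)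
    have k4 : c * (T x₀ - t) ≤ δ / 2 := by
      calc c * (T x₀ - t) ≤ c * (δ / 2 / c) := by gcongr; linarith
        _ = δ / 2 := by field_simp
    have k5 : 0 ≤ c * (T x₀ - t) := mul_nonneg hcpos.le (by linarith)
    have k6 : F (x₀, t) = invPower p Φ Ψ (x₀, t) - c * (T x₀ - t) := by
      simp only [hF]; ring
    have k7 : η / 5 * (t - s₁) ≤ η / 5 * (T x₀ - s₁) := by gcongr
    rw [abs_le] at k1 ⊢
    constructor <;> linarith [k1.1, k1.2]
  have e4 : η / 5 * (T x₀ - s₁) ≤ η / 5 * (2 * d + |s - T x₀|) := by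
    have : T x₀ - s ≤ |s - T x₀| := by rw [abs_sub_comm]; exact le_abs_self _
    have : T x₀ - s₁ ≤ 2 * d + |s - T x₀| := by linarith
    gcongr
  have e5 : η / 5 * (2 * d) + η / 5 * d + η / 5 * (2 * d + |s - T x₀|) ≤ η * (d + |s - T x₀|) := by
    have := mul_nonneg hη.le (abs_nonneg (s - T x₀))
    linarith
  change |F (y, s)| ≤ _
  rw [abs_le] at e1 e2 e3 ⊢
  constructor <;> linarith [e1.1, e1.2, e2.1, e2.2, e3.1, e3.2]

end BlowUpRegime

/-! ### Differentiability of the curve and convergence of the rescalings -/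

namespace BlowUpRegime

variable {p μ θ R : ℝ} {Ω : Set (ℝ × ℝ)} {Φ Ψ : ℝ × ℝ → ℝ} {T : ℝ → ℝ}

/-- The blow-up curve is differentiable. -/
theorem hasDerivAt_curve (h : BlowUpRegime p μ θ R Ω Φ Ψ T) {x₀ β : ℝ} (hx₀ : |x₀| < R)
    (hβ : |β| < 1) (hΦ : Tendsto (slopeRatio Φ) (curveFilter T x₀) (𝓝 β))
    (hΨ : Tendsto (slopeRatio Ψ) (curveFilter T x₀) (𝓝 β)) : HasDerivAt T (-β) x₀ := by
  rw [hasDerivAt_iff_isLittleO, Asymptotics.isLittleO_iff]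
  intro ε hε
  have hc : 0 < vanishingRate p β := vanishingRate_pos h.one_lt_p hβ
  set c := vanishingRate p β with hcdef
  have hexp := (h.invPower_expansion hx₀ hβ hΦ hΨ (show 0 < c * ε / 2 by positivity)).and
    (h.eventually_mem hx₀)
  obtain ⟨ρ, hρ, hall⟩ := eventually_curveFilter.1 hexp
  have hball : ∀ᶠ y in 𝓝 x₀, |y - x₀| < ρ := by
    filter_upwards [Metric.ball_mem_nhds x₀ hρ] with y hy
    rwa [Metric.mem_ball, Real.dist_eq] at hy
  filter_upwards [hball] with y hy
  have hyR : |y| < R := (hall y (T y - ρ / 2) hy (by linarith) (by linarith)).2.2.1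
  have hlip : |T y - T x₀| ≤ |y - x₀| := by
    have h4 := h.lipschitz y x₀ hyR hx₀
    have h5 := h.lipschitz x₀ y hx₀ hyR
    rw [abs_sub_comm] at h4
    have h6 : θ * |y - x₀| ≤ 1 * |y - x₀| := by
      have := h.theta_lt; gcongr
    rw [abs_le]
    constructor <;> linarith
  have hlim : Tendsto (fun s => invPower p Φ Ψ (y, s)) (𝓝[<] (T y)) (𝓝 0) := by
    rw [Metric.tendsto_nhds]
    intro δ hδ
    obtain ⟨t₀, ht₀, hlt⟩ := h.exists_invPower_lt hyR hδ
    filter_upwards [Ioo_mem_nhdsLT ht₀.2] with s hs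
    rw [Real.dist_eq, sub_zero, abs_of_pos (h.invPower_pos
      (h.mem y s hyR (ht₀.1.trans hs.1) hs.2))]
    exact hlt s ⟨hs.1.le, hs.2⟩
  have hid : Tendsto (fun s : ℝ => s) (𝓝[<] (T y)) (𝓝 (T y)) := nhdsWithin_le_nhds
  -- The expansion is taken up to the curve over `y`: `invPower` disappears, and what is left is the
  -- linearization error of `T`.
  have key := le_of_tendsto_of_tendsto
    (hlim.sub (((hid.sub_const (T x₀)).const_sub (-β * (y - x₀))).const_mul c)).abs
    (((hid.sub_const (T x₀)).abs.const_add |y - x₀|).const_mul (c * ε / 2)) (by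
      filter_upwards [Ioo_mem_nhdsLT (show T y - ρ < T y by linarith)] with s hs
      exact (hall y s hy hs.1 hs.2).1)
  rw [zero_sub, abs_neg, abs_mul, abs_of_pos hc] at key
  have key2 : c * |-β * (y - x₀) - (T y - T x₀)| ≤ c * (ε * |y - x₀|) := by
    have : c * ε / 2 * (|y - x₀| + |T y - T x₀|) ≤ c * ε / 2 * (|y - x₀| + |y - x₀|) := by gcongr
    linarith
  have key3 := le_of_mul_le_mul_left key2 hc
  rw [Real.norm_eq_abs, Real.norm_eq_abs, smul_eq_mul, show T y - T x₀ - (y - x₀) * -β =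
    -(-β * (y - x₀) - (T y - T x₀)) by ring, abs_neg]
  exact key3

theorem add_eq_invPower_rpow (h : BlowUpRegime p μ θ R Ω Φ Ψ T) {z : ℝ × ℝ} (hz : z ∈ Ω) :
    Φ z + Ψ z = invPower p Φ Ψ z ^ (-blowUpExponent p) := by
  have hw := h.one_lt hz
  have hp := h.one_lt_p
  rw [invPower, ← Real.rpow_mul (by linarith), blowUpExponent,
    show (1 - p) * -(1 / (p - 1)) = 1 by
      have : p - 1 ≠ 0 := by linarith
      field_simp; ring, Real.rpow_one]

/-- Up to an arbitrarily small fraction and a bounded term, `Φ` is `(1 + β) / 2` of `Φ + Ψ`. -/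
theorem fraction_bound (h : BlowUpRegime p μ θ R Ω Φ Ψ T) {x₀ β : ℝ} (hx₀ : |x₀| < R)
    (hβ : |β| < 1) (hΦ : Tendsto (slopeRatio Φ) (curveFilter T x₀) (𝓝 β))
    (hΨ : Tendsto (slopeRatio Ψ) (curveFilter T x₀) (𝓝 β)) {η : ℝ} (hη : 0 < η) :
    ∃ C, ∀ᶠ z in curveFilter T x₀,
      |Φ z - (1 + β) / 2 * (Φ z + Ψ z)| ≤ η * (Φ z + Ψ z) + C := by
  have hβ' := abs_lt.1 hβ
  have hp1 : 0 < p - 1 := by linarith [h.one_lt_p]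
  have hev := (Metric.tendsto_nhds.1 (h.tendsto_time_fraction hx₀ hΦ hΨ) η hη).and
    (h.eventually_mem hx₀)
  obtain ⟨ρ, hρ, hall⟩ := eventually_curveFilter.1 hev
  refine ⟨((p - 1) * 2 ^ (-p) / 2 * (ρ / 2)) ^ (-blowUpExponent p),
    eventually_curveFilter.2 ⟨ρ / 2, by positivity, fun y s h1 h2 h3 => ?_⟩⟩
  set s₁ := T y - ρ / 2 with hs₁
  have hm : ∀ τ, s₁ ≤ τ → τ < T y → (y, τ) ∈ Ω ∧ |y| < R ∧
      |fderiv ℝ Φ (y, τ) (0, 1) - (1 + β) / 2 *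
        (fderiv ℝ Φ (y, τ) (0, 1) + fderiv ℝ Ψ (y, τ) (0, 1))| ≤
      η * (fderiv ℝ Φ (y, τ) (0, 1) + fderiv ℝ Ψ (y, τ) (0, 1)) := by
    intro τ k1 k2
    obtain ⟨k3, k4, k5, -⟩ := hall y τ (by linarith) (by linarith) k2
    refine ⟨k4, k5, ?_⟩
    have k6 : 0 < fderiv ℝ Φ (y, τ) (0, 1) + fderiv ℝ Ψ (y, τ) (0, 1) :=
      add_pos (h.time_Φ_bounds k4).1 (h.time_Ψ_bounds k4).1
    rw [Real.dist_eq] at k3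
    calc _ = |fderiv ℝ Φ (y, τ) (0, 1) / (fderiv ℝ Φ (y, τ) (0, 1) + fderiv ℝ Ψ (y, τ) (0, 1)) -
          (1 + β) / 2| * (fderiv ℝ Φ (y, τ) (0, 1) + fderiv ℝ Ψ (y, τ) (0, 1)) := by
          conv_rhs => rw [← abs_of_pos k6, ← abs_mul, abs_of_pos k6]
          congr 1
          field_simp
      _ ≤ _ := by gcongr
  have hdΦ : ∀ τ ∈ Icc s₁ s, HasDerivAt (fun τ => Φ (y, τ)) (fderiv ℝ Φ (y, τ) (0, 1)) τ :=
    fun τ hτ => (h.differentiableAt_Φ (hm τ hτ.1 (hτ.2.trans_lt h3)).1).hasFDerivAt.comp_hasDerivAt τ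
      ((hasDerivAt_const τ y).prodMk (hasDerivAt_id τ))
  have hdΨ : ∀ τ ∈ Icc s₁ s, HasDerivAt (fun τ => Ψ (y, τ)) (fderiv ℝ Ψ (y, τ) (0, 1)) τ :=
    fun τ hτ => (h.differentiableAt_Ψ (hm τ hτ.1 (hτ.2.trans_lt h3)).1).hasFDerivAt.comp_hasDerivAt τ
      ((hasDerivAt_const τ y).prodMk (hasDerivAt_id τ))
  -- With `r = -η` this function of time is nonincreasing and with `r = η` nondecreasing, so only
  -- its value at depth `ρ / 2` enters; there `C` bounds `Φ + Ψ` uniformly in `y`.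
  have hd1 : ∀ r : ℝ, ∀ τ ∈ Icc s₁ s,
      HasDerivAt (fun τ => Φ (y, τ) - (1 + β) / 2 * (Φ (y, τ) + Ψ (y, τ)) +
        r * (Φ (y, τ) + Ψ (y, τ))) (fderiv ℝ Φ (y, τ) (0, 1) - (1 + β) / 2 *
        (fderiv ℝ Φ (y, τ) (0, 1) + fderiv ℝ Ψ (y, τ) (0, 1)) +
        r * (fderiv ℝ Φ (y, τ) (0, 1) + fderiv ℝ Ψ (y, τ) (0, 1))) τ := fun r τ hτ =>
    ((hdΦ τ hτ).sub (((hdΦ τ hτ).add (hdΨ τ hτ)).const_mul _)).add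
      (((hdΦ τ hτ).add (hdΨ τ hτ)).const_mul r)
  have hs : s₁ ≤ s := by linarith
  have hup := sub_le_mul_of_hasDerivAt (C := 0) hs
    (fun τ hτ => (hd1 (-η) τ hτ).continuousAt.continuousWithinAt)
    (fun τ hτ => hd1 (-η) τ (Ioo_subset_Icc_self hτ)) (fun τ hτ => by
      have := abs_le.1 (hm τ hτ.1.le (hτ.2.trans h3)).2.2
      linarith [this.2])
  have hlow := mul_sub_le_of_hasDerivAt (C := 0) hs
    (fun τ hτ => (hd1 η τ hτ).continuousAt.continuousWithinAt)
    (fun τ hτ => hd1 η τ (Ioo_subset_Icc_self hτ)) (fun τ hτ => by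
      have := abs_le.1 (hm τ hτ.1.le (hτ.2.trans h3)).2.2
      linarith [this.1])
  obtain ⟨m1, m2, -⟩ := hm s₁ le_rfl (by linarith)
  have hpos := h.pos _ m1
  have hC : Φ (y, s₁) + Ψ (y, s₁) ≤ ((p - 1) * 2 ^ (-p) / 2 * (ρ / 2)) ^ (-blowUpExponent p) := by
    rw [h.add_eq_invPower_rpow m1]
    have k1 := (h.invPower_bounds m2 (h.time_pos _ m1) (show s₁ < T y by linarith)).1
    rw [show T y - s₁ = ρ / 2 by rw [hs₁]; ring] at k1
    refine Real.rpow_le_rpow_of_nonpos (by positivity) k1 ?_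
    rw [blowUpExponent]
    have : 0 < 1 / (p - 1) := by positivity
    linarith
  have hb1 : |Φ (y, s₁) - (1 + β) / 2 * (Φ (y, s₁) + Ψ (y, s₁))| ≤ Φ (y, s₁) + Ψ (y, s₁) := by
    have k1 : 0 ≤ (1 + β) / 2 * (Φ (y, s₁) + Ψ (y, s₁)) :=
      mul_nonneg (by linarith) (by linarith [hpos.1, hpos.2])
    have k2 : (1 + β) / 2 * (Φ (y, s₁) + Ψ (y, s₁)) ≤ 1 * (Φ (y, s₁) + Ψ (y, s₁)) :=
      mul_le_mul_of_nonneg_right (by linarith) (by linarith [hpos.1, hpos.2])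
    rw [abs_le]
    constructor <;> linarith [hpos.1, hpos.2]
  have hb2 : 0 ≤ η * (Φ (y, s₁) + Ψ (y, s₁)) := mul_nonneg hη.le (by linarith [hpos.1, hpos.2])
  rw [abs_le] at hb1 ⊢
  constructor <;> linarith [hb1.1, hb1.2]

section limit

variable {x₀ β : ℝ} {l : ℕ → ℝ}

theorem tendsto_rescaleCurve (h : BlowUpRegime p μ θ R Ω Φ Ψ T) (hx₀ : |x₀| < R)
    (hβ : |β| < 1) (hΦ : Tendsto (slopeRatio Φ) (curveFilter T x₀) (𝓝 β))
    (hΨ : Tendsto (slopeRatio Ψ) (curveFilter T x₀) (𝓝 β)) (hl : ∀ n, 0 < l n)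
    (hl0 : Tendsto l atTop (𝓝 0)) (y : ℝ) :
    Tendsto (fun n => rescaleCurve T x₀ (l n) y) atTop (𝓝 (-β * y)) := by
  have h1 : HasDerivAt (fun τ : ℝ => T (x₀ + τ * y)) (-β * y) 0 := by
    have h2 : HasDerivAt (fun τ : ℝ => x₀ + τ * y) y 0 := by
      simpa using ((hasDerivAt_id (0 : ℝ)).mul_const y).const_add x₀
    have h3 : HasDerivAt T (-β) (x₀ + 0 * y) := by
      rw [zero_mul, add_zero]; exact h.hasDerivAt_curve hx₀ hβ hΦ hΨ
    exact h3.comp 0 h2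
  have h2 : Tendsto l atTop (𝓝[>] 0) :=
    tendsto_nhdsWithin_iff.2 ⟨hl0, Eventually.of_forall hl⟩
  refine (h1.tendsto_slope_zero_right.comp h2).congr fun n => ?_
  simp only [Function.comp_apply, zero_add, zero_mul, add_zero, smul_eq_mul, rescaleCurve]
  rw [div_eq_inv_mul]

/-- The distance of the rescaled point to the curve is `l n` times `rescaleCurve - s`, and the
second factor has the positive limit `-β y - s`. -/
theorem tendsto_curveFilter (h : BlowUpRegime p μ θ R Ω Φ Ψ T) (hx₀ : |x₀| < R)
    (hβ : |β| < 1) (hΦ : Tendsto (slopeRatio Φ) (curveFilter T x₀) (𝓝 β))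
    (hΨ : Tendsto (slopeRatio Ψ) (curveFilter T x₀) (𝓝 β)) (hl : ∀ n, 0 < l n)
    (hl0 : Tendsto l atTop (𝓝 0)) {y s : ℝ} (hs : s < -β * y) :
    Tendsto (fun n => (x₀ + l n * y, T x₀ + l n * s)) atTop (curveFilter T x₀) := by
  have h1 := h.tendsto_rescaleCurve hx₀ hβ hΦ hΨ hl hl0 y
  have h2 : ∀ n, T (x₀ + l n * y) - (T x₀ + l n * s) = l n * (rescaleCurve T x₀ (l n) y - s) := by
    intro n
    have := (hl n).ne'
    rw [rescaleCurve]; field_simp; ring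
  rw [curveFilter, tendsto_comap_iff]
  refine Tendsto.prodMk ?_ ?_
  · have := (hl0.mul_const y).const_add x₀
    rwa [zero_mul, add_zero] at this
  · refine tendsto_nhdsWithin_iff.2 ⟨?_, ?_⟩
    · simp only [h2]
      have := hl0.mul (h1.sub_const s)
      rwa [zero_mul] at this
    · filter_upwards [h1.eventually (lt_mem_nhds hs)] with n hn
      simp only [h2, mem_Ioi]
      exact mul_pos (hl n) (by linarith)

/-- The limit of the rescaled sum `Φ + Ψ`. -/
theorem tendsto_rescaled_add (h : BlowUpRegime p μ θ R Ω Φ Ψ T) (hx₀ : |x₀| < R)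
    (hβ : |β| < 1) (hΦ : Tendsto (slopeRatio Φ) (curveFilter T x₀) (𝓝 β))
    (hΨ : Tendsto (slopeRatio Ψ) (curveFilter T x₀) (𝓝 β)) (hl : ∀ n, 0 < l n)
    (hl0 : Tendsto l atTop (𝓝 0)) {y s : ℝ} (hs : s < -β * y) :
    Tendsto (fun n => l n ^ blowUpExponent p * (Φ (x₀ + l n * y, T x₀ + l n * s) +
      Ψ (x₀ + l n * y, T x₀ + l n * s))) atTop
      (𝓝 ((vanishingRate p β * (-β * y - s)) ^ (-blowUpExponent p))) := by
  have hz := h.tendsto_curveFilter hx₀ hβ hΦ hΨ hl hl0 hs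
  have hc : 0 < vanishingRate p β := vanishingRate_pos h.one_lt_p hβ
  -- The main term of the expansion is homogeneous of degree 1, so dividing by `l n` isolates it;
  -- the power `-q` then turns this factor into `l n ^ q`.
  have hg : Tendsto (fun n => invPower p Φ Ψ (x₀ + l n * y, T x₀ + l n * s) / l n) atTop
      (𝓝 (vanishingRate p β * (-β * y - s))) := by
    rw [Metric.tendsto_nhds]
    intro ε hε
    filter_upwards [hz.eventually (h.invPower_expansion hx₀ hβ hΦ hΨ
      (show 0 < ε / (|y| + |s| + 1) by positivity))] with n hn
    have hln := hl n
    simp only [add_sub_cancel_left, abs_mul, abs_of_pos hln] at hn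
    rw [Real.dist_eq]
    have e1 : invPower p Φ Ψ (x₀ + l n * y, T x₀ + l n * s) / l n -
        vanishingRate p β * (-β * y - s) = (invPower p Φ Ψ (x₀ + l n * y, T x₀ + l n * s) -
        vanishingRate p β * (-β * (l n * y) - l n * s)) / l n := by
      field_simp
    rw [e1, abs_div, abs_of_pos hln, div_lt_iff₀ hln]
    refine hn.trans_lt ?_
    calc ε / (|y| + |s| + 1) * (l n * |y| + l n * |s|)
        = ε * l n * ((|y| + |s|) / (|y| + |s| + 1)) := by field_simp
      _ < ε * l n * 1 := by
        apply mul_lt_mul_of_pos_left _ (by positivity)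
        rw [div_lt_one (by positivity)]; linarith
      _ = ε * l n := mul_one _
  have hpos : 0 < vanishingRate p β * (-β * y - s) := mul_pos hc (by linarith)
  refine (hg.rpow_const (p := -blowUpExponent p) (Or.inl hpos.ne')).congr' ?_
  filter_upwards [hz.eventually (h.eventually_mem hx₀)] with n hn
  rw [h.add_eq_invPower_rpow hn.1, Real.div_rpow (h.invPower_pos hn.1).le (hl n).le,
    Real.rpow_neg (hl n).le (blowUpExponent p), div_inv_eq_mul, mul_comm]

/-- The limit of the rescaled component `Φ`. -/
theorem tendsto_rescaled_Φ (h : BlowUpRegime p μ θ R Ω Φ Ψ T) (hx₀ : |x₀| < R)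
    (hβ : |β| < 1) (hΦ : Tendsto (slopeRatio Φ) (curveFilter T x₀) (𝓝 β))
    (hΨ : Tendsto (slopeRatio Ψ) (curveFilter T x₀) (𝓝 β)) (hl : ∀ n, 0 < l n)
    (hl0 : Tendsto l atTop (𝓝 0)) {y s : ℝ} (hs : s < -β * y) :
    Tendsto (fun n => l n ^ blowUpExponent p * Φ (x₀ + l n * y, T x₀ + l n * s)) atTop
      (𝓝 ((1 + β) / 2 * (vanishingRate p β * (-β * y - s)) ^ (-blowUpExponent p))) := by
  have hz := h.tendsto_curveFilter hx₀ hβ hΦ hΨ hl hl0 hs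
  have hw := h.tendsto_rescaled_add hx₀ hβ hΦ hΨ hl hl0 hs
  set W := (vanishingRate p β * (-β * y - s)) ^ (-blowUpExponent p) with hW
  have hW0 : 0 < W := Real.rpow_pos_of_pos
    (mul_pos (vanishingRate_pos h.one_lt_p hβ) (by linarith)) _
  have hq : 0 < blowUpExponent p := by
    have := h.one_lt_p
    rw [blowUpExponent]; exact one_div_pos.2 (by linarith)
  have hlq : Tendsto (fun n => l n ^ blowUpExponent p) atTop (𝓝 0) := by
    have := hl0.rpow_const (p := blowUpExponent p) (Or.inr hq.le)
    rwa [Real.zero_rpow hq.ne'] at this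
  have hdiff : Tendsto (fun n => l n ^ blowUpExponent p * Φ (x₀ + l n * y, T x₀ + l n * s) -
      (1 + β) / 2 * (l n ^ blowUpExponent p * (Φ (x₀ + l n * y, T x₀ + l n * s) +
      Ψ (x₀ + l n * y, T x₀ + l n * s)))) atTop (𝓝 0) := by
    rw [Metric.tendsto_nhds]
    intro ε hε
    obtain ⟨C, hC⟩ := h.fraction_bound hx₀ hβ hΦ hΨ (show 0 < ε / (2 * W) by positivity)
    have hlim := (hw.const_mul (ε / (2 * W))).add (hlq.mul_const C)
    have e0 : ε / (2 * W) * W + 0 * C = ε / 2 := by field_simp; ring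
    rw [e0] at hlim
    filter_upwards [hz.eventually hC, hlim.eventually (gt_mem_nhds (half_lt_self hε))] with n h1 h2
    have h3 : 0 < l n ^ blowUpExponent p := Real.rpow_pos_of_pos (hl n) _
    rw [Real.dist_eq, sub_zero]
    refine lt_of_le_of_lt ?_ h2
    calc _ = l n ^ blowUpExponent p * |Φ (x₀ + l n * y, T x₀ + l n * s) - (1 + β) / 2 *
          (Φ (x₀ + l n * y, T x₀ + l n * s) + Ψ (x₀ + l n * y, T x₀ + l n * s))| := by
          conv_rhs => rw [← abs_of_pos h3, ← abs_mul]
          congr 1; ring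
      _ ≤ l n ^ blowUpExponent p * (ε / (2 * W) * (Φ (x₀ + l n * y, T x₀ + l n * s) +
          Ψ (x₀ + l n * y, T x₀ + l n * s)) + C) := by gcongr
      _ = _ := by ring
  have := hdiff.add (hw.const_mul ((1 + β) / 2))
  rw [zero_add] at this
  exact this.congr fun n => by ring

end limit

end BlowUpRegime

/-- As `1 / (1 - β) + 1 / (1 + β) = 2 / (1 - β²)`, the reciprocal of `vanishingRate` is `2 ^ (p - 1)
* q * (1 - β²)`, the number whose power `q` is the amplitude. -/
theorem profileAmplitude_mul_rpow {p β r : ℝ} (hp : 1 < p) (hβ : |β| < 1) (hr : 0 < r) :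
    profileAmplitude p (-β) * r ^ (-blowUpExponent p) =
      (vanishingRate p β * r) ^ (-blowUpExponent p) := by
  have hβ' := abs_lt.1 hβ
  have h1 : 0 < 1 - β := by linarith
  have h2 : 0 < 1 + β := by linarith
  have h3 : 0 < p - 1 := by linarith
  have hc := BlowUpRegime.vanishingRate_pos hp hβ
  rw [Real.mul_rpow hc.le hr.le, Real.rpow_neg hc.le, ← Real.inv_rpow hc.le, profileAmplitude]
  congr 2
  rw [vanishingRate, blowUpExponent, Real.rpow_sub_one (by norm_num), Real.rpow_neg (by norm_num)]
  field_simp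
  ring

end BlowUpCurve

/-! ### Identification of the blow-up limit -/

open BlowUpCurve

theorem theorem3p6 (p μ γ₁ γ₂ R Tmax : ℝ) (f g : ℝ → ℝ)
    (hA : BlowUpCurve.Assumptions p μ γ₁ γ₂ R Tmax f g)
    (φ ψ : ℝ → ℝ → ℝ) (T : ℝ → ℝ)
    (hsol : BlowUpCurve.IsSolutionWithBlowUpCurve p μ R Tmax f g φ ψ T)
    (x₀ : ℝ) (hx₀ : |x₀| < R)
    (T₀ : ℝ → ℝ) (vφ vψ : ℝ → ℝ → ℝ)
    (hlim : BlowUpCurve.IsBlowUpLimit p φ ψ T x₀ T₀ vφ vψ) :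
    ∃ α : ℝ, -1 < α ∧ α < 1 ∧
      (∀ y, T₀ y = α * y) ∧
      ∀ y s, s < T₀ y →
        vφ y s = BlowUpCurve.profileφ p α y s ∧ vψ y s = BlowUpCurve.profileψ p α y s := by
  obtain ⟨θ, h⟩ := exists_blowUpRegime hA hsol
  obtain ⟨β, hβ, hΦ, hΨ⟩ := h.exists_tendsto_slopeRatio hx₀
  obtain ⟨l, hl, hl0, hT, hφ, hψ⟩ := hlim
  have hβ' := abs_lt.1 hβ
  have hT₀ : ∀ y, T₀ y = -β * y := fun y =>
    tendsto_nhds_unique ((tendstoLocallyUniformlyOn_univ.2 hT).tendsto_at (mem_univ y)) (h.tendsto_rescaleCurve hx₀ hβ hΦ hΨ hl hl0 y)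
  -- `α` is the slope of the curve at `x₀`, opposite to the limit `β` of the slope ratios.
  refine ⟨-β, by linarith, by linarith, hT₀, fun y s hs => ?_⟩
  have hs' : s < -β * y := by rwa [← hT₀]
  have hr : 0 < -β * y - s := by linarith
  have h1 : vφ y s = (1 + β) / 2 * (vanishingRate p β * (-β * y - s)) ^ (-blowUpExponent p) :=
    tendsto_nhds_unique (hφ.tendsto_at (show (y, s) ∈ {z : ℝ × ℝ | z.2 < T₀ z.1} from hs))
      (h.tendsto_rescaled_Φ hx₀ hβ hΦ hΨ hl hl0 hs')
  -- The second component is obtained as the limit of the sum minus that of the first, leaving the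
  -- fraction `(1 - β) / 2`.
  have h2 : vφ y s + vψ y s = (vanishingRate p β * (-β * y - s)) ^ (-blowUpExponent p) :=
    tendsto_nhds_unique ((hφ.tendsto_at (show (y, s) ∈ {z : ℝ × ℝ | z.2 < T₀ z.1} from hs)).add
      (hψ.tendsto_at (show (y, s) ∈ {z : ℝ × ℝ | z.2 < T₀ z.1} from hs)))
      ((h.tendsto_rescaled_add hx₀ hβ hΦ hΨ hl hl0 hs').congr fun n => by
        rw [mul_add]; rfl)
  rw [← profileAmplitude_mul_rpow hA.one_lt_p hβ hr] at h1 h2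
  constructor
  · rw [h1, profileφ]; ring
  · rw [profileψ]
    linear_combination h2 - h1
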